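/- Notation. $\mathbb T^n=\mathbb R^n/2\pi\mathbb Z^n$; functions on $\mathbb T^n$ are $2\pi$-periodic functions on $\mathbb R^n$; for multi-indices $|\alpha|=\sum_i\alpha_i$, $\alpha!=\prod_i\alpha_i!$; for $k\in\mathbb Z^n$, $|k|=\sum_i|k_i|$. For open $D\subset\mathbb R^n$, $G^{\sigma}_{L}(D,\Omega)$ is the set of smooth maps $g:D\to\Omega$ with $\|g\|_{L}:=\sup_{\alpha}\sup_{I\in D}|\partial_I^\alpha g(I)|L^{-|\alpha|}\alpha!^{-\sigma}<\infty$, and $G^{\rho,\mu}(\mathbb T^n\times D)$ is the set of smooth $v:\mathbb T^n\times D\to\mathbb C$ such that, for some $L_1,L_2>0$, $\sup_{\alpha,\beta}\sup_{\mathbb T^n\times D}|\partial_\theta^\alpha\partial_I^\beta v|\,L_1^{-|\alpha|}L_2^{-|\beta|}\alpha!^{-\rho}\beta!^{-\mu}<\infty$. Theorem. Let $\rho\ge 1$, $\tau>n-1$, $\rho'=\rho(\tau+1)+1$, $\mu>\rho'$, $\kappa>0$ and $L_0>0$. There are constants $A_M>0$ $(M\in\mathbb R)$, depending only on $n,\rho,\tau,\mu,\kappa,L_0$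 and $M$, such that the following holds. Let $D,\Omega\subset\mathbb R^n$ be open. Let $f(\theta,I;t)$ be smooth on $\mathbb T^n\times D\times(-1,1)$ with $f(\cdot,\cdot;t)\in G^{\rho,\mu}(\mathbb T^n\times D)$ for each $t$, such that for some $d_0$, some $C\ge 1$ and some $q>0$ $$|\partial_\theta^\alpha\partial_I^\beta f(\theta,I;t)|\le d_0\,C^{|\alpha|+\mu|\beta|}\,\Gamma(\rho|\alpha|+\mu|\beta|+q)$$ for all multi-indices $\alpha,\beta$ and all $(\theta,I,t)\in\mathbb T^n\times D\times(-1,1)$, and such that $\int_{\mathbb T^n}f(\theta,I;t)\,d\theta=0$ for all $I\in D$, $t\in(-1,1)$. Let $\omega(I;t)$ be smooth on $D\times(-1,1)$ with $\omega(\cdot;t)\in G^{\rho'}_{L_0}(D,\Omega)$ for each $t\in(-1,1)$. Put $$\Omega_\kappa=\{w\in\Omega:\ |\langle w,k\rangle|\ge\kappa|k|^{-\tau}\ \text{for all }k\in\mathbb Z^n\setminus\{0\},\ \operatorname{dist}(w,\partial\Omega)\ge\kappa\},\qquad E_\kappa(t)=\{I\in D:\ \omega(I;t)\in\Omega_\kappa\}.$$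 Then there is a function $u(\theta,I;t)$, smooth on $\mathbb T^n\times D\times(-1,1)$, with $u(\cdot,\cdot;t)\in G^{\rho,\mu}(\mathbb T^n\times D)$ for each $t$, such that for every $t\in(-1,1)$ $$\langle\omega(I;t),\partial_\theta\rangle u(\theta,I;t)=f(\theta,I;t)\quad\text{for }(\theta,I)\in\mathbb T^n\times E_\kappa(t),\qquad u(0,I;t)=0\quad\text{for }I\in D,$$ and such that, for every $t\in(-1,1)$ and every $M$ with $\|\omega(\cdot;t)\|_{L_0}\le M$, $$|\partial_\theta^\alpha\partial_I^\beta u(\theta,I;t)|\le A_M\,d_0\,C^{n+\tau+|\alpha|+\mu|\beta|+1}\,\Gamma\big(\rho|\alpha|+\mu|\beta|+\rho(n+\tau+1)+q\big)$$ for all $\alpha,\beta$ and all $(\theta,I)\in\mathbb T^n\times D$. In particular $A_M$ does not depend on $f,d_0,C,q,D,\Omega$ or $t$, and the estimate is uniform in $t$ whenever $\|\omega(\cdot;t)\|_{L_0}$ is bounded in $t$. -/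

import Mathlib

open Set MeasureTheory
open scoped ContDiff

noncomputable section

/-- The partial derivative `∂g/∂xᵢ` of a function on `ℝⁿ`. -/
def partialDeriv {n : ℕ} {F : Type*} [NormedAddCommGroup F] [NormedSpace ℝ F] (i : Fin n)
    (g : EuclideanSpace ℝ (Fin n) → F) : EuclideanSpace ℝ (Fin n) → F :=
  fun x => lineDeriv ℝ g x (EuclideanSpace.single i 1)

/-- The derivative `∂^α g = ∂₁^{α₁} ⋯ ∂ₙ^{αₙ} g` for a multi-index `α`. -/
def multiDeriv {n : ℕ} {F : Type*} [NormedAddCommGroup F] [NormedSpace ℝ F] (α : Fin n → ℕ)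
    (g : EuclideanSpace ℝ (Fin n) → F) : EuclideanSpace ℝ (Fin n) → F :=
  (List.finRange n).foldr (fun i h => (partialDeriv i)^[α i] h) g

/-- The mixed derivative `∂_θ^α ∂_I^β v (θ, I)`. -/
def mixedDeriv {n : ℕ} {F : Type*} [NormedAddCommGroup F] [NormedSpace ℝ F] (α β : Fin n → ℕ)
    (v : EuclideanSpace ℝ (Fin n) → EuclideanSpace ℝ (Fin n) → F)
    (θ I : EuclideanSpace ℝ (Fin n)) : F :=
  multiDeriv α (fun θ' => multiDeriv β (fun I' => v θ' I') I) θ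

/-- The length `|α| = α₁ + ⋯ + αₙ` of a multi-index, as a real number. -/
def multiLength {n : ℕ} (α : Fin n → ℕ) : ℝ := ((∑ i, α i : ℕ) : ℝ)

/-- The factorial `α! = α₁! ⋯ αₙ!` of a multi-index, as a real number. -/
def multiFactorial {n : ℕ} (α : Fin n → ℕ) : ℝ := ((∏ i, (α i).factorial : ℕ) : ℝ)

/-- The Gevrey norm `‖g‖_L = sup_α sup_{x ∈ X} |∂^α g(x)| L^{-|α|} α!^{-ρ}` is at most `M`. -/
def GevreyNormLE {n : ℕ} {F : Type*} [NormedAddCommGroup F] [NormedSpace ℝ F] (ρ L : ℝ)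
    (X : Set (EuclideanSpace ℝ (Fin n))) (g : EuclideanSpace ℝ (Fin n) → F) (M : ℝ) : Prop :=
  ∀ α : Fin n → ℕ, ∀ x ∈ X,
    ‖multiDeriv α g x‖ ≤ M * L ^ multiLength α * multiFactorial α ^ ρ

/-- The Gevrey class `G^ρ_L(X, Y)`. -/
def MemGevrey {n : ℕ} {F : Type*} [NormedAddCommGroup F] [NormedSpace ℝ F] (ρ L : ℝ)
    (X : Set (EuclideanSpace ℝ (Fin n))) (Y : Set F)
    (g : EuclideanSpace ℝ (Fin n) → F) : Prop :=
  ContDiffOn ℝ ∞ g X ∧ MapsTo g X Y ∧ ∃ M : ℝ, GevreyNormLE ρ L X g M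

/-- `v(θ, I)` is `2π`-periodic in every coordinate of `θ` for `I ∈ D`: it is (the lift of) a
function on `𝕋ⁿ × D`, `𝕋ⁿ = ℝⁿ / 2πℤⁿ`. -/
def IsTorusFunction {n : ℕ} (D : Set (EuclideanSpace ℝ (Fin n)))
    (v : EuclideanSpace ℝ (Fin n) → EuclideanSpace ℝ (Fin n) → ℂ) : Prop :=
  ∀ θ, ∀ I ∈ D, ∀ i : Fin n, v (θ + EuclideanSpace.single i (2 * Real.pi)) I = v θ I

/-- The anisotropic Gevrey class `G^{ρ,μ}(𝕋ⁿ × D) = ⋃_{L₁,L₂ > 0} G^{ρ,μ}_{L₁,L₂}(𝕋ⁿ × D)`. -/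
def MemTorusGevrey {n : ℕ} (ρ μ : ℝ) (D : Set (EuclideanSpace ℝ (Fin n)))
    (v : EuclideanSpace ℝ (Fin n) → EuclideanSpace ℝ (Fin n) → ℂ) : Prop :=
  IsTorusFunction D v ∧
  ContDiffOn ℝ ∞ (fun p : EuclideanSpace ℝ (Fin n) × EuclideanSpace ℝ (Fin n) => v p.1 p.2)
    (univ ×ˢ D) ∧
  ∃ L₁ > 0, ∃ L₂ > 0, ∃ M : ℝ, ∀ α β : Fin n → ℕ, ∀ θ, ∀ I ∈ D,
    ‖mixedDeriv α β v θ I‖ ≤ M * L₁ ^ multiLength α * L₂ ^ multiLength β *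
      multiFactorial α ^ ρ * multiFactorial β ^ μ

/-- The integral `∫_{𝕋ⁿ} g(θ) dθ` of a `2π`-periodic function. -/
def integralOverTorus {n : ℕ} (g : EuclideanSpace ℝ (Fin n) → ℂ) : ℂ :=
  ∫ θ in {θ : EuclideanSpace ℝ (Fin n) | ∀ i, θ i ∈ Icc (0 : ℝ) (2 * Real.pi)}, g θ

/-- The operator `⟨w, ∂/∂θ⟩` applied to `g`. -/
def directionalOp {n : ℕ} (w : EuclideanSpace ℝ (Fin n))
    (g : EuclideanSpace ℝ (Fin n) → ℂ) (θ : EuclideanSpace ℝ (Fin n)) : ℂ :=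
  ∑ i, (w i : ℂ) * partialDeriv i g θ

/-- The nonresonant frequencies `Ω_κ`: those `w ∈ Ω` with `|⟨w, k⟩| ≥ κ / |k|^τ` for all
`k ∈ ℤⁿ \ {0}`, where `|k| = |k₁| + ⋯ + |kₙ|`, and with distance at least `κ` from `∂Ω`. -/
def nonresonantFrequencies {n : ℕ} (τ κ : ℝ) (Ω : Set (EuclideanSpace ℝ (Fin n))) :
    Set (EuclideanSpace ℝ (Fin n)) :=
  {w | w ∈ Ω ∧
    (∀ k : Fin n → ℤ, k ≠ 0 → κ / (∑ i, |(k i : ℝ)|) ^ τ ≤ |∑ i, w i * (k i : ℝ)|) ∧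
    ∀ y ∈ frontier Ω, κ ≤ dist w y}

/-- The nonresonant actions `E_κ = {I ∈ D : w(I) ∈ Ω_κ}` of a frequency map `w : D → Ω`. -/
def nonresonantActions {n : ℕ} (τ κ : ℝ) (D Ω : Set (EuclideanSpace ℝ (Fin n)))
    (w : EuclideanSpace ℝ (Fin n) → EuclideanSpace ℝ (Fin n)) :
    Set (EuclideanSpace ℝ (Fin n)) :=
  {I | I ∈ D ∧ w I ∈ nonresonantFrequencies τ κ Ω}

end

/-! Write `f` as the sum of its angle modes `f_k`. Formally the modes of `u` are `f_k / (i⟨ω,k⟩)`,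
and `k = 0` drops out because the mean vanishes. Since `⟨ω,k⟩` may vanish off `E_κ`, the function
`1/x` is replaced by a globally defined `h` of Gevrey class `s > 1` that equals `1/x` for `|x| ≥ κ`
(`exists_gevrey_inverse`). The candidate is `S = ∑ h(|k|^τ⟨ω,k⟩) |k|^τ F_k` with `F = -i f`. On
`E_κ` the small divisor condition reads `|k|^τ|⟨ω,k⟩| ≥ κ`, so there the truncation is invisible and
the equation is exact. Subtracting the value at `θ = 0` normalizes the solution.

The estimate is made mode by mode. Put `K = |k|`. The function `φ = K^τ⟨ω,k⟩` has Gevrey norm at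
most `M K^(τ+1)`, so `i` action derivatives of `h ∘ φ` cost `i!` times a sum of two terms: `(4L)^i
i^(ρ(τ+1)i)`, which is free of `K`, and `(8LMB K^(τ+1))^i i^((s-1)i)`
(`norm_iterLineDeriv_gevrey_comp_le`). The power `K^((τ+1)i)` is paid for by the decay of the
Fourier modes, that is, by `(τ+1)i` further angle derivatives of `f`. They raise the argument of
Gamma by `ρ(τ+1)i`, while the `i` action derivatives which miss `f` lower it by `μi`.

Gamma absorbs the combinatorics: `(N choose i) i! Γ(Y - λi) ≤ Γ(Y) / i!^(λ-1)`
(`choose_mul_factorial_mul_Gamma_le`). The Leibniz sum is then at most `Γ(Y)` times a series `∑ A^i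
i^(σi) / i!^(λ-1)`, convergent for `λ > σ + 1`. The two terms above lead to `(σ, λ) = (ρ(τ+1), μ)`
and `(s-1, μ-ρ(τ+1))`. Both converge when `1 < s < μ - ρ(τ+1)`, and such an `s` exists precisely
because `μ > ρ'`.

Another `n+τ+1` powers of `K` pay for the prefactor `K^τ` and leave `K^(-(n+1))`, which is summable
over `ℤⁿ`; this is the loss `ρ(n+τ+1)` in Gamma. These exponents are not integers, whereas
differentiation gives integer powers only, so one interpolates (`rpow_mul_le_of_forall_pow_mul_le`).
-/

noncomputable section

/-- The iterated directional derivative along a list of vectors; the head of the list is the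
outermost derivative. -/
def iterLineDeriv {V F : Type*} [NormedAddCommGroup V] [NormedSpace ℝ V] [NormedAddCommGroup F]
    [NormedSpace ℝ F] (l : List V) (g : V → F) : V → F :=
  l.foldr (fun v h x => lineDeriv ℝ h x v) g

/-! ### Iterated directional derivatives: symmetry, Leibniz and chain rule bounds -/

section IterLineDeriv

variable {V F G : Type*} [NormedAddCommGroup V] [NormedSpace ℝ V] [NormedAddCommGroup F]
  [NormedSpace ℝ F] [NormedAddCommGroup G] [NormedSpace ℝ G] {W : Set V}

@[simp] theorem iterLineDeriv_nil (g : V → F) : iterLineDeriv [] g = g := rfl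

theorem iterLineDeriv_cons (v : V) (l : List V) (g : V → F) :
    iterLineDeriv (v :: l) g = fun x => lineDeriv ℝ (iterLineDeriv l g) x v := rfl

theorem iterLineDeriv_append (l l' : List V) (g : V → F) :
    iterLineDeriv (l ++ l') g = iterLineDeriv l (iterLineDeriv l' g) := by
  simp [iterLineDeriv, List.foldr_append]

theorem iterLineDeriv_concat (l : List V) (v : V) (g : V → F) :
    iterLineDeriv (l ++ [v]) g = iterLineDeriv l (fun x => lineDeriv ℝ g x v) := by
  rw [iterLineDeriv_append]; rfl

theorem lineDeriv_eqOn (hW : IsOpen W) {g g' : V → F} (h : EqOn g g' W) (v : V) {x : V}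
    (hx : x ∈ W) : lineDeriv ℝ g x v = lineDeriv ℝ g' x v :=
  (h.eventuallyEq_of_mem (hW.mem_nhds hx)).lineDeriv_eq

theorem iterLineDeriv_eqOn (hW : IsOpen W) {g g' : V → F} (h : EqOn g g' W) (l : List V) :
    EqOn (iterLineDeriv l g) (iterLineDeriv l g') W := by
  induction l with
  | nil => exact h
  | cons v l ih => exact fun x hx => lineDeriv_eqOn hW ih v hx

theorem ContDiffOn.differentiableAt_of_isOpen {g : V → F} (hg : ContDiffOn ℝ ∞ g W)
    (hW : IsOpen W) {x : V} (hx : x ∈ W) : DifferentiableAt ℝ g x :=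
  (hg.contDiffAt (hW.mem_nhds hx)).differentiableAt (by simp)

theorem ContDiffOn.lineDeriv_eqOn_fderiv {g : V → F} (hg : ContDiffOn ℝ ∞ g W)
    (hW : IsOpen W) (v : V) :
    EqOn (fun x => lineDeriv ℝ g x v) (fun x => fderiv ℝ g x v) W := fun _ hx =>
  (hg.differentiableAt_of_isOpen hW hx).lineDeriv_eq_fderiv

theorem ContDiffOn.lineDeriv_of_isOpen {g : V → F} (hg : ContDiffOn ℝ ∞ g W) (hW : IsOpen W)
    (v : V) : ContDiffOn ℝ ∞ (fun x => lineDeriv ℝ g x v) W :=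
  ContDiffOn.congr ((hg.fderiv_of_isOpen hW (by simp)).clm_apply contDiffOn_const)
    (hg.lineDeriv_eqOn_fderiv hW v)

theorem ContDiffOn.iterLineDeriv_of_isOpen {g : V → F} (hg : ContDiffOn ℝ ∞ g W)
    (hW : IsOpen W) (l : List V) : ContDiffOn ℝ ∞ (iterLineDeriv l g) W := by
  induction l with
  | nil => exact hg
  | cons v l ih => exact ih.lineDeriv_of_isOpen hW v

theorem lineDeriv_comm_of_isOpen {g : V → F} (hg : ContDiffOn ℝ ∞ g W) (hW : IsOpen W)
    (v w : V) {x : V} (hx : x ∈ W) :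
    lineDeriv ℝ (fun y => lineDeriv ℝ g y w) x v = lineDeriv ℝ (fun y => lineDeriv ℝ g y v) x w := by
  have hd : DifferentiableAt ℝ (fderiv ℝ g) x :=
    (hg.fderiv_of_isOpen hW (m := ∞) (by simp)).differentiableAt_of_isOpen hW hx
  have key : ∀ v w : V, lineDeriv ℝ (fun y => lineDeriv ℝ g y w) x v
      = fderiv ℝ (fderiv ℝ g) x v w := by
    intro v w
    rw [lineDeriv_eqOn hW (hg.lineDeriv_eqOn_fderiv hW w) v hx, DifferentiableAt.lineDeriv_eq_fderiv (hd.clm_apply (differentiableAt_const w)),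
      fderiv_clm_apply hd (differentiableAt_const w)]
    simp
  rw [key, key]
  exact ((hg.contDiffAt (hW.mem_nhds hx)).isSymmSndFDerivAt
    (by simpa using WithTop.coe_le_coe.2 (le_top : (2 : ℕ∞) ≤ ⊤))) v w

/-- A permutation is a product of adjacent swaps, and each swap is the symmetry of the second
derivative. Lists of directions can thus be sorted into multi-indices, or angle directions moved
past action directions, at will. -/
theorem iterLineDeriv_perm {g : V → F} (hg : ContDiffOn ℝ ∞ g W) (hW : IsOpen W) {l l' : List V}
    (h : l.Perm l') : EqOn (iterLineDeriv l g) (iterLineDeriv l' g) W := by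
  induction h with
  | nil => exact fun _ _ => rfl
  | cons v _ ih => exact fun x hx => lineDeriv_eqOn hW ih v hx
  | swap v w l => exact fun x hx =>
      lineDeriv_comm_of_isOpen (hg.iterLineDeriv_of_isOpen hW l) hW w v hx
  | trans _ _ ih₁ ih₂ => exact ih₁.trans ih₂

theorem iterLineDeriv_clm_comp (A : F →L[ℝ] G) {g : V → F} (hg : ContDiffOn ℝ ∞ g W)
    (hW : IsOpen W) (l : List V) :
    ∀ {x : V}, x ∈ W → iterLineDeriv l (fun x => A (g x)) x = A (iterLineDeriv l g x) := by
  induction l with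
  | nil => exact fun _ => rfl
  | cons v l ih =>
    intro x hx
    have hd := (hg.iterLineDeriv_of_isOpen hW l).differentiableAt_of_isOpen hW hx
    simp only [iterLineDeriv_cons]
    rw [lineDeriv_eqOn hW (fun _ => ih) v hx, hd.lineDeriv_eq_fderiv]
    exact ((A.hasFDerivAt.comp x hd.hasFDerivAt).hasLineDerivAt v).lineDeriv

theorem iterLineDeriv_add {f g : V → F} (hf : ContDiffOn ℝ ∞ f W) (hg : ContDiffOn ℝ ∞ g W)
    (hW : IsOpen W) (l : List V) :
    ∀ {x : V}, x ∈ W →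
      iterLineDeriv l (fun x => f x + g x) x = iterLineDeriv l f x + iterLineDeriv l g x := by
  induction l with
  | nil => exact fun _ => rfl
  | cons v l ih =>
    intro x hx
    have hf' := (hf.iterLineDeriv_of_isOpen hW l).differentiableAt_of_isOpen hW hx
    have hg' := (hg.iterLineDeriv_of_isOpen hW l).differentiableAt_of_isOpen hW hx
    simp only [iterLineDeriv_cons]
    rw [lineDeriv_eqOn hW (fun _ => ih) v hx, hf'.lineDeriv_eq_fderiv, hg'.lineDeriv_eq_fderiv]
    exact ((hf'.hasFDerivAt.add hg'.hasFDerivAt).hasLineDerivAt v).lineDeriv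

theorem iterLineDeriv_sub {f g : V → F} (hf : ContDiffOn ℝ ∞ f W) (hg : ContDiffOn ℝ ∞ g W)
    (hW : IsOpen W) (l : List V) {x : V} (hx : x ∈ W) :
    iterLineDeriv l (fun x => f x - g x) x = iterLineDeriv l f x - iterLineDeriv l g x := by
  have h1 := iterLineDeriv_add hf hg.neg hW l hx
  have h2 := iterLineDeriv_clm_comp (-ContinuousLinearMap.id ℝ F) hg hW l hx
  simp only [neg_apply, ContinuousLinearMap.id_apply] at h2
  simp only [sub_eq_add_neg]
  rw [h1, h2]

theorem lineDeriv_smul_of_isOpen {f : V → ℝ} {g : V → F} (hf : ContDiffOn ℝ ∞ f W)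
    (hg : ContDiffOn ℝ ∞ g W) (hW : IsOpen W) (v : V) {x : V} (hx : x ∈ W) :
    lineDeriv ℝ (fun y => f y • g y) x v
      = lineDeriv ℝ f x v • g x + f x • lineDeriv ℝ g x v := by
  have hf' := hf.differentiableAt_of_isOpen hW hx
  have hg' := hg.differentiableAt_of_isOpen hW hx
  rw [hf'.lineDeriv_eq_fderiv, hg'.lineDeriv_eq_fderiv,
    ((hf'.hasFDerivAt.fun_smul hg'.hasFDerivAt).hasLineDerivAt v).lineDeriv]
  simp [add_comm]

theorem norm_iterLineDeriv_lineDeriv_le {g : V → F} {c : ℕ → ℝ} {x v : V} {S : Set V} {N : ℕ}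
    (hv : v ∈ S) (h : ∀ l : List V, (∀ v ∈ l, v ∈ S) → l.length ≤ N + 1 →
      ‖iterLineDeriv l g x‖ ≤ c l.length) :
    ∀ l : List V, (∀ v ∈ l, v ∈ S) → l.length ≤ N →
      ‖iterLineDeriv l (fun x => lineDeriv ℝ g x v) x‖ ≤ c (l.length + 1) := by
  intro l hl hlen
  rw [← iterLineDeriv_concat]
  have := h (l ++ [v]) (by
    intro w hw
    rcases List.mem_append.1 hw with hw | hw
    · exact hl w hw
    · rw [List.mem_singleton.1 hw]; exact hv) (by simpa using hlen)
  simpa using this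

/-- The bounds see a list only through its length, so the Leibniz sum over sublists collapses to a
binomial sum in one variable. The induction peels off the innermost derivative, to which the plain
product rule applies, and Pascal's rule recombines the two halves. -/
theorem norm_iterLineDeriv_smul_le (hW : IsOpen W) {x : V} (hx : x ∈ W) (S : Set V) (l : List V) :
    ∀ {f : V → ℝ} {g : V → F} {a b : ℕ → ℝ}, ContDiffOn ℝ ∞ f W → ContDiffOn ℝ ∞ g W →
    (∀ v ∈ l, v ∈ S) →
    (∀ l' : List V, (∀ v ∈ l', v ∈ S) → l'.length ≤ l.length →
      ‖iterLineDeriv l' f x‖ ≤ a l'.length) →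
    (∀ l' : List V, (∀ v ∈ l', v ∈ S) → l'.length ≤ l.length →
      ‖iterLineDeriv l' g x‖ ≤ b l'.length) →
    ‖iterLineDeriv l (fun y => f y • g y) x‖ ≤
      ∑ i ∈ Finset.range (l.length + 1), (l.length.choose i : ℝ) * (a i * b (l.length - i)) := by
  induction l using List.reverseRecOn with
  | nil =>
    intro f g a b _ _ _ ha hb
    have h1 := ha [] (by simp) le_rfl
    have h2 := hb [] (by simp) le_rfl
    simp only [iterLineDeriv_nil, List.length_nil] at h1 h2
    simpa [norm_smul] using mul_le_mul h1 h2 (norm_nonneg _) ((norm_nonneg _).trans h1)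
  | append_singleton l v ih =>
    intro f g a b hf hg hl ha hb
    have hlS : ∀ w ∈ l, w ∈ S := fun w hw => hl w (by simp [hw])
    have hv : v ∈ S := hl v (by simp)
    have hf' := hf.lineDeriv_of_isOpen hW v
    have hg' := hg.lineDeriv_of_isOpen hW v
    rw [iterLineDeriv_concat, iterLineDeriv_eqOn hW (fun _ => lineDeriv_smul_of_isOpen hf hg hW v) l hx,
      iterLineDeriv_add (f := fun x => lineDeriv ℝ f x v • g x)
        (g := fun x => f x • lineDeriv ℝ g x v) (hf'.smul hg) (hf.smul hg') hW l hx]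
    have h1 := ih hf' hg hlS (a := fun i => a (i + 1)) (norm_iterLineDeriv_lineDeriv_le hv
      (by simpa using ha)) (fun l' hl' hlen => hb l' hl' (by simp; omega))
    have h2 := ih hf hg' hlS (fun l' hl' hlen => ha l' hl' (by simp; omega))
      (b := fun i => b (i + 1)) (norm_iterLineDeriv_lineDeriv_le hv (by simpa using hb))
    refine (norm_add_le _ _).trans ((add_le_add h1 h2).trans ?_)
    rw [List.length_append, List.length_singleton, add_comm]
    have := Finset.sum_choose_succ_mul (fun i j => a i * b j) l.length
    rw [this]
    refine add_le_add (Finset.sum_le_sum fun i hi => ?_) le_rfl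
    rw [Nat.sub_add_comm (Nat.lt_succ_iff.1 (Finset.mem_range.1 hi))]

/-- This arithmetic closes the induction for compositions. The summand `q(N+3)` is the reserve that
makes it inductive: passing to `N+1` adds `q(N+2) + q(N+4) = 2q(N+3)`, which `P ≥ 2` absorbs, while
`4q ≤ P` starts it. -/
theorem sum_mul_pow_le_pow {q P : ℝ} (hq : 0 ≤ q) (hP : P = 2 + 4 * q) (N : ℕ) :
    q * ∑ i ∈ Finset.range (N + 1), ((N - i : ℕ) + 1 : ℝ) * P ^ i + q * (N + 3) ≤ P ^ (N + 1) := by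
  induction N with
  | zero => simp; linarith
  | succ N ih =>
    rw [Finset.sum_range_succ']
    have h1 : ∑ k ∈ Finset.range (N + 1), ((N + 1 - (k + 1) : ℕ) + 1 : ℝ) * P ^ (k + 1)
        = P * ∑ i ∈ Finset.range (N + 1), ((N - i : ℕ) + 1 : ℝ) * P ^ i := by
      rw [Finset.mul_sum]
      refine Finset.sum_congr rfl fun k _ => ?_
      rw [Nat.add_sub_add_right]; ring
    rw [h1]
    have hP0 : 0 ≤ P := by rw [hP]; positivity
    have h2 := mul_le_mul_of_nonneg_left ih hP0
    have h3 : 0 ≤ q * (N + 3) * (P - 2) := by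
      have : 0 ≤ P - 2 := by rw [hP]; linarith
      positivity
    push_cast
    rw [pow_succ P (N + 1), pow_zero]
    nlinarith

theorem choose_mul_factorial_mul_factorial_le {N i : ℕ} (hi : i ≤ N) (j : ℕ) :
    N.choose i * (i + (j + 1)).factorial * (N - i + 1).factorial
      ≤ (N - i + 1) * (N + 1 + j).factorial := by
  have h1 : N.choose i * (N - i).factorial = N.descFactorial (N - i) := by
    rw [Nat.descFactorial_eq_factorial_mul_choose, Nat.choose_symm hi, mul_comm]
  have h2 : (i + (j + 1)).factorial * (N + 1 + j).descFactorial (N - i)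
      = (N + 1 + j).factorial := by
    have := Nat.factorial_mul_descFactorial (n := N + 1 + j) (k := N - i) (by omega)
    rwa [show N + 1 + j - (N - i) = i + (j + 1) by omega] at this
  rw [Nat.factorial_succ, ← h2]
  calc _ = (N - i + 1) * ((i + (j + 1)).factorial * (N.choose i * (N - i).factorial)) := by ring
    _ ≤ _ := by
      rw [h1]
      gcongr
      omega

theorem lineDeriv_comp_of_isOpen (hW : IsOpen W) {φ : V → ℝ} (hφ : ContDiffOn ℝ ∞ φ W)
    {h h' : ℝ → ℝ} (hh : ContDiff ℝ ∞ h) (hder : ∀ y, deriv h y = h' y) (v : V) {y : V}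
    (hy : y ∈ W) :
    lineDeriv ℝ (fun y => h (φ y)) y v = h' (φ y) • lineDeriv ℝ φ y v := by
  have h1 := hφ.differentiableAt_of_isOpen hW hy
  have h2 : HasDerivAt h (h' (φ y)) (φ y) := by
    rw [← hder]
    exact (hh.differentiable (by simp)).differentiableAt.hasDerivAt
  have h3 := ((h2.comp_hasFDerivAt y h1.hasFDerivAt).hasLineDerivAt v).lineDeriv
  rw [Function.comp_def] at h3
  rw [h3, h1.lineDeriv_eq_fderiv]
  simp

/-- A substitute for the Faà di Bruno formula. One derivative of `h_j ∘ φ` is `h_(j+1) ∘ φ` times a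
derivative of `φ`, so the bound is proved for all `j` at once by strong induction on the order,
through the Leibniz bound. Only orders at most `b` enter, which later allows the constants to depend
on `b`. The value of `φ` itself is never estimated, hence the restriction to nonempty lists. -/
theorem norm_iterLineDeriv_comp_le (hW : IsOpen W) {x : V} (hx : x ∈ W) (S : Set V) (b : ℕ)
    {h : ℕ → ℝ → ℝ} {φ : V → ℝ} (hφ : ContDiffOn ℝ ∞ φ W) (hh : ∀ j, ContDiff ℝ ∞ (h j))
    (hder : ∀ j y, deriv (h j) y = h (j + 1) y) {A H a d : ℝ} (hA : 0 ≤ A) (hH : 0 ≤ H)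
    (ha : 0 ≤ a) (hd : 0 ≤ d)
    (hbound : ∀ j ≤ b, |h j (φ x)| ≤ A * H ^ j * j.factorial)
    (hφb : ∀ l : List V, (∀ v ∈ l, v ∈ S) → l ≠ [] → l.length ≤ b →
      |iterLineDeriv l φ x| ≤ a * l.length.factorial * d ^ l.length) (l : List V) :
    ∀ j, (∀ v ∈ l, v ∈ S) → l.length + j ≤ b → |iterLineDeriv l (fun y => h j (φ y)) x| ≤
      A * H ^ j * (l.length + j).factorial * (d * (2 + 4 * (a * H))) ^ l.length := by
  induction hN : l.length using Nat.strong_induction_on generalizing l with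
  | _ N ih =>
  intro j hlS hlen
  rcases List.eq_nil_or_concat' l with rfl | ⟨l, v, rfl⟩
  · simp at hN
    subst hN
    simpa using hbound j (by simpa using hlen)
  obtain ⟨N, rfl⟩ : ∃ M, N = M + 1 := ⟨l.length, by simpa using hN.symm⟩
  have hlN : l.length = N := by simpa using hN
  have hv : v ∈ S := hlS v (by simp)
  have hlS' : ∀ w ∈ l, w ∈ S := fun w hw => hlS w (by simp [hw])
  set P := 2 + 4 * (a * H) with hP
  have hP0 : 0 ≤ P := by positivity
  rw [iterLineDeriv_concat, iterLineDeriv_eqOn hW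
    (fun _ => lineDeriv_comp_of_isOpen hW hφ (hh j) (hder j) v) l hx, ← Real.norm_eq_abs]
  refine (norm_iterLineDeriv_smul_le hW hx S l
    (a := fun i => A * H ^ (j + 1) * (i + (j + 1)).factorial * (d * P) ^ i)
    (b := fun i => a * (i + 1).factorial * d ^ (i + 1))
    ((hh (j + 1)).comp_contDiffOn hφ) (hφ.lineDeriv_of_isOpen hW v) hlS' ?_ ?_).trans ?_
  · intro l' hl' hlen'
    exact ih l'.length (by omega) l' rfl (j + 1) hl' (by omega)
  · intro l' hl' hlen'
    rw [← iterLineDeriv_concat, Real.norm_eq_abs]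
    have := hφb (l' ++ [v]) (by
      intro w hw
      rcases List.mem_append.1 hw with hw | hw
      · exact hl' w hw
      · rw [List.mem_singleton.1 hw]; exact hv) (by simp) (by simp; omega)
    simpa using this
  · rw [hlN]
    -- All factorials merge into `(N+1+j)!` with a leftover factor `N-i+1`; what remains is the sum
    -- treated by `sum_mul_pow_le_pow` with `q = aH`.
    have hterm : ∀ i ∈ Finset.range (N + 1), (N.choose i : ℝ) *
        ((A * H ^ (j + 1) * (i + (j + 1)).factorial * (d * P) ^ i) *
          (a * (N - i + 1).factorial * d ^ (N - i + 1)))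
        ≤ A * H ^ j * (N + 1 + j).factorial * d ^ (N + 1) *
          ((a * H) * (((N - i : ℕ) + 1 : ℝ) * P ^ i)) := by
      intro i hi
      have hi' : i ≤ N := Nat.lt_succ_iff.1 (Finset.mem_range.1 hi)
      have h1 : (N.choose i : ℝ) * (i + (j + 1)).factorial * (N - i + 1).factorial
          ≤ ((N - i : ℕ) + 1 : ℝ) * (N + 1 + j).factorial := by
        exact_mod_cast choose_mul_factorial_mul_factorial_le hi' j
      have h2 : d ^ (N + 1) = d ^ i * d ^ (N - i + 1) := by
        rw [← pow_add]; congr 1; omega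
      have h3 : 0 ≤ A * H ^ (j + 1) * a * P ^ i * d ^ (N + 1) := by positivity
      have h4 := mul_le_mul_of_nonneg_right h1 h3
      rw [h2] at h4 ⊢
      rw [mul_pow]
      refine le_of_eq_of_le ?_ (h4.trans_eq ?_) <;> ring
    refine (Finset.sum_le_sum hterm).trans ?_
    rw [← Finset.mul_sum, ← Finset.mul_sum, mul_pow, ← mul_assoc]
    have h5 := sum_mul_pow_le_pow (mul_nonneg ha hH) hP N
    have h6 : 0 ≤ a * H * ((N : ℝ) + 3) := by positivity
    rw [mul_assoc, mul_assoc (A * H ^ j * ((N + 1 + j).factorial : ℝ))]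
    gcongr
    linarith

end IterLineDeriv

/-! ### Families of smooth functions with summable derivatives -/

section Families

open Filter Topology

variable {V F ι : Type*} [NormedAddCommGroup V] [NormedSpace ℝ V] [NormedAddCommGroup F]
  [NormedSpace ℝ F] {W : Set V}

/-- The derivatives of order at most `m` of the family `φ` are bounded, locally uniformly on `W`,
by a constant multiple of the weight `w`. -/
def LocallyBoundedBy (W : Set V) (w : ι → ℝ) : ℕ → (ι → V → F) → Prop
  | 0, φ => ∀ x ∈ W, ∃ C : ℝ, ∀ᶠ y in 𝓝 x, ∀ k, ‖φ k y‖ ≤ C * w k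
  | m + 1, φ => (∀ x ∈ W, ∃ C : ℝ, ∀ᶠ y in 𝓝 x, ∀ k, ‖φ k y‖ ≤ C * w k) ∧
      ∀ v, LocallyBoundedBy W w m (fun k x => lineDeriv ℝ (φ k) x v)

namespace LocallyBoundedBy

variable {w w' : ι → ℝ} {m : ℕ} {φ ψ : ι → V → F}

theorem pred (h : LocallyBoundedBy W w (m + 1) φ) : LocallyBoundedBy W w m φ := by
  induction m generalizing φ with
  | zero => exact h.1
  | succ m ih => exact ⟨h.1, fun v => ih (h.2 v)⟩

theorem mono_weight (h : LocallyBoundedBy W w m φ) (hw : ∀ k, 0 ≤ w k) {c : ℝ}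
    (hw' : ∀ k, w k ≤ c * w' k) : LocallyBoundedBy W w' m φ := by
  have key : ∀ {φ : ι → V → F}, LocallyBoundedBy W w 0 φ → LocallyBoundedBy W w' 0 φ := by
    intro φ h x hx
    obtain ⟨C, hC⟩ := h x hx
    refine ⟨|C| * c, hC.mono fun y hy k => (hy k).trans ?_⟩
    calc C * w k ≤ |C| * w k := by gcongr; exacts [hw k, le_abs_self C]
      _ ≤ |C| * (c * w' k) := by gcongr; exact hw' k
      _ = _ := by ring
  induction m generalizing φ with
  | zero => exact key h
  | succ m ih => exact ⟨key h.1, fun v => ih (h.2 v)⟩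

theorem congr (h : LocallyBoundedBy W w m φ) (hW : IsOpen W) (he : ∀ k, EqOn (ψ k) (φ k) W) :
    LocallyBoundedBy W w m ψ := by
  have key : ∀ {φ ψ : ι → V → F}, LocallyBoundedBy W w 0 φ → (∀ k, EqOn (ψ k) (φ k) W) →
      LocallyBoundedBy W w 0 ψ := by
    intro φ ψ h he x hx
    obtain ⟨C, hC⟩ := h x hx
    refine ⟨C, ?_⟩
    filter_upwards [hC, hW.mem_nhds hx] with y hy hyW k
    rw [he k hyW]
    exact hy k
  induction m generalizing φ ψ with
  | zero => exact key h he
  | succ m ih =>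
    exact ⟨key h.1 he, fun v => ih (h.2 v) fun k x hx => lineDeriv_eqOn hW (he k) v hx⟩

theorem add (h : LocallyBoundedBy W w m φ) (h' : LocallyBoundedBy W w m ψ) (hW : IsOpen W)
    (hφ : ∀ k, ContDiffOn ℝ ∞ (φ k) W) (hψ : ∀ k, ContDiffOn ℝ ∞ (ψ k) W) :
    LocallyBoundedBy W w m (fun k x => φ k x + ψ k x) := by
  have key : ∀ {φ ψ : ι → V → F}, LocallyBoundedBy W w 0 φ → LocallyBoundedBy W w 0 ψ →
      LocallyBoundedBy W w 0 (fun k x => φ k x + ψ k x) := by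
    intro φ ψ h h' x hx
    obtain ⟨C, hC⟩ := h x hx
    obtain ⟨C', hC'⟩ := h' x hx
    refine ⟨C + C', ?_⟩
    filter_upwards [hC, hC'] with y hy hy' k
    rw [add_mul]
    exact (norm_add_le _ _).trans (add_le_add (hy k) (hy' k))
  induction m generalizing φ ψ with
  | zero => exact key h h'
  | succ m ih =>
    refine ⟨key h.1 h'.1, fun v => ?_⟩
    refine (ih (h.2 v) (h'.2 v) (fun k => (hφ k).lineDeriv_of_isOpen hW v)
      (fun k => (hψ k).lineDeriv_of_isOpen hW v)).congr hW fun k x hx => ?_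
    exact iterLineDeriv_add (hφ k) (hψ k) hW [v] hx

theorem smul {f : ι → V → ℝ} (h : LocallyBoundedBy W w m f) (h' : LocallyBoundedBy W w' m φ)
    (hW : IsOpen W) (hf : ∀ k, ContDiffOn ℝ ∞ (f k) W) (hφ : ∀ k, ContDiffOn ℝ ∞ (φ k) W) :
    LocallyBoundedBy W (fun k => w k * w' k) m (fun k x => f k x • φ k x) := by
  have key : ∀ {f : ι → V → ℝ} {φ : ι → V → F}, LocallyBoundedBy W w 0 f →
      LocallyBoundedBy W w' 0 φ →
      LocallyBoundedBy W (fun k => w k * w' k) 0 (fun k x => f k x • φ k x) := by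
    intro f φ h h' x hx
    obtain ⟨C, hC⟩ := h x hx
    obtain ⟨C', hC'⟩ := h' x hx
    refine ⟨C * C', ?_⟩
    filter_upwards [hC, hC'] with y hy hy' k
    rw [norm_smul]
    calc _ ≤ (C * w k) * (C' * w' k) :=
          mul_le_mul (hy k) (hy' k) (norm_nonneg _) ((norm_nonneg _).trans (hy k))
      _ = _ := by ring
  induction m generalizing f φ with
  | zero => exact key h h'
  | succ m ih =>
    refine ⟨key h.1 h'.1, fun v => ?_⟩
    have hf' := fun k => (hf k).lineDeriv_of_isOpen hW v
    have hφ' := fun k => (hφ k).lineDeriv_of_isOpen hW v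
    refine ((ih (h.2 v) h'.pred hf' hφ).add (ih h.pred (h'.2 v) hf hφ') hW
      (fun k => (hf' k).smul (hφ k)) (fun k => (hf k).smul (hφ' k))).congr hW fun k x hx => ?_
    exact lineDeriv_smul_of_isOpen (hf k) (hφ k) hW v hx

/-- Each differentiation brings out at most one more derivative of `f`, hence one more factor `w`,
while the derivatives of `h` stay bounded. A polynomial loss in `w` is harmless for smoothness,
since Fourier modes decay faster than any power. -/
theorem comp {f : ι → V → ℝ} (hf : ∀ m, LocallyBoundedBy W w m f) (hW : IsOpen W)
    (hw : ∀ k, 1 ≤ w k) (hfs : ∀ k, ContDiffOn ℝ ∞ (f k) W) {h : ℕ → ℝ → ℝ}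
    (hh : ∀ j, ContDiff ℝ ∞ (h j)) (hder : ∀ j y, deriv (h j) y = h (j + 1) y)
    (hb : ∀ j, ∃ C : ℝ, ∀ y, |h j y| ≤ C) (m : ℕ) :
    ∀ j, LocallyBoundedBy W (fun k => w k ^ m) m (fun k x => h j (f k x)) := by
  have key : ∀ m j, LocallyBoundedBy W (fun k => w k ^ m) 0 (fun k x => h j (f k x)) := by
    intro m j x _
    obtain ⟨C, hC⟩ := hb j
    refine ⟨C, .of_forall fun y k => (hC _).trans ?_⟩
    exact le_mul_of_one_le_right ((abs_nonneg _).trans (hC 0)) (one_le_pow₀ (hw k))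
  induction m with
  | zero => exact key 0
  | succ m ih =>
    refine fun j => ⟨key (m + 1) j, fun v => ?_⟩
    have h1 := (ih (j + 1)).smul ((hf (m + 1)).2 v) hW
      (fun k => (hh (j + 1)).comp_contDiffOn (hfs k)) (fun k => (hfs k).lineDeriv_of_isOpen hW v)
    simp only [← pow_succ] at h1
    exact h1.congr hW fun k x hx => lineDeriv_comp_of_isOpen hW (hfs k) (hh j) (hder j) v hx

end LocallyBoundedBy

/-- If differentiating `S g` amounts to replacing the datum `g` by another admissible datum, then
all the functions `S g` are smooth. -/
theorem contDiffOn_of_lineDeriv_closed [FiniteDimensional ℝ V] {T : Type*} (hW : IsOpen W)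
    (S : T → V → F) (D : V → T → T) (p : T → Prop) (hp : ∀ v g, p g → p (D v g))
    (hd : ∀ g, p g → ∀ x ∈ W, DifferentiableAt ℝ (S g) x)
    (h : ∀ v g, p g → ∀ x ∈ W, lineDeriv ℝ (S g) x v = S (D v g) x) {g : T} (hg : p g) :
    ContDiffOn ℝ ∞ (S g) W := by
  refine contDiffOn_infty.2 fun m => ?_
  induction m generalizing g with
  | zero =>
    exact contDiffOn_zero.2 fun x hx => (hd g hg x hx).continuousAt.continuousWithinAt
  | succ m ih =>
    push_cast
    rw [contDiffOn_succ_iff_fderiv_apply hW.uniqueDiffOn]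
    refine ⟨fun x hx => (hd g hg x hx).differentiableWithinAt, by simp, fun v => ?_⟩
    refine (ih (hp v g hg)).congr fun x hx => ?_
    rw [fderivWithin_of_isOpen hW hx, ← (hd g hg x hx).lineDeriv_eq_fderiv, h v g hg x hx]

section Tsum

variable {w : ι → ℝ}

/-- A family of smooth functions whose derivatives are dominated by a summable weight. -/
def SummableFamily (W : Set V) (w : ι → ℝ) (φ : ι → V → F) : Prop :=
  (∀ k, ContDiffOn ℝ ∞ (φ k) W) ∧ ∀ m, LocallyBoundedBy W w m φ

theorem SummableFamily.lineDeriv {φ : ι → V → F} (h : SummableFamily W w φ) (hW : IsOpen W)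
    (v : V) : SummableFamily W w (fun k x => lineDeriv ℝ (φ k) x v) :=
  ⟨fun k => (h.1 k).lineDeriv_of_isOpen hW v, fun m => (h.2 (m + 1)).2 v⟩

theorem SummableFamily.iterLineDeriv {φ : ι → V → F} (h : SummableFamily W w φ) (hW : IsOpen W)
    (l : List V) : SummableFamily W w (fun k => iterLineDeriv l (φ k)) := by
  induction l with
  | nil => exact h
  | cons v l ih => exact ih.lineDeriv hW v

theorem SummableFamily.summable [CompleteSpace F] {φ : ι → V → F} (h : SummableFamily W w φ) (hw : Summable w)
    {x : V} (hx : x ∈ W) : Summable fun k => φ k x := by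
  obtain ⟨C, hC⟩ := h.2 0 x hx
  exact Summable.of_norm_bounded (hw.mul_left C) hC.self_of_nhds

variable [FiniteDimensional ℝ V] [CompleteSpace F]

theorem SummableFamily.hasFDerivAt_tsum {φ : ι → V → F} (h : SummableFamily W w φ)
    (hW : IsOpen W) (hw : Summable w) (hw0 : ∀ k, 0 ≤ w k) {x : V} (hx : x ∈ W) :
    HasFDerivAt (fun y => ∑' k, φ k y) (∑' k, fderiv ℝ (φ k) x) x ∧
      Summable fun k => fderiv ℝ (φ k) x := by
  let b := Module.finBasis ℝ V
  -- The hypotheses control directional derivatives one direction at a time. In finite dimension the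
  -- values on a basis control the operator norm, with a constant independent of the index of the
  -- family.
  obtain ⟨K, hK0, hK⟩ := b.exists_opNorm_le (F := F)
  have h1 : ∀ i, ∃ C : ℝ, ∀ᶠ y in 𝓝 x, ∀ k, ‖_root_.lineDeriv ℝ (φ k) y (b i)‖ ≤ C * w k :=
    fun i => (h.lineDeriv hW (b i)).2 0 x hx
  choose C hC using h1
  obtain ⟨ε, hε, hball⟩ := Metric.eventually_nhds_iff_ball.1
    ((eventually_all.2 hC).and (hW.mem_nhds hx))
  have hder : ∀ k, ∀ y ∈ Metric.ball x ε, HasFDerivAt (φ k) (fderiv ℝ (φ k) y) y := fun k y hy =>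
    ((h.1 k).differentiableAt_of_isOpen hW (hball y hy).2).hasFDerivAt
  have hb : ∀ k, ∀ y ∈ Metric.ball x ε,
      ‖fderiv ℝ (φ k) y‖ ≤ K * ((∑ i, |C i|) * w k) := by
    intro k y hy
    refine hK (mul_nonneg (Finset.sum_nonneg fun i _ => abs_nonneg _) (hw0 k)) fun i => ?_
    rw [← (hder k y hy).differentiableAt.lineDeriv_eq_fderiv]
    refine ((hball y hy).1 i k).trans (mul_le_mul_of_nonneg_right ?_ (hw0 k))
    exact (le_abs_self _).trans
      (Finset.single_le_sum (f := fun i => |C i|) (fun i _ => abs_nonneg _) (Finset.mem_univ i))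
  have hsum : Summable fun k => K * ((∑ i, |C i|) * w k) := (hw.mul_left _).mul_left _
  exact ⟨hasFDerivAt_tsum_of_isPreconnected hsum Metric.isOpen_ball
      (convex_ball x ε).isPreconnected hder hb (Metric.mem_ball_self hε) (h.summable hw hx)
      (Metric.mem_ball_self hε),
    Summable.of_norm_bounded hsum fun k => hb k x (Metric.mem_ball_self hε)⟩

theorem SummableFamily.lineDeriv_tsum {φ : ι → V → F} (h : SummableFamily W w φ)
    (hW : IsOpen W) (hw : Summable w) (hw0 : ∀ k, 0 ≤ w k) (v : V) {x : V} (hx : x ∈ W) :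
    _root_.lineDeriv ℝ (fun y => ∑' k, φ k y) x v = ∑' k, _root_.lineDeriv ℝ (φ k) x v := by
  obtain ⟨h1, h2⟩ := h.hasFDerivAt_tsum hW hw hw0 hx
  rw [(h1.hasLineDerivAt v).lineDeriv]
  refine ((ContinuousLinearMap.apply ℝ F v).map_tsum h2).trans (tsum_congr fun k => ?_)
  exact ((h.1 k).differentiableAt_of_isOpen hW hx).lineDeriv_eq_fderiv.symm

theorem SummableFamily.contDiffOn_tsum {φ : ι → V → F} (h : SummableFamily W w φ)
    (hW : IsOpen W) (hw : Summable w) (hw0 : ∀ k, 0 ≤ w k) :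
    ContDiffOn ℝ ∞ (fun y => ∑' k, φ k y) W :=
  contDiffOn_of_lineDeriv_closed hW (fun (φ : ι → V → F) y => ∑' k, φ k y)
    (fun v φ k x => _root_.lineDeriv ℝ (φ k) x v) (SummableFamily W w)
    (fun v _ h => h.lineDeriv hW v)
    (fun _ h _ hx => (h.hasFDerivAt_tsum hW hw hw0 hx).1.differentiableAt)
    (fun v _ h _ hx => h.lineDeriv_tsum hW hw hw0 v hx) h

theorem SummableFamily.iterLineDeriv_tsum {φ : ι → V → F} (h : SummableFamily W w φ)
    (hW : IsOpen W) (hw : Summable w) (hw0 : ∀ k, 0 ≤ w k) (l : List V) :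
    EqOn (_root_.iterLineDeriv l (fun y => ∑' k, φ k y))
      (fun x => ∑' k, _root_.iterLineDeriv l (φ k) x) W := by
  induction l with
  | nil => exact fun _ _ => rfl
  | cons v l ih =>
    intro x hx
    simp only [iterLineDeriv_cons]
    rw [lineDeriv_eqOn hW ih v hx, (h.iterLineDeriv hW l).lineDeriv_tsum hW hw hw0 v hx]

end Tsum

end Families

/-! ### Fourier modes in the angles and differentiation under the integral -/

section FourierModes

open Filter Topology UnitAddTorus

variable {n : ℕ} {P : Type*} [NormedAddCommGroup P]

/-- The representative in `(0, 2π]ⁿ` of a point of the torus. -/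
def torusRep (y : UnitAddTorus (Fin n)) : EuclideanSpace ℝ (Fin n) :=
  WithLp.toLp 2 fun i => 2 * Real.pi * (AddCircle.equivIoc (1 : ℝ) 0 (y i) : ℝ)

theorem torusRep_apply (y : UnitAddTorus (Fin n)) (i : Fin n) :
    torusRep y i = 2 * Real.pi * (AddCircle.equivIoc (1 : ℝ) 0 (y i) : ℝ) := rfl

theorem measurable_torusRep : Measurable (torusRep (n := n)) := by
  refine (WithLp.measurable_toLp 2 _).comp (measurable_pi_lambda _ fun i => ?_)
  exact measurable_const.mul (measurable_subtype_coe.comp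
    ((AddCircle.measurableEquivIoc 1 0).measurable.comp (measurable_pi_apply i)))

theorem exists_isCompact_torusRep_mem :
    ∃ K : Set (EuclideanSpace ℝ (Fin n)), IsCompact K ∧ ∀ y, torusRep y ∈ K := by
  refine ⟨WithLp.toLp 2 '' Set.pi univ fun _ : Fin n => Icc (0 : ℝ) (2 * Real.pi),
    (isCompact_univ_pi fun _ => isCompact_Icc).image (PiLp.continuous_toLp 2 _),
    fun y => ⟨_, fun i _ => ?_, rfl⟩⟩
  have h := (AddCircle.equivIoc (1 : ℝ) 0 (y i)).2
  have hpi := Real.pi_pos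
  constructor
  · exact mul_nonneg (by positivity) h.1.le
  · have := h.2
    nlinarith

/-- The normalized Haar measure of the torus. -/
def torusMeasure (n : ℕ) : Measure (UnitAddTorus (Fin n)) :=
  Measure.pi fun _ => AddCircle.haarAddCircle

instance : IsProbabilityMeasure (torusMeasure n) := by
  unfold torusMeasure; infer_instance

instance : (torusMeasure n).IsAddRightInvariant := by
  unfold torusMeasure; infer_instance

/-- The component of frequency `k`, with respect to the angle variables, of a function which is
periodic in these variables. -/
def fourierMode (k : Fin n → ℤ) (F : EuclideanSpace ℝ (Fin n) × P → ℂ)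
    (x : EuclideanSpace ℝ (Fin n) × P) : ℂ :=
  ∫ y, mFourier (-k) y * F (x + (torusRep y, 0)) ∂(torusMeasure n)

theorem fourierMode_eq_mFourierCoeff (k : Fin n → ℤ) (F : EuclideanSpace ℝ (Fin n) × P → ℂ)
    (x : EuclideanSpace ℝ (Fin n) × P) :
    fourierMode k F x = mFourierCoeff (fun y => F (x + (torusRep y, 0))) k := rfl

theorem norm_mFourier_apply (k : Fin n → ℤ) (y : UnitAddTorus (Fin n)) : ‖mFourier k y‖ = 1 := by
  simp only [mFourier, ContinuousMap.coe_mk, norm_prod, fourier_apply, Circle.norm_coe,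
    Finset.prod_const_one]

variable {U : Set P} {H : Type*} [NormedAddCommGroup H]

theorem add_prod_zero_mem {x : EuclideanSpace ℝ (Fin n) × P}
    (hx : x ∈ (univ : Set (EuclideanSpace ℝ (Fin n))) ×ˢ U) (z : EuclideanSpace ℝ (Fin n)) :
    x + (z, 0) ∈ (univ : Set (EuclideanSpace ℝ (Fin n))) ×ˢ U := by
  simpa using hx

/-- This supplies the dominating constant for differentiation under the integral. A compact
neighbourhood of `x`, translated by the compact cube of representatives, is a compact subset of the
domain. -/
theorem exists_bound_torusRep [NormedSpace ℝ P] [FiniteDimensional ℝ P]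
    {G : EuclideanSpace ℝ (Fin n) × P → H} (hU : IsOpen U)
    (hG : ContinuousOn G ((univ : Set (EuclideanSpace ℝ (Fin n))) ×ˢ U))
    {x : EuclideanSpace ℝ (Fin n) × P} (hx : x ∈ (univ : Set (EuclideanSpace ℝ (Fin n))) ×ˢ U) :
    ∃ C, ∀ᶠ x' in 𝓝 x, x' ∈ (univ : Set (EuclideanSpace ℝ (Fin n))) ×ˢ U ∧
      ∀ y, ‖G (x' + (torusRep y, 0))‖ ≤ C := by
  have : ProperSpace P := FiniteDimensional.proper ℝ P
  obtain ⟨K, hK, hKy⟩ := exists_isCompact_torusRep_mem (n := n)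
  obtain ⟨N, hN, hxN, hNU⟩ := exists_compact_subset (isOpen_univ.prod hU) hx
  have hcomp : IsCompact ((fun q : (EuclideanSpace ℝ (Fin n) × P) × EuclideanSpace ℝ (Fin n) =>
      q.1 + (q.2, 0)) '' (N ×ˢ K)) :=
    (hN.prod hK).image (by fun_prop)
  obtain ⟨C, hC⟩ := hcomp.exists_bound_of_continuousOn (f := G) (hG.mono (by
    rintro _ ⟨q, hq, rfl⟩
    exact add_prod_zero_mem (hNU hq.1) _))
  refine ⟨C, ?_⟩
  filter_upwards [mem_interior_iff_mem_nhds.1 hxN] with x' hx'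
  exact ⟨hNU hx', fun y => hC _ ⟨(x', torusRep y), ⟨hx', hKy y⟩, rfl⟩⟩

theorem aestronglyMeasurable_mul_torusRep [NormedSpace ℂ H] (k : Fin n → ℤ)
    {G : EuclideanSpace ℝ (Fin n) × P → H}
    (hG : ContinuousOn G ((univ : Set (EuclideanSpace ℝ (Fin n))) ×ˢ U))
    {x : EuclideanSpace ℝ (Fin n) × P} (hx : x ∈ (univ : Set (EuclideanSpace ℝ (Fin n))) ×ˢ U) :
    AEStronglyMeasurable (fun y => mFourier k y • G (x + (torusRep y, 0))) (torusMeasure n) := by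
  have h1 : Continuous fun z : EuclideanSpace ℝ (Fin n) => G (x + (z, 0)) :=
    hG.comp_continuous (by fun_prop) fun z => add_prod_zero_mem hx z
  exact ((map_continuous (mFourier k)).stronglyMeasurable.smul
    (h1.stronglyMeasurable.comp_measurable measurable_torusRep)).aestronglyMeasurable

theorem integrable_mul_torusRep [NormedSpace ℂ H] (k : Fin n → ℤ)
    {G : EuclideanSpace ℝ (Fin n) × P → H}
    (hG : ContinuousOn G ((univ : Set (EuclideanSpace ℝ (Fin n))) ×ˢ U))
    {x : EuclideanSpace ℝ (Fin n) × P} (hx : x ∈ (univ : Set (EuclideanSpace ℝ (Fin n))) ×ˢ U)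
    {C : ℝ} (hC : ∀ y, ‖G (x + (torusRep y, 0))‖ ≤ C) :
    Integrable (fun y => mFourier k y • G (x + (torusRep y, 0))) (torusMeasure n) := by
  refine Integrable.of_bound (aestronglyMeasurable_mul_torusRep k hG hx) C
    (.of_forall fun y => ?_)
  rw [norm_smul, norm_mFourier_apply, one_mul]
  exact hC y

variable [NormedSpace ℝ P] [FiniteDimensional ℝ P]

theorem hasFDerivAt_fourierMode (hU : IsOpen U) (k : Fin n → ℤ)
    {F : EuclideanSpace ℝ (Fin n) × P → ℂ}
    (hF : ContDiffOn ℝ ∞ F ((univ : Set (EuclideanSpace ℝ (Fin n))) ×ˢ U))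
    {x : EuclideanSpace ℝ (Fin n) × P} (hx : x ∈ (univ : Set (EuclideanSpace ℝ (Fin n))) ×ˢ U) :
    DifferentiableAt ℝ (fourierMode k F) x ∧
      ∀ v, lineDeriv ℝ (fourierMode k F) x v
        = fourierMode k (fun x => lineDeriv ℝ F x v) x := by
  have hW : IsOpen ((univ : Set (EuclideanSpace ℝ (Fin n))) ×ˢ U) := isOpen_univ.prod hU
  have hF' := hF.fderiv_of_isOpen hW (m := ∞) (by simp)
  obtain ⟨C₀, hC₀⟩ := exists_bound_torusRep hU hF.continuousOn hx
  obtain ⟨C, hC⟩ := exists_bound_torusRep hU hF'.continuousOn hx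
  have key := hasFDerivAt_integral_of_dominated_of_fderiv_le (𝕜 := ℝ) (μ := torusMeasure n)
    (F := fun x y => mFourier (-k) y • F (x + (torusRep y, 0)))
    (F' := fun x y => mFourier (-k) y • fderiv ℝ F (x + (torusRep y, 0)))
    (bound := fun _ => C) hC (hC.mono fun x' hx' =>
      aestronglyMeasurable_mul_torusRep (-k) hF.continuousOn hx'.1)
    (integrable_mul_torusRep (-k) hF.continuousOn hx hC₀.self_of_nhds.2)
    (aestronglyMeasurable_mul_torusRep (-k) hF'.continuousOn hx)
    (.of_forall fun y x' hx' => by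
      rw [norm_smul, norm_mFourier_apply, one_mul]
      exact hx'.2 y)
    (integrable_const C)
    (.of_forall fun y x' hx' => by
      have h1 := (hF.differentiableAt_of_isOpen hW
        (add_prod_zero_mem hx'.1 (torusRep y))).hasFDerivAt
      have h2 := (h1.comp x' ((hasFDerivAt_id x').add_const (torusRep y, (0 : P)))).const_smul
        (mFourier (-k) y)
      rw [ContinuousLinearMap.comp_id] at h2
      exact h2)
  have key' : HasFDerivAt (fourierMode k F)
      (∫ y, mFourier (-k) y • fderiv ℝ F (x + (torusRep y, 0)) ∂(torusMeasure n)) x := key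
  refine ⟨key'.differentiableAt, fun v => ?_⟩
  rw [(key'.hasLineDerivAt v).lineDeriv]
  have hI := integrable_mul_torusRep (-k) hF'.continuousOn hx hC.self_of_nhds.2
  rw [ContinuousLinearMap.integral_apply hI]
  refine integral_congr_ae (.of_forall fun y => ?_)
  simp only [smul_apply, smul_eq_mul]
  rw [(hF.differentiableAt_of_isOpen hW
    (add_prod_zero_mem hx (torusRep y))).lineDeriv_eq_fderiv]

theorem contDiffOn_fourierMode (hU : IsOpen U) (k : Fin n → ℤ)
    {F : EuclideanSpace ℝ (Fin n) × P → ℂ}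
    (hF : ContDiffOn ℝ ∞ F ((univ : Set (EuclideanSpace ℝ (Fin n))) ×ˢ U)) :
    ContDiffOn ℝ ∞ (fourierMode k F) ((univ : Set (EuclideanSpace ℝ (Fin n))) ×ˢ U) :=
  contDiffOn_of_lineDeriv_closed (isOpen_univ.prod hU) (fourierMode k)
    (fun v F x => lineDeriv ℝ F x v) (fun F => ContDiffOn ℝ ∞ F (univ ×ˢ U))
    (fun v _ h => h.lineDeriv_of_isOpen (isOpen_univ.prod hU) v)
    (fun _ h _ hx => (hasFDerivAt_fourierMode hU k h hx).1)
    (fun v _ h _ hx => (hasFDerivAt_fourierMode hU k h hx).2 v) hF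

theorem iterLineDeriv_fourierMode (hU : IsOpen U) (k : Fin n → ℤ)
    {F : EuclideanSpace ℝ (Fin n) × P → ℂ}
    (hF : ContDiffOn ℝ ∞ F ((univ : Set (EuclideanSpace ℝ (Fin n))) ×ˢ U))
    (l : List (EuclideanSpace ℝ (Fin n) × P)) :
    EqOn (iterLineDeriv l (fourierMode k F)) (fourierMode k (iterLineDeriv l F))
      ((univ : Set (EuclideanSpace ℝ (Fin n))) ×ˢ U) := by
  induction l with
  | nil => exact fun _ _ => rfl
  | cons v l ih =>
    intro x hx
    simp only [iterLineDeriv_cons]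
    rw [lineDeriv_eqOn (isOpen_univ.prod hU) ih v hx]
    exact (hasFDerivAt_fourierMode hU k
      (hF.iterLineDeriv_of_isOpen (isOpen_univ.prod hU) l) hx).2 v

end FourierModes

/-! ### Periodicity in the angles and decay of the modes -/

section FourierSeries

open Filter Topology UnitAddTorus

variable {n : ℕ} {P : Type*} [NormedAddCommGroup P] {U : Set P}

theorem add_angle_add_angle (x : EuclideanSpace ℝ (Fin n) × P) (z z' : EuclideanSpace ℝ (Fin n)) :
    x + (z, 0) + (z', 0) = x + (z + z', 0) := by
  rw [add_assoc]
  congr 1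
  simp

/-- `F` is `2π`-periodic in each of the angle variables. -/
def AnglePeriodicOn (U : Set P) (F : EuclideanSpace ℝ (Fin n) × P → ℂ) : Prop :=
  ∀ x ∈ (univ : Set (EuclideanSpace ℝ (Fin n))) ×ˢ U, ∀ i,
    F (x + (EuclideanSpace.single i (2 * Real.pi), 0)) = F x

theorem AnglePeriodicOn.lineDeriv [NormedSpace ℝ P] (hU : IsOpen U)
    {F : EuclideanSpace ℝ (Fin n) × P → ℂ} (hF : AnglePeriodicOn U F)
    (v : EuclideanSpace ℝ (Fin n) × P) : AnglePeriodicOn U (fun x => lineDeriv ℝ F x v) := by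
  intro x hx i
  have h := lineDeriv_eqOn (isOpen_univ.prod hU) (fun x hx => hF x hx i) v hx
  refine Eq.trans ?_ h
  simp only [_root_.lineDeriv, add_right_comm]

theorem AnglePeriodicOn.iterLineDeriv [NormedSpace ℝ P] (hU : IsOpen U)
    {F : EuclideanSpace ℝ (Fin n) × P → ℂ} (hF : AnglePeriodicOn U F)
    (l : List (EuclideanSpace ℝ (Fin n) × P)) : AnglePeriodicOn U (iterLineDeriv l F) := by
  induction l with
  | nil => exact hF
  | cons v l ih => exact ih.lineDeriv hU v

/-- The projection of `ℝⁿ` onto the torus `ℝⁿ / 2πℤⁿ`, rescaled to the unit torus. -/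
def torusProj (z : EuclideanSpace ℝ (Fin n)) : UnitAddTorus (Fin n) :=
  fun i => ((z i / (2 * Real.pi) : ℝ) : UnitAddCircle)

theorem torusProj_torusRep (y : UnitAddTorus (Fin n)) : torusProj (torusRep y) = y := by
  funext i
  simp only [torusProj, torusRep_apply]
  rw [mul_div_cancel_left₀ _ (by positivity)]
  exact AddCircle.coe_equivIoc

theorem torusProj_add (z z' : EuclideanSpace ℝ (Fin n)) :
    torusProj (z + z') = torusProj z + torusProj z' := by
  funext i
  simp [torusProj, add_div]

theorem AnglePeriodicOn.eq_of_torusProj_eq {F : EuclideanSpace ℝ (Fin n) × P → ℂ}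
    (hF : AnglePeriodicOn U F) {x : EuclideanSpace ℝ (Fin n) × P}
    (hx : x ∈ (univ : Set (EuclideanSpace ℝ (Fin n))) ×ˢ U) {z z' : EuclideanSpace ℝ (Fin n)}
    (h : torusProj z = torusProj z') : F (x + (z, 0)) = F (x + (z', 0)) := by
  have hper : ∀ i, Function.Periodic (fun z : EuclideanSpace ℝ (Fin n) => F (x + (z, 0)))
      (EuclideanSpace.single i (2 * Real.pi)) := by
    intro i z
    have := hF (x + (z, 0)) (add_prod_zero_mem hx z) i
    rw [add_angle_add_angle] at this
    exact this
  have hm : ∀ i, ∃ m : ℤ, z i = z' i + m * (2 * Real.pi) := by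
    intro i
    have h1 : (((z i / (2 * Real.pi) - z' i / (2 * Real.pi) : ℝ)) : UnitAddCircle) = 0 := by
      rw [AddCircle.coe_sub, sub_eq_zero]
      exact congrFun h i
    obtain ⟨m, hm⟩ := (AddCircle.coe_eq_zero_iff (1 : ℝ)).1 h1
    refine ⟨m, ?_⟩
    have hpi := Real.pi_pos
    rw [zsmul_eq_mul, mul_one] at hm
    field_simp at hm
    linarith
  choose m hm using hm
  have hsum : ∀ s : Finset (Fin n),
      Function.Periodic (fun z : EuclideanSpace ℝ (Fin n) => F (x + (z, 0)))
        (∑ i ∈ s, m i • EuclideanSpace.single i (2 * Real.pi)) := by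
    intro s
    induction s using Finset.induction_on with
    | empty => intro z; simp
    | insert i s hi ih =>
      rw [Finset.sum_insert hi]
      exact ((hper i).zsmul (m i)).add_period ih
  have hz : z = z' + ∑ i, m i • EuclideanSpace.single i (2 * Real.pi) := by
    ext j
    simp [hm j, Pi.single_apply]
  rw [hz]
  exact hsum Finset.univ z'

theorem AnglePeriodicOn.torusRep_torusProj {F : EuclideanSpace ℝ (Fin n) × P → ℂ}
    (hF : AnglePeriodicOn U F) {x : EuclideanSpace ℝ (Fin n) × P}
    (hx : x ∈ (univ : Set (EuclideanSpace ℝ (Fin n))) ×ˢ U) (z : EuclideanSpace ℝ (Fin n)) :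
    F (x + (torusRep (torusProj z), 0)) = F (x + (z, 0)) :=
  hF.eq_of_torusProj_eq hx (torusProj_torusRep _)

/-- `torusRep` jumps, but by a period, which `F` does not notice. Continuity is tested after
composing with the quotient map `ℝⁿ → 𝕋ⁿ`, where the representative can be replaced by the point
itself. -/
theorem AnglePeriodicOn.continuous_torusRep {F : EuclideanSpace ℝ (Fin n) × P → ℂ}
    (hF : AnglePeriodicOn U F)
    (hc : ContinuousOn F ((univ : Set (EuclideanSpace ℝ (Fin n))) ×ˢ U))
    {x : EuclideanSpace ℝ (Fin n) × P} (hx : x ∈ (univ : Set (EuclideanSpace ℝ (Fin n))) ×ˢ U) :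
    Continuous fun y => F (x + (torusRep y, 0)) := by
  have hq : IsOpenQuotientMap (Pi.map fun (_ : Fin n) (t : ℝ) => (t : UnitAddCircle)) :=
    IsOpenQuotientMap.piMap fun _ => QuotientAddGroup.isOpenQuotientMap_mk
  rw [hq.isQuotientMap.continuous_iff]
  have h1 : Continuous fun t : Fin n → ℝ => F (x + (WithLp.toLp 2 fun i => 2 * Real.pi * t i, 0)) :=
    hc.comp_continuous
      (continuous_const.add (((PiLp.continuous_toLp 2 _).comp (by fun_prop)).prodMk
        continuous_const)) fun z => add_prod_zero_mem hx _
  refine h1.congr fun t => ?_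
  rw [← hF.torusRep_torusProj hx]
  congr 5
  funext i
  simp only [torusProj, Pi.map_apply]
  rw [mul_div_cancel_left₀ _ (by positivity)]

theorem mFourier_apply_add (k : Fin n → ℤ) (y y' : UnitAddTorus (Fin n)) :
    mFourier k (y + y') = mFourier k y * mFourier k y' := by
  simp only [mFourier, ContinuousMap.coe_mk, fourier_apply, Pi.add_apply, smul_add,
    AddCircle.toCircle_add, Circle.coe_mul, Finset.prod_mul_distrib]

/-- Invariance of Haar measure moves the translation from `F` onto the character. A mode is
therefore an eigenfunction of angle translations, and so of angle derivatives. -/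
theorem AnglePeriodicOn.fourierMode_add {F : EuclideanSpace ℝ (Fin n) × P → ℂ}
    (hF : AnglePeriodicOn U F) (k : Fin n → ℤ) {x : EuclideanSpace ℝ (Fin n) × P}
    (hx : x ∈ (univ : Set (EuclideanSpace ℝ (Fin n))) ×ˢ U) (z : EuclideanSpace ℝ (Fin n)) :
    fourierMode k F (x + (z, 0)) = mFourier k (torusProj z) * fourierMode k F x := by
  have h1 : ∀ y, mFourier (-k) y * F (x + (z, 0) + (torusRep y, 0))
      = mFourier k (torusProj z) * (fun y => mFourier (-k) y * F (x + (torusRep y, 0)))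
        (y + torusProj z) := by
    intro y
    have h2 : F (x + (z, 0) + (torusRep y, 0)) = F (x + (torusRep (y + torusProj z), 0)) := by
      rw [add_angle_add_angle]
      refine hF.eq_of_torusProj_eq hx ?_
      rw [torusProj_add, torusProj_torusRep, torusProj_torusRep, add_comm]
    have h3 : mFourier k (torusProj z) * mFourier (-k) (torusProj z) = 1 := by
      rw [← mFourier_add, add_neg_cancel, mFourier_zero]
      rfl
    simp only [h2, mFourier_apply_add]
    linear_combination (-(mFourier (-k) y * F (x + (torusRep (y + torusProj z), 0)))) * h3
  unfold fourierMode
  simp_rw [h1]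
  rw [integral_const_mul, integral_add_right_eq_self
    (fun y => mFourier (-k) y * F (x + (torusRep y, 0)))]

theorem mFourier_torusProj_single (k : Fin n → ℤ) (i : Fin n) (s : ℝ) :
    mFourier k (torusProj (s • EuclideanSpace.single i 1)) = Complex.exp (Complex.I * k i * s) := by
  have hpi : (Real.pi : ℂ) ≠ 0 := by exact_mod_cast Real.pi_ne_zero
  simp only [mFourier, ContinuousMap.coe_mk, torusProj]
  rw [Finset.prod_eq_single i]
  · rw [fourier_coe_apply]
    congr 1
    simp
    field_simp
  · intro j _ hj
    simp [hj]
  · simp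

variable [NormedSpace ℝ P]

theorem AnglePeriodicOn.lineDeriv_fourierMode {F : EuclideanSpace ℝ (Fin n) × P → ℂ}
    (hF : AnglePeriodicOn U F) (k : Fin n → ℤ) {x : EuclideanSpace ℝ (Fin n) × P}
    (hx : x ∈ (univ : Set (EuclideanSpace ℝ (Fin n))) ×ˢ U) (i : Fin n) :
    _root_.lineDeriv ℝ (fourierMode k F) x (EuclideanSpace.single i 1, 0)
      = Complex.I * k i * fourierMode k F x := by
  have h1 : ∀ s : ℝ, fourierMode k F (x + s • (EuclideanSpace.single i 1, 0))
      = Complex.exp (Complex.I * k i * s) * fourierMode k F x := by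
    intro s
    rw [Prod.smul_mk, smul_zero, hF.fourierMode_add k hx, mFourier_torusProj_single]
  simp only [_root_.lineDeriv, h1]
  have h2 : HasDerivAt (fun s : ℝ => Complex.I * k i * (s : ℂ)) (Complex.I * k i) 0 := by
    simpa using (Complex.ofRealCLM.hasDerivAt (x := (0 : ℝ))).const_mul (Complex.I * k i)
  have h3 := (h2.cexp.mul_const (fourierMode k F x)).deriv
  simpa using h3

/-- The length `|k₁| + ⋯ + |kₙ|` of a frequency. -/
def frequencyLength (k : Fin n → ℤ) : ℝ := ∑ i, |(k i : ℝ)|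

theorem AnglePeriodicOn.iterLineDeriv_replicate_fourierMode (hU : IsOpen U)
    {F : EuclideanSpace ℝ (Fin n) × P → ℂ}
    (hF : AnglePeriodicOn U F) (k : Fin n → ℤ) (i : Fin n) (m : ℕ)
    {x : EuclideanSpace ℝ (Fin n) × P}
    (hx : x ∈ (univ : Set (EuclideanSpace ℝ (Fin n))) ×ˢ U) :
    _root_.iterLineDeriv (List.replicate m (EuclideanSpace.single i 1, 0)) (fourierMode k F) x
      = (Complex.I * k i) ^ m * fourierMode k F x := by
  induction m generalizing x with
  | zero => simp
  | succ m ih =>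
    rw [List.replicate_succ, iterLineDeriv_cons]
    simp only
    rw [lineDeriv_eqOn (isOpen_univ.prod hU) (fun x hx => ih hx) _ hx]
    have h1 := hF.lineDeriv_fourierMode k hx i
    simp only [_root_.lineDeriv, deriv_const_mul_field] at h1 ⊢
    rw [h1]
    ring

variable [FiniteDimensional ℝ P]

/-- Differentiate `m` times in the angle for which `|k_i|` is largest. Each derivative multiplies
the mode by `i k_i`, and `|k| ≤ n|k_i|` accounts for the factor `n^m`. -/
theorem AnglePeriodicOn.frequencyLength_pow_mul_norm_fourierMode_le (hU : IsOpen U)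
    {F : EuclideanSpace ℝ (Fin n) × P → ℂ}
    (hF : AnglePeriodicOn U F)
    (hFs : ContDiffOn ℝ ∞ F ((univ : Set (EuclideanSpace ℝ (Fin n))) ×ˢ U)) {k : Fin n → ℤ}
    (hk : k ≠ 0) (m : ℕ) {x : EuclideanSpace ℝ (Fin n) × P}
    (hx : x ∈ (univ : Set (EuclideanSpace ℝ (Fin n))) ×ˢ U) {C : ℝ}
    (hC : ∀ i y, ‖_root_.iterLineDeriv (List.replicate m (EuclideanSpace.single i 1, 0)) F
      (x + (torusRep y, 0))‖ ≤ C) :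
    frequencyLength k ^ m * ‖fourierMode k F x‖ ≤ n ^ m * C := by
  have : Nonempty (Fin n) := by
    by_contra h
    rw [not_nonempty_iff] at h
    exact hk (Subsingleton.elim _ _)
  obtain ⟨i, -, hi⟩ := Finset.exists_max_image Finset.univ (fun i => |(k i : ℝ)|)
    Finset.univ_nonempty
  have h1 : frequencyLength k ≤ n * |(k i : ℝ)| := by
    refine (Finset.sum_le_card_nsmul _ _ _ hi).trans ?_
    simp
  have h2 : |(k i : ℝ)| ^ m * ‖fourierMode k F x‖ ≤ C := by
    have h3 : ‖(Complex.I * k i) ^ m * fourierMode k F x‖ ≤ C := by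
      rw [← hF.iterLineDeriv_replicate_fourierMode hU k i m hx,
        iterLineDeriv_fourierMode hU k hFs _ hx]
      refine (norm_integral_le_of_norm_le_const (C := C) (.of_forall fun y => ?_)).trans (by simp)
      rw [norm_mul, norm_mFourier_apply, one_mul]
      exact hC i y
    simpa using h3
  have h0 : 0 ≤ frequencyLength k := Finset.sum_nonneg fun i _ => abs_nonneg _
  calc _ ≤ (n * |(k i : ℝ)|) ^ m * ‖fourierMode k F x‖ := by gcongr
    _ = n ^ m * (|(k i : ℝ)| ^ m * ‖fourierMode k F x‖) := by ring
    _ ≤ _ := by gcongr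

end FourierSeries

/-! ### Summability over frequencies, the zero mode and Fourier inversion -/

section FourierInversion

open Filter Topology UnitAddTorus

variable {n : ℕ}

theorem frequencyLength_nonneg (k : Fin n → ℤ) : 0 ≤ frequencyLength k :=
  Finset.sum_nonneg fun _ _ => abs_nonneg _

theorem norm_intCast_le_frequencyLength (k : Fin n → ℤ) :
    ‖fun i => (k i : ℝ)‖ ≤ frequencyLength k := by
  refine (pi_norm_le_iff_of_nonneg (frequencyLength_nonneg k)).2 fun i => ?_
  exact Finset.single_le_sum (f := fun i => |(k i : ℝ)|) (fun i _ => abs_nonneg _)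
    (Finset.mem_univ i)

theorem one_le_frequencyLength {k : Fin n → ℤ} (hk : k ≠ 0) : 1 ≤ frequencyLength k := by
  obtain ⟨i, hi⟩ := Function.ne_iff.1 hk
  refine le_trans ?_ (Finset.single_le_sum (f := fun i => |(k i : ℝ)|) (fun i _ => abs_nonneg _)
    (Finset.mem_univ i))
  exact_mod_cast Int.one_le_abs hi

theorem summable_inv_frequencyLength_pow (n : ℕ) :
    Summable fun k : Fin n → ℤ => ((1 + frequencyLength k) ^ (n + 1))⁻¹ := by
  let b := Pi.basisFun ℝ (Fin n)
  let L := Submodule.span ℤ (Set.range b)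
  have hrank : Module.finrank ℤ L < n + 1 := by
    rw [ZLattice.rank ℝ L]; simp
  have h1 := ZLattice.summable_norm_pow_inv L (n + 1) hrank
  let ψ : (Fin n → ℤ) → L := fun k => ⟨∑ i, k i • b i, Submodule.sum_mem _ fun i _ =>
    Submodule.smul_mem _ _ (Submodule.subset_span ⟨i, rfl⟩)⟩
  have hψ : ∀ k, ((ψ k : L) : Fin n → ℝ) = fun i => (k i : ℝ) := by
    intro k
    funext j
    simp [ψ, b, Finset.sum_apply, Pi.single_apply]
  have hinj : Function.Injective ψ := by
    intro k k' h
    have h2 := congrArg (Subtype.val) h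
    rw [hψ, hψ] at h2
    funext i
    exact_mod_cast congrFun h2 i
  -- The comparison series has the value `0` at `k = 0`, by the convention for the inverse of zero,
  -- whereas the summand there is `1`; the indicator of `{0}` makes up for this.
  have h3 := (h1.comp_injective hinj).add
    (summable_of_ne_finset_zero (s := {(0 : Fin n → ℤ)}) (f := fun k => if k = 0 then (1 : ℝ) else 0)
      (fun k hk => if_neg (by simpa using hk)))
  refine Summable.of_nonneg_of_le (fun k => ?_) (fun k => ?_) h3
  · have := frequencyLength_nonneg k
    positivity
  · by_cases hk : k = 0
    · subst hk
      simp [frequencyLength, ψ]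
    · simp only [Function.comp_apply, hk, if_false, add_zero]
      rw [← inv_pow]
      have h4 : ‖ψ k‖ = ‖fun i => (k i : ℝ)‖ := by
        rw [← hψ]; rfl
      have h5 : 0 < ‖fun i => (k i : ℝ)‖ := by
        rw [norm_pos_iff]
        contrapose! hk
        funext i
        have := congrFun hk i
        simpa using this
      have h6 := norm_intCast_le_frequencyLength k
      rw [h4]
      have h7 := frequencyLength_nonneg k
      gcongr
      linarith

variable {P : Type*} [NormedAddCommGroup P] {U : Set P}

/-- The zero mode is invariant under angle translations, so it may be computed at angle zero. The
substitution `θ = 2πt` from the unit cube contributes the Jacobian `(2π)^n`. This is where vanishing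
mean becomes vanishing of the mode `k = 0`. -/
theorem AnglePeriodicOn.fourierMode_zero {F : EuclideanSpace ℝ (Fin n) × P → ℂ}
    (hF : AnglePeriodicOn U F) {x : EuclideanSpace ℝ (Fin n) × P}
    (hx : x ∈ (univ : Set (EuclideanSpace ℝ (Fin n))) ×ˢ U) :
    fourierMode 0 F x
      = (((2 * Real.pi) ^ n)⁻¹ : ℝ) • integralOverTorus (fun θ => F (θ, x.2)) := by
  have hpi : 0 < 2 * Real.pi := by positivity
  have hx0 : ((0 : EuclideanSpace ℝ (Fin n)), x.2) ∈
      (univ : Set (EuclideanSpace ℝ (Fin n))) ×ˢ U := ⟨mem_univ _, hx.2⟩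
  have h1 : fourierMode 0 F x = fourierMode 0 F (0, x.2) := by
    have := hF.fourierMode_add 0 hx0 x.1
    rw [mFourier_zero] at this
    simpa using this
  have hz : ∀ z : EuclideanSpace ℝ (Fin n), ((0 : EuclideanSpace ℝ (Fin n)), x.2) + (z, 0)
      = (z, x.2) := by
    intro z; simp
  have hval : ∀ t : Fin n → ℝ,
      F ((0, x.2) + (torusRep (fun i => ((t i : ℝ) : UnitAddCircle)), 0))
        = F ((2 * Real.pi) • WithLp.toLp 2 t, x.2) := by
    intro t
    rw [← hz (_ • _), ← hF.torusRep_torusProj hx0 (_ • _)]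
    congr 4
    funext i
    simp only [torusProj, PiLp.smul_apply, smul_eq_mul]
    rw [mul_div_cancel_left₀ _ hpi.ne']
  rw [h1, fourierMode_eq_mFourierCoeff, mFourierCoeff_eq_integral _ _ 0]
  simp only [neg_zero, mFourier_zero, ContinuousMap.one_apply, one_smul, hval]
  -- The half-open cube and the closed cube differ by a null set.
  have hset : (volume.restrict {t : Fin n → ℝ | ∀ i, t i ∈ Ioc ((0 : Fin n → ℝ) i) ((0 : Fin n → ℝ) i + 1)})
      = volume.restrict (Icc 0 1) := by
    refine Measure.restrict_congr_set ?_
    have := Measure.univ_pi_Ioc_ae_eq_Icc (μ := fun _ : Fin n => (volume : Measure ℝ))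
      (f := 0) (g := 1)
    have h2 : {t : Fin n → ℝ | ∀ i, t i ∈ Ioc ((0 : Fin n → ℝ) i) ((0 : Fin n → ℝ) i + 1)}
        = univ.pi fun i => Ioc ((0 : Fin n → ℝ) i) ((1 : Fin n → ℝ) i) := by
      ext t
      simp
    rw [h2]
    exact this
  rw [hset, integralOverTorus]
  have hbox : MeasurableSet
      {θ : EuclideanSpace ℝ (Fin n) | ∀ i, θ i ∈ Icc (0 : ℝ) (2 * Real.pi)} := by
    simp only [ofPred_forall]
    exact MeasurableSet.iInter fun i =>
      measurableSet_Icc.preimage (by fun_prop)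
  rw [← integral_indicator hbox, ← integral_indicator measurableSet_Icc]
  have h3 := Measure.integral_comp_smul (volume : Measure (EuclideanSpace ℝ (Fin n)))
    (indicator {θ : EuclideanSpace ℝ (Fin n) | ∀ i, θ i ∈ Icc (0 : ℝ) (2 * Real.pi)}
      fun θ => F (θ, x.2)) (2 * Real.pi)
  rw [finrank_euclideanSpace_fin, abs_of_pos (by positivity)] at h3
  rw [← h3, ← (PiLp.volume_preserving_toLp (Fin n)).integral_comp
    (MeasurableEquiv.toLp 2 (Fin n → ℝ)).measurableEmbedding]
  refine integral_congr_ae (.of_forall fun t => ?_)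
  have hmem : t ∈ Icc (0 : Fin n → ℝ) 1 ↔ (2 * Real.pi) • WithLp.toLp 2 t ∈
      {θ : EuclideanSpace ℝ (Fin n) | ∀ i, θ i ∈ Icc (0 : ℝ) (2 * Real.pi)} := by
    simp only [mem_ofPred_eq, PiLp.smul_apply, smul_eq_mul, mem_Icc, Pi.le_def, ← forall_and]
    refine forall_congr' fun i => and_congr ?_ ?_
    · simp [hpi]
    · simp [hpi]
  by_cases ht : t ∈ Icc (0 : Fin n → ℝ) 1
  · rw [indicator_of_mem ht]
    exact (indicator_of_mem (hmem.1 ht) fun θ => F (θ, x.2)).symm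
  · rw [indicator_of_notMem ht]
    exact (indicator_of_notMem (fun h => ht (hmem.2 h)) fun θ => F (θ, x.2)).symm

variable [NormedSpace ℝ P] [FiniteDimensional ℝ P]

theorem locallyBoundedBy_fourierMode (hU : IsOpen U) (N m : ℕ)
    {F : EuclideanSpace ℝ (Fin n) × P → ℂ} (hF : AnglePeriodicOn U F)
    (hFs : ContDiffOn ℝ ∞ F ((univ : Set (EuclideanSpace ℝ (Fin n))) ×ˢ U)) :
    LocallyBoundedBy ((univ : Set (EuclideanSpace ℝ (Fin n))) ×ˢ U)
      (fun k => ((1 + frequencyLength k) ^ N)⁻¹) m (fun k => fourierMode k F) := by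
  have hW : IsOpen ((univ : Set (EuclideanSpace ℝ (Fin n))) ×ˢ U) := isOpen_univ.prod hU
  have key : ∀ {F : EuclideanSpace ℝ (Fin n) × P → ℂ}, AnglePeriodicOn U F →
      ContDiffOn ℝ ∞ F ((univ : Set (EuclideanSpace ℝ (Fin n))) ×ˢ U) →
      LocallyBoundedBy ((univ : Set (EuclideanSpace ℝ (Fin n))) ×ˢ U)
      (fun k => ((1 + frequencyLength k) ^ N)⁻¹) 0 (fun k => fourierMode k F) := by
    intro F hF hFs x hx
    obtain ⟨C₀, hC₀⟩ := exists_bound_torusRep hU hFs.continuousOn hx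
    have hder := fun i => exists_bound_torusRep hU (hFs.iterLineDeriv_of_isOpen hW
      (List.replicate N (EuclideanSpace.single i 1, 0))).continuousOn hx
    choose C hC using hder
    -- By `(1+K)^N ≤ 2^(N-1) (1 + K^N)` it suffices to bound a mode and `K^N` times it. The first is
    -- at most `C₀`; the second is at most `n^N ∑|C_i|` for `k ≠ 0` and at most `C₀` for `k = 0`.
    refine ⟨2 ^ (N - 1) * (2 * C₀ + n ^ N * ∑ i, |C i|), ?_⟩
    filter_upwards [hC₀, eventually_all.2 hC] with x' h₀ h k
    have h1 : ‖fourierMode k F x'‖ ≤ C₀ := by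
      refine (norm_integral_le_of_norm_le_const (C := C₀) (.of_forall fun y => ?_)).trans (by simp)
      rw [norm_mul, norm_mFourier_apply, one_mul]
      exact h₀.2 y
    have hS : 0 ≤ ∑ i, |C i| := Finset.sum_nonneg fun i _ => abs_nonneg _
    have h2 : frequencyLength k ^ N * ‖fourierMode k F x'‖
        ≤ C₀ + n ^ N * ∑ i, |C i| := by
      by_cases hk : k = 0
      · subst hk
        have : frequencyLength (0 : Fin n → ℤ) = 0 := by simp [frequencyLength]
        rw [this]
        refine le_add_of_le_of_nonneg (le_trans ?_ h1) (by positivity)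
        exact mul_le_of_le_one_left (norm_nonneg _) (pow_le_one₀ le_rfl zero_le_one)
      · refine (hF.frequencyLength_pow_mul_norm_fourierMode_le hU hFs hk N h₀.1
          (C := ∑ i, |C i|) fun i y => ?_).trans ?_
        · refine ((h i).2 y).trans ((le_abs_self _).trans ?_)
          exact Finset.single_le_sum (f := fun i => |C i|) (fun i _ => abs_nonneg _)
            (Finset.mem_univ i)
        · exact le_add_of_nonneg_left ((norm_nonneg _).trans h1)
    have hf := frequencyLength_nonneg k
    rw [← div_eq_mul_inv, le_div_iff₀ (by positivity), mul_comm]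
    calc _ ≤ (2 ^ (N - 1) * (1 ^ N + frequencyLength k ^ N)) * ‖fourierMode k F x'‖ := by
          gcongr
          exact add_pow_le zero_le_one hf N
      _ = 2 ^ (N - 1) * (‖fourierMode k F x'‖ + frequencyLength k ^ N * ‖fourierMode k F x'‖) := by
          ring
      _ ≤ 2 ^ (N - 1) * (C₀ + (C₀ + n ^ N * ∑ i, |C i|)) := by gcongr
      _ = _ := by ring
  induction m generalizing F with
  | zero => exact key hF hFs
  | succ m ih =>
    refine ⟨key hF hFs, fun v => ?_⟩
    exact (ih (hF.lineDeriv hU v) (hFs.lineDeriv_of_isOpen hW v)).congr hW fun k x hx =>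
      (hasFDerivAt_fourierMode hU k hFs hx).2 v

theorem AnglePeriodicOn.hasSum_fourierMode (hU : IsOpen U)
    {F : EuclideanSpace ℝ (Fin n) × P → ℂ} (hF : AnglePeriodicOn U F)
    (hFs : ContDiffOn ℝ ∞ F ((univ : Set (EuclideanSpace ℝ (Fin n))) ×ˢ U))
    {x : EuclideanSpace ℝ (Fin n) × P}
    (hx : x ∈ (univ : Set (EuclideanSpace ℝ (Fin n))) ×ˢ U) :
    HasSum (fun k => fourierMode k F x) (F x) := by
  obtain ⟨C, hC⟩ := locallyBoundedBy_fourierMode hU (n + 1) 0 hF hFs x hx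
  have hs : Summable fun k => fourierMode k F x :=
    Summable.of_norm_bounded ((summable_inv_frequencyLength_pow n).mul_left C) hC.self_of_nhds
  -- The translated function is expanded on the torus and evaluated at the origin, where every
  -- character equals `1`.
  have h := hasSum_mFourier_series_apply_of_summable
    (f := ⟨fun y => F (x + (torusRep y, 0)), hF.continuous_torusRep hFs.continuousOn hx⟩) hs
    (torusProj 0)
  have h0 : F (x + (torusRep (torusProj 0), 0)) = F x := by
    rw [hF.torusRep_torusProj hx, show ((0 : EuclideanSpace ℝ (Fin n)), (0 : P)) = 0 from rfl,
      add_zero]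
  have h1 : ∀ k : Fin n → ℤ, mFourier k (torusProj 0) = 1 := by
    intro k
    simp [mFourier, torusProj]
  simp only [h1, ContinuousMap.coe_mk, h0, smul_eq_mul, mul_one] at h
  exact h

end FourierInversion

/-! ### A Gevrey truncation of `1/x` -/

section GevreyCutoff

open Filter Topology

/-- The derivatives of `g` at `x` satisfy the Gevrey bounds `|g^(j)(x)| ≤ A B^j j!^s`. -/
def GevreyBoundAt (s A B : ℝ) (g : ℝ → ℝ) (x : ℝ) : Prop :=
  ∀ j : ℕ, |iteratedDeriv j g x| ≤ A * B ^ j * (j.factorial : ℝ) ^ s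

theorem iteratedDeriv_eq_re {Ω : Set ℂ} (hΩ : IsOpen Ω) {f : ℂ → ℂ} (hf : DifferentiableOn ℂ f Ω)
    {g : ℝ → ℝ} (hg : ∀ t : ℝ, (t : ℂ) ∈ Ω → g t = (f t).re) (j : ℕ) :
    DifferentiableOn ℂ (iteratedDeriv j f) Ω ∧
      ∀ t : ℝ, (t : ℂ) ∈ Ω → iteratedDeriv j g t = (iteratedDeriv j f t).re := by
  induction j with
  | zero => simpa using ⟨hf, hg⟩
  | succ j ih =>
    simp only [iteratedDeriv_succ]
    refine ⟨ih.1.deriv hΩ, fun t ht => ?_⟩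
    have h1 := (ih.1.differentiableAt (hΩ.mem_nhds ht)).hasDerivAt.real_of_complex
    have h2 : (fun x : ℝ => (iteratedDeriv j f x).re) =ᶠ[𝓝 t] iteratedDeriv j g := by
      filter_upwards [Complex.continuous_ofReal.continuousAt.preimage_mem_nhds
        (hΩ.mem_nhds ht)] with y hy
      exact (ih.2 y hy).symm
    exact (h1.congr_of_eventuallyEq h2.symm).deriv

/-- Cauchy's estimates on a disc about `x`: on the real axis, the real derivatives of `g` are the
real parts of the complex derivatives of its holomorphic extension. -/
theorem abs_iteratedDeriv_le_of_complex {f : ℂ → ℂ} {g : ℝ → ℝ} {Ω : Set ℂ} (hΩ : IsOpen Ω)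
    (hf : DifferentiableOn ℂ f Ω) (hg : ∀ t : ℝ, (t : ℂ) ∈ Ω → g t = (f t).re) {x r C : ℝ}
    (hr : 0 < r) (hx : Metric.closedBall (x : ℂ) r ⊆ Ω)
    (hC : ∀ z ∈ Metric.closedBall (x : ℂ) r, ‖f z‖ ≤ C) (j : ℕ) :
    |iteratedDeriv j g x| ≤ j.factorial * C / r ^ j := by
  rw [(iteratedDeriv_eq_re hΩ hf hg j).2 x (hx (Metric.mem_closedBall_self hr.le))]
  refine (Complex.abs_re_le_norm _).trans ?_
  refine Complex.norm_iteratedDeriv_le_of_forall_mem_sphere_norm_le j hr ?_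
    fun z hz => hC z (Metric.sphere_subset_closedBall hz)
  refine DifferentiableOn.diffContOnCl (hf.mono ?_)
  rw [closure_ball _ hr.ne']
  exact hx

theorem GevreyBoundAt.mul {s A B A' B' x : ℝ} {g g' : ℝ → ℝ} (hs : 0 ≤ s) (hA : 0 ≤ A)
    (hB : 0 ≤ B) (hA' : 0 ≤ A') (hB' : 0 ≤ B') (hg : GevreyBoundAt s A B g x)
    (hg' : GevreyBoundAt s A' B' g' x) (hc : ContDiffAt ℝ ∞ g x) (hc' : ContDiffAt ℝ ∞ g' x) :
    GevreyBoundAt s (A * A') (B + B') (fun y => g y * g' y) x := by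
  intro j
  rw [iteratedDeriv_fun_mul (hc.of_le (by exact_mod_cast le_top))
    (hc'.of_le (by exact_mod_cast le_top))]
  refine (Finset.abs_sum_le_sum_abs _ _).trans ?_
  rw [add_pow, Finset.mul_sum, Finset.sum_mul]
  refine Finset.sum_le_sum fun i hi => ?_
  have hi' : i ≤ j := Nat.lt_succ_iff.1 (Finset.mem_range.1 hi)
  have h1 : (i.factorial : ℝ) ^ s * ((j - i).factorial : ℝ) ^ s ≤ (j.factorial : ℝ) ^ s := by
    rw [← Real.mul_rpow (by positivity) (by positivity)]
    refine Real.rpow_le_rpow (by positivity) ?_ hs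
    exact_mod_cast Nat.le_of_dvd (Nat.factorial_pos j) (Nat.factorial_mul_factorial_dvd_factorial hi')
  rw [abs_mul, abs_mul, Nat.abs_cast]
  calc (j.choose i : ℝ) * |iteratedDeriv i g x| * |iteratedDeriv (j - i) g' x|
      ≤ (j.choose i : ℝ) * (A * B ^ i * (i.factorial : ℝ) ^ s)
          * (A' * B' ^ (j - i) * ((j - i).factorial : ℝ) ^ s) := by
        gcongr
        exacts [hg i, hg' (j - i)]
    _ = A * A' * (B ^ i * B' ^ (j - i) * (j.choose i : ℝ)) *
          ((i.factorial : ℝ) ^ s * ((j - i).factorial : ℝ) ^ s) := by ring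
    _ ≤ _ := by gcongr

/-- Continuity at `w = 0`, where the value is `1`. Writing `z = x(1+w)`, this gives `Re z^(-m) ≥
x^(-m)/2` on the disc of radius `cx` about `x > 0`, and `c < 1` keeps that disc away from `0`. -/
theorem exists_re_inv_pow_ge (m : ℕ) :
    ∃ c : ℝ, 0 < c ∧ c < 1 ∧ ∀ w : ℂ, ‖w‖ ≤ c → 1 / 2 ≤ (((1 + w) ^ m)⁻¹).re := by
  have h1 : ContinuousAt (fun w : ℂ => (((1 + w) ^ m)⁻¹).re) 0 := by
    refine Complex.continuous_re.continuousAt.comp ?_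
    exact ContinuousAt.inv₀ (by fun_prop) (by simp)
  have h2 : ∀ᶠ w in 𝓝 (0 : ℂ), 1 / 2 < (((1 + w) ^ m)⁻¹).re :=
    h1.eventually (lt_mem_nhds (by simp; norm_num))
  obtain ⟨ε, hε, h⟩ := Metric.eventually_nhds_iff.1 h2
  refine ⟨min (ε / 2) (1 / 2), by positivity, (min_le_right _ _).trans_lt (by norm_num),
    fun w hw => (h ?_).le⟩
  rw [dist_zero_right]
  exact (hw.trans (min_le_left _ _)).trans_lt (by linarith)

/-- With `y = x^(-m)/2`, the `m`-th power of the left side is at most `(2y)^j e^(-y)`, and `y^j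
e^(-y) ≤ j!`. Taking `m`-th roots turns `j!` into `j!^(1/m)`. -/
theorem inv_pow_mul_exp_le {x : ℝ} (hx : 0 < x) {m : ℕ} (hm : m ≠ 0) (j : ℕ) :
    (x ^ j)⁻¹ * Real.exp (-((x ^ m)⁻¹ / 2)) ≤ 2 ^ j * (j.factorial : ℝ) ^ (1 / (m : ℝ)) := by
  set y := (x ^ m)⁻¹ / 2 with hy
  have hy0 : 0 < y := by positivity
  have h1 : ((x ^ j)⁻¹ * Real.exp (-y)) ^ m ≤ 2 ^ j * j.factorial := by
    have h2 : ((x ^ j)⁻¹) ^ m = 2 ^ j * y ^ j := by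
      rw [← mul_pow, hy, inv_pow, ← pow_mul, mul_div_cancel₀ _ (by norm_num : (2 : ℝ) ≠ 0), inv_pow,
        ← pow_mul, mul_comm]
    have h3 := Real.pow_div_factorial_le_exp y hy0.le j
    rw [div_le_iff₀ (by positivity)] at h3
    have h4 : Real.exp (-y) ^ m ≤ Real.exp (-y) :=
      pow_le_of_le_one (Real.exp_pos _).le (by simpa using hy0.le) hm
    rw [mul_pow, h2, mul_assoc]
    refine mul_le_mul_of_nonneg_left ?_ (by positivity)
    calc y ^ j * Real.exp (-y) ^ m ≤ (Real.exp y * j.factorial) * Real.exp (-y) := by gcongr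
      _ = (Real.exp y * Real.exp (-y)) * j.factorial := by ring
      _ = _ := by rw [← Real.exp_add]; simp
  have h5 : (x ^ j)⁻¹ * Real.exp (-y) ≤ ((2 : ℝ) ^ j * j.factorial) ^ (1 / (m : ℝ)) := by
    rw [one_div, Real.le_rpow_inv_iff_of_pos (by positivity) (by positivity) (by positivity),
      Real.rpow_natCast]
    exact h1
  refine h5.trans ?_
  rw [Real.mul_rpow (by positivity) (by positivity)]
  gcongr
  refine (Real.rpow_le_rpow_of_exponent_le (z := (1 : ℝ)) (one_le_pow₀ one_le_two) ?_).trans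
    (Real.rpow_one _).le
  rw [one_div]
  exact inv_le_one_of_one_le₀ (by exact_mod_cast Nat.one_le_iff_ne_zero.2 hm)

/-- Cauchy's estimates for `exp(-z^(-m))` on the disc of radius `cx` give `j! (cx)^(-j)
exp(-x^(-m)/2)`. The exponential compensates `x^(-j)` at the price `j!^(1/m)`, so the class is `1 +
1/m`. Oddness of `m` makes the function vanish on the negative axis. -/
theorem exists_gevreyBoundAt_expNegInvGlue_pow {m : ℕ} (hm : Odd m) {s : ℝ}
    (hs : 1 + 1 / (m : ℝ) ≤ s) :
    ∃ B : ℝ, 1 ≤ B ∧ ∀ x, GevreyBoundAt s 1 B (fun x => expNegInvGlue (x ^ m)) x := by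
  have hm0 : m ≠ 0 := hm.pos.ne'
  obtain ⟨c, hc0, hc1, hc⟩ := exists_re_inv_pow_ge m
  have hsm : ContDiff ℝ ∞ (fun x : ℝ => expNegInvGlue (x ^ m)) :=
    expNegInvGlue.contDiff.comp (contDiff_id.pow m)
  refine ⟨2 / c, (one_le_div hc0).2 (by linarith), fun x j => ?_⟩
  have hpos : ∀ x : ℝ, 0 < x → |iteratedDeriv j (fun x => expNegInvGlue (x ^ m)) x|
      ≤ 1 * (2 / c) ^ j * (j.factorial : ℝ) ^ s := by
    intro x hx
    have hz : ∀ z ∈ Metric.closedBall (x : ℂ) (c * x),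
        z ≠ 0 ∧ (x ^ m)⁻¹ / 2 ≤ ((z ^ m)⁻¹).re := by
      intro z hz
      have hxc : (x : ℂ) ≠ 0 := by exact_mod_cast hx.ne'
      obtain ⟨w, rfl⟩ : ∃ w : ℂ, z = x * (1 + w) := ⟨z / x - 1, by field_simp; ring⟩
      have hw : ‖w‖ ≤ c := by
        rw [Metric.mem_closedBall, dist_eq_norm, mul_add, mul_one, add_sub_cancel_left, norm_mul,
          Complex.norm_real, Real.norm_of_nonneg hx.le, mul_comm c] at hz
        exact le_of_mul_le_mul_left hz hx
      refine ⟨mul_ne_zero hxc ?_, ?_⟩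
      · intro h
        have : w = -1 := by linear_combination h
        rw [this] at hw
        simp at hw
        linarith
      · rw [mul_pow, mul_inv, ← Complex.ofReal_pow, ← Complex.ofReal_inv, Complex.re_ofReal_mul]
        have := mul_le_mul_of_nonneg_left (hc w hw) (by positivity : 0 ≤ (x ^ m)⁻¹)
        linarith
    have h1 := abs_iteratedDeriv_le_of_complex (f := fun z : ℂ => Complex.exp (-(z ^ m)⁻¹))
      (g := fun x => expNegInvGlue (x ^ m)) (Ω := {z : ℂ | 0 < z.re})
      (isOpen_lt continuous_const Complex.continuous_re)
      (fun z hz => by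
        have hz0 : z ≠ 0 := by
          rintro rfl
          simp at hz
        exact ((((differentiableAt_id.pow m).inv (pow_ne_zero m hz0)).neg).cexp).differentiableWithinAt)
      (fun t ht => by
        have ht' : 0 < t := by simpa using ht
        have : -((t : ℂ) ^ m)⁻¹ = ((-(t ^ m)⁻¹ : ℝ) : ℂ) := by push_cast; rfl
        rw [this, ← Complex.ofReal_exp, Complex.ofReal_re, expNegInvGlue,
          if_neg (not_le.2 (pow_pos ht' m))])
      (mul_pos hc0 hx)
      (fun z hz' => by
        have h1 := (Complex.abs_re_le_norm (z - x)).trans (by simpa [dist_eq_norm] using hz')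
        rw [Complex.sub_re, Complex.ofReal_re] at h1
        have h2 := (abs_le.1 h1).1
        show 0 < z.re
        nlinarith) (C := Real.exp (-((x ^ m)⁻¹ / 2)))
      (fun z hz' => by
        rw [Complex.norm_exp]
        simpa using (hz z hz').2) j
    refine h1.trans ?_
    have h2 := inv_pow_mul_exp_le hx hm0 j
    have h3 : (j.factorial : ℝ) * (j.factorial : ℝ) ^ (1 / (m : ℝ)) ≤ (j.factorial : ℝ) ^ s := by
      rw [← Real.rpow_one_add' (by positivity) (by positivity)]
      exact Real.rpow_le_rpow_of_exponent_le
        (by exact_mod_cast Nat.one_le_iff_ne_zero.2 (Nat.factorial_ne_zero j)) hs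
    calc _ = (c ^ j)⁻¹ * j.factorial * ((x ^ j)⁻¹ * Real.exp (-((x ^ m)⁻¹ / 2))) := by
          rw [mul_pow]; field_simp
      _ ≤ (c ^ j)⁻¹ * j.factorial * (2 ^ j * (j.factorial : ℝ) ^ (1 / (m : ℝ))) := by gcongr
      _ = (2 / c) ^ j * (j.factorial * (j.factorial : ℝ) ^ (1 / (m : ℝ))) := by
          rw [div_pow]; field_simp
      _ ≤ _ := by rw [one_mul]; gcongr
  have hneg : ∀ x : ℝ, x < 0 → |iteratedDeriv j (fun x => expNegInvGlue (x ^ m)) x|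
      ≤ 1 * (2 / c) ^ j * (j.factorial : ℝ) ^ s := by
    intro x hx
    have h1 : (fun x : ℝ => expNegInvGlue (x ^ m)) =ᶠ[𝓝 x] fun _ => 0 := by
      filter_upwards [gt_mem_nhds hx] with y hy
      exact expNegInvGlue.zero_of_nonpos (hm.pow_nonpos hy.le)
    rw [h1.iteratedDeriv_eq]
    have : iteratedDeriv j (fun _ : ℝ => (0 : ℝ)) x = 0 := by simp
    rw [this, abs_zero]
    positivity
  -- At the origin no disc is available. The bound is a closed condition and passes from the dense
  -- set `x ≠ 0` to the limit.
  have hclosed : IsClosed {x : ℝ | |iteratedDeriv j (fun x => expNegInvGlue (x ^ m)) x|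
      ≤ 1 * (2 / c) ^ j * (j.factorial : ℝ) ^ s} :=
    isClosed_le (hsm.continuous_iteratedDeriv j (by exact_mod_cast le_top)).abs continuous_const
  have hsub : closure ({0}ᶜ : Set ℝ) ⊆ _ := hclosed.closure_subset_iff.2 (fun x hx => by
    rcases lt_or_gt_of_ne (show x ≠ 0 from hx) with h | h
    · exact hneg x h
    · exact hpos x h)
  rw [(dense_compl_singleton (0 : ℝ)).closure_eq] at hsub
  exact hsub (mem_univ x)

theorem GevreyBoundAt.congr {s A B x : ℝ} {g g' : ℝ → ℝ} (h : GevreyBoundAt s A B g x)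
    (he : g' =ᶠ[𝓝 x] g) : GevreyBoundAt s A B g' x := by
  intro j
  rw [he.iteratedDeriv_eq]
  exact h j

theorem GevreyBoundAt.mono {s A B A' B' x : ℝ} {g : ℝ → ℝ} (h : GevreyBoundAt s A B g x)
    (hB : 0 ≤ B) (hAA' : A ≤ A') (hA' : 0 ≤ A') (hBB' : B ≤ B') : GevreyBoundAt s A' B' g x := by
  intro j
  refine (h j).trans ?_
  gcongr

theorem gevreyBoundAt_zero {s A B x : ℝ} (hA : 0 ≤ A) (hB : 0 ≤ B) :
    GevreyBoundAt s A B (fun _ => 0) x := by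
  intro j
  have : iteratedDeriv j (fun _ : ℝ => (0 : ℝ)) x = 0 := by simp
  rw [this, abs_zero]
  positivity

/-- A smooth function of Gevrey class `s > 1` which vanishes on `(-∞, κ/2]` and equals one on
`[κ, ∞)`. -/
theorem exists_gevrey_step {s κ : ℝ} (hs : 1 < s) (hκ : 0 < κ) :
    ∃ Ψ : ℝ → ℝ, ContDiff ℝ ∞ Ψ ∧ (∀ x ≤ κ / 2, Ψ x = 0) ∧ (∀ x, κ ≤ x → Ψ x = 1) ∧
      ∃ A B : ℝ, 0 ≤ A ∧ 1 ≤ B ∧ ∀ x, GevreyBoundAt s A B Ψ x := by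
  -- The odd exponent `m = 2p + 1` then satisfies `1 + 1/m ≤ s`.
  obtain ⟨p, hp⟩ := exists_nat_gt (1 / (s - 1))
  have hs0 : 0 < s - 1 := by linarith
  have hp0 : 0 < (p : ℝ) := (by positivity : 0 < 1 / (s - 1)).trans hp
  have hm : Odd (2 * p + 1) := odd_two_mul_add_one p
  obtain ⟨B, hB1, hB⟩ := exists_gevreyBoundAt_expNegInvGlue_pow hm (s := s) (by
    have : 1 / ((2 * p + 1 : ℕ) : ℝ) ≤ s - 1 := by
      rw [one_div_le (by positivity) hs0]
      push_cast
      linarith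
    linarith)
  set φ : ℝ → ℝ := fun x => expNegInvGlue (x ^ (2 * p + 1)) with hφ
  have hφs : ContDiff ℝ ∞ φ := expNegInvGlue.contDiff.comp (contDiff_id.pow _)
  have hφpos : ∀ x, 0 < x → 0 < φ x := fun x hx => expNegInvGlue.pos_of_pos (pow_pos hx _)
  have hφzero : ∀ x ≤ 0, φ x = 0 := fun x hx => expNegInvGlue.zero_of_nonpos (hm.pow_nonpos hx)
  -- A bump vanishing outside `(κ/2, κ)`; the step is its normalized primitive. Integration keeps
  -- the Gevrey class, since the derivative of order `j+1` of the step is a multiple of the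
  -- derivative of order `j` of `β`.
  set β : ℝ → ℝ := fun x => φ (x - κ / 2) * φ (κ - x) with hβ
  have hβs : ContDiff ℝ ∞ β := (hφs.comp (contDiff_id.sub contDiff_const)).mul
    (hφs.comp (contDiff_const.sub contDiff_id))
  have hB0 : 0 ≤ B := zero_le_one.trans hB1
  have hβB : ∀ x, GevreyBoundAt s (1 * 1) (B + B) β x := by
    intro x
    refine GevreyBoundAt.mul (by linarith) zero_le_one hB0 zero_le_one hB0 ?_ ?_
      (hφs.comp (contDiff_id.sub contDiff_const)).contDiffAt
      (hφs.comp (contDiff_const.sub contDiff_id)).contDiffAt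
    · intro j
      have := hB (x + -(κ / 2)) j
      rw [← congrFun (iteratedDeriv_comp_add_const j φ (-(κ / 2))) x] at this
      simpa only [sub_eq_add_neg] using this
    · intro j
      have := hB (κ - x) j
      rw [congrFun (iteratedDeriv_comp_const_sub j φ κ) x, smul_eq_mul, abs_mul, abs_pow, abs_neg,
        abs_one, one_pow, one_mul]
      exact this
  have hκ2 : κ / 2 < κ := by linarith
  set c := ∫ x in (κ / 2)..κ, β x with hc
  have hc0 : 0 < c := intervalIntegral.intervalIntegral_pos_of_pos_on
    (hβs.continuous.intervalIntegrable _ _)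
    (fun x hx => mul_pos (hφpos _ (by linarith [hx.1])) (hφpos _ (by linarith [hx.2]))) hκ2
  set Ψ : ℝ → ℝ := fun x => c⁻¹ * ∫ y in (κ / 2)..x, β y with hΨ
  have hderiv : ∀ x, HasDerivAt Ψ (c⁻¹ * β x) x := fun x =>
    (intervalIntegral.integral_hasDerivAt_right (hβs.continuous.intervalIntegrable _ _)
      (hβs.continuous.stronglyMeasurableAtFilter _ _) hβs.continuous.continuousAt).const_mul _
  have hderiv' : deriv Ψ = fun x => c⁻¹ * β x := funext fun x => (hderiv x).deriv
  have hΨs : ContDiff ℝ ∞ Ψ := contDiff_infty_iff_deriv.2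
    ⟨fun x => (hderiv x).differentiableAt, hderiv' ▸ contDiff_const.mul hβs⟩
  have hΨ0 : ∀ x ≤ κ / 2, Ψ x = 0 := by
    intro x hx
    have : ∫ y in (κ / 2)..x, β y = ∫ y in (κ / 2)..x, (0 : ℝ) :=
      intervalIntegral.integral_congr fun y hy => by
        rw [uIcc_of_ge hx] at hy
        simp only [hβ, hφzero (y - κ / 2) (by linarith [hy.2]), zero_mul]
    simp only [hΨ, this, intervalIntegral.integral_zero, mul_zero]
  have hΨ1 : ∀ x, κ ≤ x → Ψ x = 1 := by
    intro x hx
    have h0 : ∫ y in κ..x, β y = ∫ y in κ..x, (0 : ℝ) :=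
      intervalIntegral.integral_congr fun y hy => by
        rw [uIcc_of_le hx] at hy
        simp only [hβ, hφzero (κ - y) (by linarith [hy.1]), mul_zero]
    have h1 := intervalIntegral.integral_add_adjacent_intervals
      (hβs.continuous.intervalIntegrable (μ := volume) (κ / 2) κ)
      (hβs.continuous.intervalIntegrable κ x)
    rw [h0, intervalIntegral.integral_zero, add_zero] at h1
    simp only [hΨ, ← h1]
    exact inv_mul_cancel₀ hc0.ne'
  obtain ⟨K, hK⟩ := isCompact_Icc.exists_bound_of_continuousOn (s := Icc (κ / 2) κ)
    hΨs.continuous.continuousOn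
  have hbd : ∀ x, |Ψ x| ≤ max K 1 := by
    intro x
    rcases le_total x (κ / 2) with h | h
    · rw [hΨ0 x h, abs_zero]
      exact zero_le_one.trans (le_max_right _ _)
    rcases le_total x κ with h' | h'
    · exact (hK x ⟨h, h'⟩).trans (le_max_left _ _)
    · rw [hΨ1 x h', abs_one]
      exact le_max_right _ _
  refine ⟨Ψ, hΨs, hΨ0, hΨ1, max (max K 1) c⁻¹, B + B, ?_, by linarith, fun x j => ?_⟩
  · positivity
  cases j with
  | zero => simpa using Or.inl ((le_max_iff.1 (hbd x)))
  | succ j =>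
    rw [iteratedDeriv_succ', hderiv', iteratedDeriv_const_mul_field, abs_mul,
      abs_of_pos (inv_pos.2 hc0)]
    have h1 : |iteratedDeriv j β x| ≤ (B + B) ^ (j + 1) * ((j + 1).factorial : ℝ) ^ s := by
      refine (hβB x j).trans ?_
      rw [one_mul, one_mul]
      gcongr
      · linarith
      · omega
      · omega
    calc c⁻¹ * |iteratedDeriv j β x| ≤ max (max K 1) c⁻¹ *
          ((B + B) ^ (j + 1) * ((j + 1).factorial : ℝ) ^ s) := by
          gcongr
          exact le_max_right _ _
      _ = _ := by ring

theorem gevreyBoundAt_inv {s δ x : ℝ} (hs : 1 ≤ s) (hδ : 0 < δ) (hx : 2 * δ ≤ x) :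
    GevreyBoundAt s δ⁻¹ δ⁻¹ (fun y => y⁻¹) x := by
  intro j
  have h1 := abs_iteratedDeriv_le_of_complex (f := fun z : ℂ => z⁻¹) (g := fun y => y⁻¹)
    (Ω := {z : ℂ | z ≠ 0}) isOpen_ne
    (fun z hz => (differentiableAt_inv hz).differentiableWithinAt)
    (fun t _ => by rw [← Complex.ofReal_inv, Complex.ofReal_re]) (x := x) hδ
    (C := δ⁻¹) ?_ ?_ j
  · refine h1.trans ?_
    rw [inv_pow]
    have h2 : (j.factorial : ℝ) ≤ (j.factorial : ℝ) ^ s := by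
      conv_lhs => rw [← Real.rpow_one (j.factorial : ℝ)]
      exact Real.rpow_le_rpow_of_exponent_le
        (by exact_mod_cast Nat.one_le_iff_ne_zero.2 (Nat.factorial_ne_zero j)) hs
    calc _ = δ⁻¹ * (δ ^ j)⁻¹ * j.factorial := by field_simp
      _ ≤ _ := by gcongr
  all_goals
    intro z hz
    have h3 : δ ≤ ‖z‖ := by
      have h4 : ‖(x : ℂ)‖ - ‖z‖ ≤ ‖(x : ℂ) - z‖ := norm_sub_norm_le _ _
      rw [Metric.mem_closedBall, dist_comm, dist_eq_norm] at hz
      rw [Complex.norm_real, Real.norm_of_nonneg (by linarith)] at h4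
      linarith
  · show z ≠ 0
    rw [← norm_pos_iff]
    linarith
  · rw [norm_inv]
    gcongr

/-- A smooth function of Gevrey class `s > 1` which equals `1/x` for `|x| ≥ κ`. -/
theorem exists_gevrey_inverse {s κ : ℝ} (hs : 1 < s) (hκ : 0 < κ) :
    ∃ h : ℝ → ℝ, ContDiff ℝ ∞ h ∧ (∀ x, κ ≤ |x| → h x = x⁻¹) ∧
      ∃ A B : ℝ, 0 ≤ A ∧ 1 ≤ B ∧ ∀ x, GevreyBoundAt s A B h x := by
  obtain ⟨Ψ, hΨs, hΨ0, hΨ1, A, B, hA, hB, hΨB⟩ := exists_gevrey_step hs hκ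
  have hB0 : 0 ≤ B := zero_le_one.trans hB
  -- The step vanishes below `κ/2 = 2δ`, so `1/x` is only needed where the disc of radius `δ` avoids
  -- the origin.
  set δ := κ / 4 with hδ
  have hδ0 : 0 < δ := by positivity
  set H : ℝ → ℝ := fun x => Ψ x * x⁻¹ with hH
  have hH0 : ∀ x < κ / 2, H =ᶠ[𝓝 x] fun _ => 0 := by
    intro x hx
    filter_upwards [gt_mem_nhds hx] with y hy
    simp only [hH, hΨ0 y (le_of_lt hy), zero_mul]
  have hHs : ContDiff ℝ ∞ H := by
    rw [contDiff_iff_contDiffAt]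
    intro x
    rcases lt_or_ge x (κ / 2) with h | h
    · exact contDiffAt_const.congr_of_eventuallyEq (hH0 x h)
    · exact hΨs.contDiffAt.mul (contDiffAt_inv ℝ (by linarith : 0 < x).ne')
  have hHB : ∀ x, GevreyBoundAt s (A * δ⁻¹) (B + δ⁻¹) H x := by
    intro x
    rcases lt_or_ge x (κ / 2) with h | h
    · exact (gevreyBoundAt_zero (by positivity) (by positivity)).congr (hH0 x h)
    · exact (hΨB x).mul (by linarith) hA hB0 (by positivity) (by positivity)
        (gevreyBoundAt_inv hs.le hδ0 (by rw [hδ]; linarith)) hΨs.contDiffAt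
        (contDiffAt_inv ℝ (by linarith : 0 < x).ne')
  have hHns : ContDiff ℝ ∞ fun x => H (-x) := hHs.comp contDiff_neg
  -- `H` handles positive `x` only. Antisymmetrizing covers negative `x`, and since `H` vanishes on
  -- `x ≤ κ/2` at most one of the two terms is nonzero.
  refine ⟨fun x => H x - H (-x), hHs.sub hHns, fun x hx => ?_,
    A * δ⁻¹ + A * δ⁻¹, B + δ⁻¹, by positivity, ?_, fun x j => ?_⟩
  · rcases le_abs.1 hx with h | h
    · simp only [hH, hΨ1 x h, hΨ0 (-x) (by linarith), one_mul, zero_mul, sub_zero]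
    · simp only [hH, hΨ1 (-x) h, hΨ0 x (by linarith), one_mul, zero_mul, zero_sub, inv_neg, neg_neg]
  · have : 0 ≤ δ⁻¹ := by positivity
    linarith
  · have h1 := iteratedDeriv_fun_sub (n := j) (hHs.contDiffAt (x := x).of_le (by exact_mod_cast le_top))
      (hHns.contDiffAt (x := x).of_le (by exact_mod_cast le_top))
    rw [h1, iteratedDeriv_comp_neg, add_mul, add_mul]
    refine (abs_sub _ _).trans (add_le_add (hHB x j) ?_)
    rw [smul_eq_mul, abs_mul, abs_pow, abs_neg, abs_one, one_pow, one_mul]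
    exact hHB (-x) j

end GevreyCutoff

/-! ### Gamma function inequalities and the Leibniz series -/

section GammaEstimates

/-- By convexity of `log Γ`, its slope on `[x, x+s]` is at most its slope on `[x+s, x+s+1]`, which
is `log(x+s)`. -/
theorem Gamma_add_le {x s : ℝ} (hx : 0 < x) (hs : 0 ≤ s) :
    Real.Gamma (x + s) ≤ (x + s) ^ s * Real.Gamma x := by
  rcases hs.eq_or_lt with rfl | hs
  · simp
  have h1 := Real.convexOn_log_Gamma.slope_mono_adjacent (x := x) (y := x + s) (z := x + s + 1)
    hx (by simp; linarith) (by linarith) (by linarith)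
  have hxs : 0 < x + s := by linarith
  simp only [Function.comp_apply, add_sub_cancel_left, div_one] at h1
  rw [Real.Gamma_add_one hxs.ne', Real.log_mul hxs.ne' (Real.Gamma_pos_of_pos hxs).ne',
    add_sub_cancel_right, div_le_iff₀ hs] at h1
  rw [← Real.log_le_log_iff (Real.Gamma_pos_of_pos hxs)
    (mul_pos (Real.rpow_pos_of_pos hxs _) (Real.Gamma_pos_of_pos hx)),
    Real.log_mul (Real.rpow_pos_of_pos hxs _).ne' (Real.Gamma_pos_of_pos hx).ne', Real.log_rpow hxs]
  linarith

/-- The companion inequality: the slope of `log Γ` on `[x-1, x]`, which is `log(x-1)`, is at most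
that on `[x, x+s]`. -/
theorem mul_Gamma_le_Gamma_add {x s : ℝ} (hx : 1 < x) (hs : 0 ≤ s) :
    (x - 1) ^ s * Real.Gamma x ≤ Real.Gamma (x + s) := by
  rcases hs.eq_or_lt with rfl | hs
  · simp
  have hx1 : 0 < x - 1 := by linarith
  have hx0 : 0 < x := by linarith
  have hxs : 0 < x + s := by linarith
  have h1 := Real.convexOn_log_Gamma.slope_mono_adjacent (x := x - 1) (y := x) (z := x + s)
    hx1 hxs (by linarith) (by linarith)
  have h2 : Real.Gamma x = (x - 1) * Real.Gamma (x - 1) := by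
    rw [← Real.Gamma_add_one hx1.ne', sub_add_cancel]
  have h3 : Real.log (Real.Gamma x) = Real.log (x - 1) + Real.log (Real.Gamma (x - 1)) := by
    rw [h2, Real.log_mul hx1.ne' (Real.Gamma_pos_of_pos hx1).ne']
  simp only [Function.comp_apply, sub_sub_cancel, div_one, add_sub_cancel_left] at h1
  rw [h3, add_sub_cancel_right, le_div_iff₀ hs, ← h3] at h1
  rw [← Real.log_le_log_iff (mul_pos (Real.rpow_pos_of_pos hx1 _) (Real.Gamma_pos_of_pos hx0))
    (Real.Gamma_pos_of_pos hxs),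
    Real.log_mul (Real.rpow_pos_of_pos hx1 _).ne' (Real.Gamma_pos_of_pos hx0).ne',
    Real.log_rpow hx1]
  linarith

/-- Log-convexity gives the opposite inequality without a constant. Reversing it costs only
`((x+ρ)/(x-1))^(ρθ)`, and `x + ρ ≤ (2+ρ)(x-1)` for `x ≥ 2`. -/
theorem Gamma_interpolation {x ρ θ : ℝ} (hx : 2 ≤ x) (hρ : 0 ≤ ρ) (h0 : 0 ≤ θ) (h1 : θ ≤ 1) :
    Real.Gamma x ^ (1 - θ) * Real.Gamma (x + ρ) ^ θ
      ≤ (2 + ρ) ^ ρ * Real.Gamma (x + θ * ρ) := by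
  have hx0 : 0 < x := by linarith
  have hG : 0 < Real.Gamma x := Real.Gamma_pos_of_pos hx0
  have hG' : 0 < Real.Gamma (x + ρ) := Real.Gamma_pos_of_pos (by linarith)
  calc Real.Gamma x ^ (1 - θ) * Real.Gamma (x + ρ) ^ θ
      ≤ Real.Gamma x ^ (1 - θ) * ((x + ρ) ^ ρ * Real.Gamma x) ^ θ := by
        gcongr
        exact Gamma_add_le hx0 hρ
    _ = (x + ρ) ^ (ρ * θ) * Real.Gamma x := by
        rw [Real.mul_rpow (by positivity) hG.le, ← Real.rpow_mul (by positivity), mul_left_comm,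
          ← Real.rpow_add hG]
        simp
    _ ≤ ((2 + ρ) * (x - 1)) ^ (ρ * θ) * Real.Gamma x := by
        gcongr
        nlinarith
    _ = (2 + ρ) ^ (ρ * θ) * ((x - 1) ^ (θ * ρ) * Real.Gamma x) := by
        rw [Real.mul_rpow (by positivity) (by linarith), mul_comm θ ρ]
        ring
    _ ≤ (2 + ρ) ^ ρ * Real.Gamma (x + θ * ρ) := by
        have h2 : 0 ≤ (x - 1) ^ (θ * ρ) := Real.rpow_nonneg (by linarith) _
        gcongr
        · linarith
        · exact mul_le_of_le_one_right hρ h1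
        · exact mul_Gamma_le_Gamma_add (by linarith) (by positivity)

/-- Each factor `(N-b)^λ` is traded for a raise of the Gamma argument by `λ`. This needs `N - b` to
be at most the lowered argument minus one, which follows from `X ≥ 2` and `μ ≥ λ ≥ 1`. -/
theorem descFactorial_rpow_mul_Gamma_le {X μ lam : ℝ} (hX : 2 ≤ X) (hlam : 1 ≤ lam)
    (hμ : lam ≤ μ) (N b : ℕ) (hb : b ≤ N) :
    (N.descFactorial b : ℝ) ^ lam * Real.Gamma (X + μ * N - lam * b) ≤ Real.Gamma (X + μ * N) := by
  induction b with
  | zero => simp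
  | succ b ih =>
    refine le_trans ?_ (ih (by omega))
    have hNb : (b : ℝ) + 1 ≤ N := by exact_mod_cast hb
    have h1 : lam * (b + 1) ≤ μ * (b + 1) := by gcongr
    have h2 : (N : ℝ) - (b + 1) ≤ μ * (N - (b + 1)) :=
      le_mul_of_one_le_left (by linarith) (by linarith)
    have h3 : (N : ℝ) - b ≤ X + μ * N - lam * (b + 1) - 1 := by nlinarith
    have h4 := mul_Gamma_le_Gamma_add (x := X + μ * N - lam * (b + 1)) (s := lam) (by linarith)
      (by linarith)
    rw [show X + μ * N - lam * (b + 1) + lam = X + μ * N - lam * b by ring] at h4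
    rw [Nat.descFactorial_succ]
    push_cast [Nat.cast_sub (by omega : b ≤ N)]
    rw [Real.mul_rpow (by linarith) (by positivity), mul_comm (((N : ℝ) - b) ^ lam), mul_assoc]
    gcongr
    refine le_trans ?_ h4
    have : 0 ≤ Real.Gamma (X + μ * N - lam * (b + 1)) :=
      (Real.Gamma_pos_of_pos (by linarith)).le
    gcongr
    linarith

/-- The product `(N choose b) b!` is the falling factorial, which is at least `b!`. Gamma absorbs
its full power `λ` although only the first power is present; the spare power `λ-1` yields the
denominator that makes the Leibniz sum converge uniformly in `N`. -/
theorem choose_mul_factorial_mul_Gamma_le {X μ lam : ℝ} (hX : 2 ≤ X) (hlam : 1 ≤ lam)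
    (hμ : lam ≤ μ) (N b : ℕ) (hb : b ≤ N) :
    (N.choose b : ℝ) * b.factorial * Real.Gamma (X + μ * N - lam * b)
      ≤ Real.Gamma (X + μ * N) / (b.factorial : ℝ) ^ (lam - 1) := by
  have hf : (0 : ℝ) < b.factorial := by exact_mod_cast Nat.factorial_pos b
  have hle : (b.factorial : ℝ) ≤ N.descFactorial b := by
    rw [Nat.descFactorial_eq_factorial_mul_choose]
    exact_mod_cast Nat.le_mul_of_pos_right _ (Nat.choose_pos hb)
  have hd : (0 : ℝ) < N.descFactorial b := hf.trans_le hle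
  have hNb : (b : ℝ) ≤ N := by exact_mod_cast hb
  have h0 : 0 < X + μ * N - lam * b := by
    have : lam * b ≤ μ * N := by gcongr; linarith
    linarith
  have hG := Real.Gamma_pos_of_pos h0
  rw [le_div_iff₀ (by positivity)]
  refine le_trans ?_ (descFactorial_rpow_mul_Gamma_le hX hlam hμ N b hb)
  have h1 : (N.choose b : ℝ) * b.factorial = N.descFactorial b := by
    rw [Nat.descFactorial_eq_factorial_mul_choose]
    push_cast
    ring
  calc _ = ((N.descFactorial b : ℝ) * (b.factorial : ℝ) ^ (lam - 1)) *
        Real.Gamma (X + μ * N - lam * b) := by rw [h1]; ring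
    _ ≤ ((N.descFactorial b : ℝ) * (N.descFactorial b : ℝ) ^ (lam - 1)) *
        Real.Gamma (X + μ * N - lam * b) := by
        gcongr
    _ = _ := by
        rw [← Real.rpow_one_add' hd.le (by linarith)]
        congr 2
        ring

/-- The series whose sum bounds the Leibniz expansions of products of Gevrey functions. -/
def gevreySeriesTerm (A σ lam : ℝ) (b : ℕ) : ℝ :=
  A ^ b * ((b : ℝ) ^ σ) ^ b / (b.factorial : ℝ) ^ (lam - 1)

theorem gevreySeriesTerm_nonneg {A σ lam : ℝ} (hA : 0 ≤ A) (b : ℕ) :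
    0 ≤ gevreySeriesTerm A σ lam b := by
  unfold gevreySeriesTerm
  positivity

theorem summable_gevreySeriesTerm {A σ lam : ℝ} (hA : 0 ≤ A) (hσ : 0 ≤ σ) (hlam : σ + 1 < lam) :
    Summable (gevreySeriesTerm A σ lam) := by
  set ε := lam - 1 - σ with hε
  have hε0 : 0 < ε := by linarith
  -- From `b^b ≤ e^b b!` the term is at most `(A e^σ)^b / b!^ε`. The extra `2` in `y` leaves a
  -- geometric factor `2^(-b)` once `y^b / b!^ε = (z^b / b!)^ε` is bounded by `(e^z)^ε`.
  set y := A * Real.exp σ * 2 with hy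
  have hy0 : 0 ≤ y := by positivity
  set z := y ^ (1 / ε) with hz
  have hz0 : 0 ≤ z := by positivity
  have hg : Summable fun b : ℕ => Real.exp z ^ ε * (1 / 2 : ℝ) ^ b :=
    (summable_geometric_of_lt_one (by norm_num) (by norm_num)).mul_left _
  refine Summable.of_nonneg_of_le (gevreySeriesTerm_nonneg hA) (fun b => ?_) hg
  have hf : (0 : ℝ) < b.factorial := by exact_mod_cast Nat.factorial_pos b
  have h1 : ((b : ℝ) ^ σ) ^ b ≤ Real.exp σ ^ b * (b.factorial : ℝ) ^ σ := by
    have h2 := Real.pow_div_factorial_le_exp b (by positivity) b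
    rw [div_le_iff₀ hf] at h2
    calc ((b : ℝ) ^ σ) ^ b = ((b : ℝ) ^ b) ^ σ := by
          rw [← Real.rpow_natCast, ← Real.rpow_natCast, ← Real.rpow_mul (by positivity),
            ← Real.rpow_mul (by positivity), mul_comm]
      _ ≤ (Real.exp b * b.factorial) ^ σ := by gcongr
      _ = _ := by
          rw [Real.mul_rpow (by positivity) (by positivity), ← Real.exp_mul, ← Real.exp_nat_mul]
  have h3 : y ^ b / (b.factorial : ℝ) ^ ε ≤ Real.exp z ^ ε := by
    have h4 := Real.pow_div_factorial_le_exp z hz0 b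
    calc y ^ b / (b.factorial : ℝ) ^ ε = (z ^ b / b.factorial) ^ ε := by
          rw [Real.div_rpow (by positivity) (by positivity), hz, ← Real.rpow_natCast,
            ← Real.rpow_natCast, ← Real.rpow_mul hy0, ← Real.rpow_mul hy0]
          congr 2
          field_simp
      _ ≤ _ := by gcongr
  have h5 : (b.factorial : ℝ) ^ (lam - 1) = (b.factorial : ℝ) ^ ε * (b.factorial : ℝ) ^ σ := by
    rw [← Real.rpow_add hf]
    congr 1
    rw [hε]; ring
  unfold gevreySeriesTerm
  rw [h5]
  calc _ ≤ A ^ b * (Real.exp σ ^ b * (b.factorial : ℝ) ^ σ) /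
        ((b.factorial : ℝ) ^ ε * (b.factorial : ℝ) ^ σ) := by gcongr
    _ = y ^ b / (b.factorial : ℝ) ^ ε * (1 / 2) ^ b := by
        rw [hy, mul_pow, mul_pow, div_pow, one_pow]
        field_simp
    _ ≤ _ := by gcongr

end GammaEstimates

/-! ### Composition of Gevrey functions -/

section GevreyComposition

variable {V : Type*} [NormedAddCommGroup V] [NormedSpace ℝ V] {W : Set V}

theorem factorial_succ_le_pow (j : ℕ) : (j + 1).factorial ≤ (j + 1) ^ j := by
  induction j with
  | zero => simp
  | succ j ih =>
    rw [Nat.factorial_succ, pow_succ, mul_comm]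
    gcongr
    exact ih.trans (Nat.pow_le_pow_left (by omega) j)

/-- Fix the order `b`. For `i ≤ b` one has `i!^e ≤ b^(ei)`, so up to order `b` Gevrey bounds become
analytic ones with constants depending on `b`, and `norm_iterLineDeriv_comp_le` applies. The two
classes `r` and `s` enter as a sum, not as a product; a product of both powers would demand a larger
`μ`. -/
theorem norm_iterLineDeriv_gevrey_comp_le (hW : IsOpen W) {x : V} (hx : x ∈ W) (S : Set V)
    {h : ℝ → ℝ} (hh : ContDiff ℝ ∞ h) {φ : V → ℝ} (hφ : ContDiffOn ℝ ∞ φ W)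
    {s A B L R r : ℝ} (hs : 1 ≤ s) (hr : 1 ≤ r) (hA : 0 ≤ A) (hB : 0 ≤ B) (hL : 0 ≤ L)
    (hR : 0 ≤ R) (hb : GevreyBoundAt s A B h (φ x))
    (hφb : ∀ l : List V, (∀ v ∈ l, v ∈ S) →
      |iterLineDeriv l φ x| ≤ R * L ^ l.length * (l.length.factorial : ℝ) ^ r)
    (l : List V) (hl : ∀ v ∈ l, v ∈ S) :
    |iterLineDeriv l (fun y => h (φ y)) x| ≤ A * l.length.factorial *
      ((4 * L) ^ l.length * ((l.length : ℝ) ^ (r - 1)) ^ l.length +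
        (8 * L * R * B) ^ l.length * ((l.length : ℝ) ^ (s - 1)) ^ l.length) := by
  rcases Nat.eq_zero_or_pos l.length with h0 | h0
  · have hb0 := hb 0
    obtain rfl := List.length_eq_zero_iff.1 h0
    simp at hb0 ⊢
    linarith
  set b := l.length with hbdef
  have hb1 : (1 : ℝ) ≤ b := by exact_mod_cast h0
  have hb0 : (0 : ℝ) < b := by linarith
  have hfac : ∀ {i : ℕ} {e : ℝ}, 0 ≤ e → i ≤ b → (i.factorial : ℝ) ^ e ≤ ((b : ℝ) ^ e) ^ i := by
    intro i e he hi
    rw [← Real.rpow_natCast, ← Real.rpow_mul hb0.le, mul_comm, Real.rpow_mul hb0.le,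
      Real.rpow_natCast]
    gcongr
    exact_mod_cast (Nat.factorial_le_pow i).trans (Nat.pow_le_pow_left hi i)
  -- For `i ≥ 1` the sharper `i! ≤ b^(i-1)` saves one factor `b^e`. It goes into the denominator of
  -- `a` below, so that in `d(2 + 4aH)` it cancels the `b^(r-1)` of `d` against `H`.
  have hfac' : ∀ {i : ℕ} {e : ℝ}, 0 ≤ e → i ≤ b → 1 ≤ i →
      (i.factorial : ℝ) ^ e * (b : ℝ) ^ e ≤ ((b : ℝ) ^ e) ^ i := by
    intro i e he hi hi1
    obtain ⟨j, rfl⟩ : ∃ j, i = j + 1 := ⟨i - 1, by omega⟩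
    rw [pow_succ]
    gcongr
    rw [← Real.rpow_natCast, ← Real.rpow_mul hb0.le, mul_comm, Real.rpow_mul hb0.le,
      Real.rpow_natCast]
    gcongr
    exact_mod_cast (factorial_succ_le_pow j).trans (Nat.pow_le_pow_left hi j)
  have hsplit : ∀ {i : ℕ} {e : ℝ}, 1 ≤ e →
      (i.factorial : ℝ) ^ e = i.factorial * (i.factorial : ℝ) ^ (e - 1) := by
    intro i e he
    rw [← Real.rpow_one_add' (by positivity) (by linarith)]
    ring_nf
  set H := B * (b : ℝ) ^ (s - 1) with hH
  set d := L * (b : ℝ) ^ (r - 1) with hd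
  set a := R / (b : ℝ) ^ (r - 1) with ha
  have hbr : 0 < (b : ℝ) ^ (r - 1) := by positivity
  have key := norm_iterLineDeriv_comp_le hW hx S b (h := fun j => iteratedDeriv j h) hφ
    (fun j => by
      rw [iteratedDeriv_eq_iterate]
      exact hh.iterate_deriv j)
    (fun j y => by rw [iteratedDeriv_succ]) hA (H := H) (by positivity) (a := a) (by positivity)
    (d := d) (by positivity)
    (fun j hj => by
      refine (hb j).trans ?_
      rw [hsplit hs, hH, mul_pow]
      have := hfac (e := s - 1) (by linarith) hj
      calc _ = A * B ^ j * j.factorial * (j.factorial : ℝ) ^ (s - 1) := by ring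
        _ ≤ A * B ^ j * j.factorial * ((b : ℝ) ^ (s - 1)) ^ j := by gcongr
        _ = _ := by ring)
    (fun l' hl' hne hlen => by
      refine (hφb l' hl').trans ?_
      have h1 := hfac' (e := r - 1) (by linarith) hlen (List.length_pos_iff.2 hne)
      rw [hsplit hr, hd, ha, mul_pow]
      rw [← le_div_iff₀ hbr] at h1
      calc _ = R * L ^ l'.length * l'.length.factorial * (l'.length.factorial : ℝ) ^ (r - 1) := by
            ring
        _ ≤ R * L ^ l'.length * l'.length.factorial *
            (((b : ℝ) ^ (r - 1)) ^ l'.length / (b : ℝ) ^ (r - 1)) := by gcongr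
        _ = _ := by ring)
    l 0 hl le_rfl
  simp only [iteratedDeriv_zero, pow_zero, mul_one, add_zero] at key
  refine key.trans ?_
  have h1 : d * (2 + 4 * (a * H)) = 2 * L * (b : ℝ) ^ (r - 1) +
      4 * L * R * B * (b : ℝ) ^ (s - 1) := by
    rw [hd, ha, hH]
    field_simp
  rw [← hbdef, h1]
  gcongr
  refine (add_pow_le (by positivity) (by positivity) b).trans ?_
  calc _ ≤ 2 ^ b * ((2 * L * (b : ℝ) ^ (r - 1)) ^ b + (4 * L * R * B * (b : ℝ) ^ (s - 1)) ^ b) := by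
        gcongr
        · norm_num
        · omega
    _ = _ := by
        rw [mul_add, ← mul_pow, ← mul_pow, ← mul_pow, ← mul_pow]
        congr 2 <;> ring

end GevreyComposition

/-! ### The estimate of a single Fourier mode -/

section ModeEstimate

/-- Take the weighted geometric mean of the bounds for `m = ⌊p⌋` and `m + 1`. Every factor but Gamma
interpolates exactly; `Gamma_interpolation` costs `(2+ρ)^ρ`, and `p ≥ 2` puts its argument in the
required range. -/
theorem rpow_mul_le_of_forall_pow_mul_le {K ν d C ρ e g Z : ℝ} (hK : 1 ≤ K) (hν : 1 ≤ ν)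
    (hd : 0 ≤ d) (hC : 1 ≤ C) (hρ : 1 ≤ ρ) (hg : 0 ≤ g) (hZ : 0 ≤ Z)
    (h : ∀ m : ℕ, K ^ m * Z ≤ ν ^ m * (d * C ^ (e + m) * Real.Gamma (ρ * m + g))) {p : ℝ}
    (hp : 2 ≤ p) :
    K ^ p * Z ≤ ν ^ p * ((2 + ρ) ^ ρ * (d * C ^ (e + p) * Real.Gamma (ρ * p + g))) := by
  have hp0 : 0 ≤ p := by linarith
  have hK0 : 0 < K := by linarith
  have hν0 : 0 < ν := by linarith
  have hC0 : 0 < C := by linarith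
  set m := ⌊p⌋₊ with hm
  set θ := p - m with hθ
  have hθ0 : 0 ≤ θ := sub_nonneg.2 (Nat.floor_le hp0)
  have hθ1 : θ ≤ 1 := by
    have := Nat.lt_floor_add_one p
    linarith
  have hm2 : (2 : ℝ) ≤ m := by exact_mod_cast Nat.le_floor (by exact_mod_cast hp)
  have hx : 2 ≤ ρ * m + g := by nlinarith
  have hG1 : 0 < Real.Gamma (ρ * m + g) := Real.Gamma_pos_of_pos (by linarith)
  have hG2 : 0 < Real.Gamma (ρ * m + g + ρ) := Real.Gamma_pos_of_pos (by linarith)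
  have hint := Gamma_interpolation hx (by linarith : 0 ≤ ρ) hθ0 hθ1
  rw [show ρ * m + g + θ * ρ = ρ * p + g by rw [hθ]; ring] at hint
  have h1 := h m
  have h2 := h (m + 1)
  push_cast at h2
  rw [show ρ * ((m : ℝ) + 1) + g = ρ * m + g + ρ by ring] at h2
  have hinterp : ∀ {y : ℝ}, 0 < y → ∀ f : ℝ, y ^ (f + p) =
      (y ^ (f + m)) ^ (1 - θ) * (y ^ (f + (m + 1))) ^ θ := by
    intro y hy f
    rw [← Real.rpow_mul hy.le, ← Real.rpow_mul hy.le, ← Real.rpow_add hy]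
    congr 1
    rw [hθ]; ring
  have hinterp0 : ∀ {y : ℝ}, 0 < y → y ^ p = (y ^ m) ^ (1 - θ) * (y ^ (m + 1)) ^ θ := by
    intro y hy
    have := hinterp hy 0
    simp only [zero_add] at this
    rw [this]
    norm_cast
  have hone : ∀ {y : ℝ}, 0 ≤ y → y = y ^ (1 - θ) * y ^ θ := by
    intro y hy
    rcases hy.eq_or_lt with rfl | hy
    · rcases eq_or_ne θ 0 with h0 | h0
      · simp [h0]
      · simp [Real.zero_rpow h0]
    · rw [← Real.rpow_add hy]
      simp
  calc K ^ p * Z = (K ^ m * Z) ^ (1 - θ) * (K ^ (m + 1) * Z) ^ θ := by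
        conv_lhs => rw [hinterp0 hK0, hone hZ]
        rw [Real.mul_rpow (by positivity) hZ, Real.mul_rpow (by positivity) hZ]
        ring
    _ ≤ (ν ^ m * (d * C ^ (e + m) * Real.Gamma (ρ * m + g))) ^ (1 - θ) *
        (ν ^ (m + 1) * (d * C ^ (e + (m + 1)) * Real.Gamma (ρ * m + g + ρ))) ^ θ := by
        have : 0 ≤ 1 - θ := by linarith
        gcongr
    _ = ν ^ p * (d * C ^ (e + p) *
        (Real.Gamma (ρ * m + g) ^ (1 - θ) * Real.Gamma (ρ * m + g + ρ) ^ θ)) := by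
        rw [hinterp0 hν0, hinterp hC0 e]
        conv_rhs => rw [hone hd]
        rw [Real.mul_rpow (by positivity) (by positivity), Real.mul_rpow (by positivity)
          (by positivity), Real.mul_rpow (by positivity) (by positivity),
          Real.mul_rpow (by positivity) (by positivity), Real.mul_rpow (by positivity)
          (by positivity), Real.mul_rpow (by positivity) (by positivity)]
        ring
    _ ≤ ν ^ p * (d * C ^ (e + p) * ((2 + ρ) ^ ρ * Real.Gamma (ρ * p + g))) := by gcongr
    _ = _ := by ring

variable {V : Type*} [NormedAddCommGroup V] [NormedSpace ℝ V] {W : Set V}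

/-- The constant in the estimate of one Fourier mode of the solution; `M` bounds the Gevrey norm of
the frequency map. -/
def modeConstant (n : ℕ) (ρ τ μ L A B s M : ℝ) : ℝ :=
  A * ((n : ℝ) ^ ((n : ℝ) + τ + 1) * (2 + ρ) ^ ρ) *
    (∑' b, gevreySeriesTerm (4 * L) (ρ * (τ + 1)) μ b +
      ∑' b, gevreySeriesTerm (8 * L * M * B * (n : ℝ) ^ (τ + 1)) (s - 1) (μ - ρ * (τ + 1)) b)

/-- The heart of the estimate. In the Leibniz sum, the part of the bound for `h ∘ φ` free of `K` is
paired with `p = n+τ+1` powers of decay of `Φ`, and the part growing like `K^((τ+1)i)` with `p +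
(τ+1)i` powers. In both cases `K^τ K^(-p) = K^(-(n+1))` is left. -/
theorem norm_iterLineDeriv_mode_le (hW : IsOpen W) {x : V} (hx : x ∈ W) (S : Set V)
    {h : ℝ → ℝ} (hh : ContDiff ℝ ∞ h) {φ : V → ℝ} (hφ : ContDiffOn ℝ ∞ φ W) {Φ : V → ℂ}
    (hΦ : ContDiffOn ℝ ∞ Φ W) {n : ℕ} {ρ τ μ s A B L M K d C q a : ℝ} (hn : 1 ≤ n)
    (hρ : 1 ≤ ρ) (hτ : 0 < τ) (hs : 1 < s) (hμ : ρ * (τ + 1) + s < μ)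
    (hA : 0 ≤ A) (hB : 0 ≤ B) (hL : 0 ≤ L) (hM : 0 ≤ M) (hK : 1 ≤ K) (hd : 0 ≤ d) (hC : 1 ≤ C)
    (hq : 0 < q) (ha : 0 ≤ a) (hb : GevreyBoundAt s A B h (φ x))
    (hφb : ∀ l : List V, (∀ v ∈ l, v ∈ S) → |iterLineDeriv l φ x| ≤
      M * K ^ (τ + 1) * L ^ l.length * (l.length.factorial : ℝ) ^ (ρ * (τ + 1) + 1))
    (hΦb : ∀ l : List V, (∀ v ∈ l, v ∈ S) → ∀ m : ℕ, K ^ m * ‖iterLineDeriv l Φ x‖ ≤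
      (n : ℝ) ^ m * (K ^ τ * d * C ^ (a + μ * l.length + m) *
        Real.Gamma (ρ * m + (ρ * a + μ * l.length + q))))
    (l : List V) (hl : ∀ v ∈ l, v ∈ S) :
    ‖iterLineDeriv l (fun y => h (φ y) • Φ y) x‖ ≤ (K ^ (n + 1))⁻¹ *
      (modeConstant n ρ τ μ L A B s M * d * C ^ ((n : ℝ) + τ + a + μ * l.length + 1) *
        Real.Gamma (ρ * a + μ * l.length + ρ * ((n : ℝ) + τ + 1) + q)) := by
  have hK0 : 0 < K := by linarith
  have hC0 : 0 < C := by linarith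
  have hn1 : (1 : ℝ) ≤ n := by exact_mod_cast hn
  have hτ1 : 1 ≤ τ + 1 := by linarith
  have hρτ : 1 ≤ ρ * (τ + 1) := one_le_mul_of_one_le_of_one_le hρ hτ1
  have hμτ : τ + 1 ≤ μ := by nlinarith
  have hμ0 : 0 < μ := by linarith
  set p := (n : ℝ) + τ + 1 with hp
  have hp2 : 2 ≤ p := by linarith
  set N := l.length with hN
  set T : ℝ → ℕ → ℝ := fun p' c => (n : ℝ) ^ p' * ((2 + ρ) ^ ρ * (d * C ^ (a + μ * c + p') *
    Real.Gamma (ρ * p' + (ρ * a + μ * c + q)))) with hT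
  have hTb : ∀ l' : List V, (∀ v ∈ l', v ∈ S) → ∀ p', 2 ≤ p' →
      K ^ p' * ‖iterLineDeriv l' Φ x‖ ≤ K ^ τ * T p' l'.length := by
    intro l' hl' p' hp'
    refine (rpow_mul_le_of_forall_pow_mul_le hK hn1 (by positivity) hC hρ (by positivity)
      (norm_nonneg _) (hΦb l' hl') hp').trans_eq ?_
    rw [hT]; ring
  -- The Leibniz bound takes a single majorant for each order of `Φ`. The minimum keeps both decay
  -- estimates available, so that each part of the bound for `h ∘ φ` can use its own; `N - c` is the
  -- number of derivatives falling on `h ∘ φ`.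
  set b : ℕ → ℝ := fun c => (K ^ (n + 1))⁻¹ * min (T p c)
    (((K ^ (τ + 1)) ^ (N - c))⁻¹ * T (p + (τ + 1) * (N - c : ℕ)) c) with hbdef
  have hKp : K ^ p = K ^ τ * K ^ (n + 1) := by
    rw [hp, ← Real.rpow_natCast, ← Real.rpow_add hK0]
    congr 1
    push_cast
    ring
  have hbb : ∀ l' : List V, (∀ v ∈ l', v ∈ S) → l'.length ≤ l.length →
      ‖iterLineDeriv l' Φ x‖ ≤ b l'.length := by
    intro l' hl' _
    have hKτ : 0 < K ^ τ := by positivity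
    have h1 := hTb l' hl' p hp2
    have h2 := hTb l' hl' (p + (τ + 1) * (N - l'.length : ℕ)) (by
      have : 0 ≤ (τ + 1) * ((N - l'.length : ℕ) : ℝ) := by positivity
      linarith)
    rw [hKp, mul_assoc, mul_le_mul_iff_right₀ hKτ] at h1
    rw [Real.rpow_add hK0, hKp, Real.rpow_mul hK0.le, Real.rpow_natCast, mul_assoc, mul_assoc,
      mul_le_mul_iff_right₀ hKτ] at h2
    rw [hbdef]
    simp only
    rw [inv_mul_eq_div, le_div_iff₀ (by positivity), le_min_iff, inv_mul_eq_div,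
      le_div_iff₀ (by positivity)]
    constructor <;> linarith
  refine (norm_iterLineDeriv_smul_le hW hx S l (hh.comp_contDiffOn hφ) hΦ hl
    (a := fun i => A * i.factorial * ((4 * L) ^ i * ((i : ℝ) ^ (ρ * (τ + 1))) ^ i +
      (8 * L * (M * K ^ (τ + 1)) * B) ^ i * ((i : ℝ) ^ (s - 1)) ^ i)) (b := b)
    (fun l' hl' _ => by
      have := norm_iterLineDeriv_gevrey_comp_le hW hx S hh hφ hs.le
        (by linarith : 1 ≤ ρ * (τ + 1) + 1) hA hB hL (by positivity) hb hφb l' hl'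
      rwa [add_sub_cancel_right] at this) hbb).trans ?_
  set Y := ρ * a + μ * N + ρ * p + q with hY
  set X := ρ * a + ρ * p + q with hX
  have hX2 : 2 ≤ X := by
    have : 1 * p ≤ ρ * p := by gcongr
    have : 0 ≤ ρ * a := by positivity
    linarith
  have hYX : X + μ * N = Y := by rw [hX, hY]; ring
  have hY0 : 0 < Y := by
    rw [← hYX]
    have : 0 ≤ μ * N := by positivity
    linarith
  have hG := Real.Gamma_pos_of_pos hY0
  set Q := (n : ℝ) ^ p * (2 + ρ) ^ ρ * (d * C ^ ((n : ℝ) + τ + a + μ * N + 1) * Real.Gamma Y) with hQ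
  have hQ0 : 0 ≤ Q := by positivity
  have hlam : 1 ≤ μ - ρ * (τ + 1) := by linarith
  have hT1 : ∀ i ≤ N, (N.choose i : ℝ) * i.factorial * T p (N - i) ≤
      Q / (i.factorial : ℝ) ^ (μ - 1) := by
    intro i hi
    have h1 := choose_mul_factorial_mul_Gamma_le hX2 (by linarith : 1 ≤ μ) le_rfl N i hi
    rw [hYX] at h1
    have hcast : ((N - i : ℕ) : ℝ) = N - i := Nat.cast_sub hi
    have h2 : C ^ (a + μ * (N - i : ℕ) + p) ≤ C ^ ((n : ℝ) + τ + a + μ * N + 1) := by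
      refine Real.rpow_le_rpow_of_exponent_le hC ?_
      have : 0 ≤ μ * i := by positivity
      rw [hcast, hp]; linarith
    have h3 : ρ * p + (ρ * a + μ * (N - i : ℕ) + q) = Y - μ * i := by
      rw [hcast, hY]; ring
    have h4 : 0 ≤ (N.choose i : ℝ) * i.factorial * Real.Gamma (Y - μ * i) := by
      refine mul_nonneg (by positivity) (Real.Gamma_nonneg_of_nonneg ?_)
      rw [← h3]; positivity
    rw [hT]
    simp only
    rw [h3]
    calc _ = (n : ℝ) ^ p * (2 + ρ) ^ ρ * (d * C ^ (a + μ * (N - i : ℕ) + p)) *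
          ((N.choose i : ℝ) * i.factorial * Real.Gamma (Y - μ * i)) := by ring
      _ ≤ (n : ℝ) ^ p * (2 + ρ) ^ ρ * (d * C ^ ((n : ℝ) + τ + a + μ * N + 1)) *
          (Real.Gamma Y / (i.factorial : ℝ) ^ (μ - 1)) := by gcongr
      _ = _ := by rw [hQ]; ring
  have hT2 : ∀ i ≤ N, (N.choose i : ℝ) * i.factorial * T (p + (τ + 1) * i) (N - i) ≤
      ((n : ℝ) ^ (τ + 1)) ^ i * (Q / (i.factorial : ℝ) ^ (μ - ρ * (τ + 1) - 1)) := by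
    intro i hi
    have h1 := choose_mul_factorial_mul_Gamma_le hX2 hlam (by linarith : μ - ρ * (τ + 1) ≤ μ) N i hi
    rw [hYX] at h1
    have hcast : ((N - i : ℕ) : ℝ) = N - i := Nat.cast_sub hi
    have h2 : C ^ (a + μ * (N - i : ℕ) + (p + (τ + 1) * i)) ≤
        C ^ ((n : ℝ) + τ + a + μ * N + 1) := by
      refine Real.rpow_le_rpow_of_exponent_le hC ?_
      -- The additional `(τ+1)i` powers of `C` fit into the `μi` powers saved because `i` action
      -- derivatives do not reach `Φ`.
      have : (τ + 1) * i ≤ μ * i := by gcongr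
      rw [hcast, hp]; linarith
    have h3 : ρ * (p + (τ + 1) * i) + (ρ * a + μ * (N - i : ℕ) + q)
        = Y - (μ - ρ * (τ + 1)) * i := by
      rw [hcast, hY]; ring
    have h4 : 0 ≤ (N.choose i : ℝ) * i.factorial * Real.Gamma (Y - (μ - ρ * (τ + 1)) * i) := by
      refine mul_nonneg (by positivity) (Real.Gamma_nonneg_of_nonneg ?_)
      rw [← h3]; positivity
    rw [hT]
    simp only
    rw [h3, Real.rpow_add (by linarith : 0 < (n : ℝ)), Real.rpow_mul (by positivity) (τ + 1),
      Real.rpow_natCast]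
    calc _ = (n : ℝ) ^ p * ((n : ℝ) ^ (τ + 1)) ^ i * (2 + ρ) ^ ρ *
          (d * C ^ (a + μ * (N - i : ℕ) + (p + (τ + 1) * i))) *
          ((N.choose i : ℝ) * i.factorial * Real.Gamma (Y - (μ - ρ * (τ + 1)) * i)) := by ring
      _ ≤ (n : ℝ) ^ p * ((n : ℝ) ^ (τ + 1)) ^ i * (2 + ρ) ^ ρ *
          (d * C ^ ((n : ℝ) + τ + a + μ * N + 1)) *
          (Real.Gamma Y / (i.factorial : ℝ) ^ (μ - ρ * (τ + 1) - 1)) := by gcongr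
      _ = _ := by rw [hQ]; ring
  set c₂ := 8 * L * M * B * (n : ℝ) ^ (τ + 1) with hc₂
  have hc₂0 : 0 ≤ c₂ := by positivity
  have hterm : ∀ i ∈ Finset.range (N + 1), (N.choose i : ℝ) *
      ((A * i.factorial * ((4 * L) ^ i * ((i : ℝ) ^ (ρ * (τ + 1))) ^ i +
      (8 * L * (M * K ^ (τ + 1)) * B) ^ i * ((i : ℝ) ^ (s - 1)) ^ i)) * b (N - i)) ≤
      (K ^ (n + 1))⁻¹ * A * Q * (gevreySeriesTerm (4 * L) (ρ * (τ + 1)) μ i +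
        gevreySeriesTerm c₂ (s - 1) (μ - ρ * (τ + 1)) i) := by
    intro i hi
    have hi' : i ≤ N := Nat.lt_succ_iff.1 (Finset.mem_range.1 hi)
    have hKi : 0 < (K ^ (τ + 1)) ^ i := by positivity
    have hb1 : b (N - i) ≤ (K ^ (n + 1))⁻¹ * T p (N - i) := by
      rw [hbdef]
      simp only
      gcongr
      exact min_le_left _ _
    have hb2 : (K ^ (τ + 1)) ^ i * b (N - i) ≤ (K ^ (n + 1))⁻¹ * T (p + (τ + 1) * i) (N - i) := by
      rw [hbdef]
      simp only
      rw [Nat.sub_sub_self hi', mul_left_comm]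
      gcongr
      rw [← le_inv_mul_iff₀ hKi]
      exact min_le_right _ _
    have e1 := hT1 i hi'
    have e2 := hT2 i hi'
    unfold gevreySeriesTerm
    calc _ = A * ((4 * L) ^ i * ((i : ℝ) ^ (ρ * (τ + 1))) ^ i) * (N.choose i * i.factorial) *
            b (N - i) + A * ((8 * L * M * B) ^ i * ((i : ℝ) ^ (s - 1)) ^ i) *
            (N.choose i * i.factorial) * ((K ^ (τ + 1)) ^ i * b (N - i)) := by
          rw [show 8 * L * (M * K ^ (τ + 1)) * B = 8 * L * M * B * K ^ (τ + 1) by ring, mul_pow _ (K ^ (τ + 1))]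
          ring
      _ ≤ A * ((4 * L) ^ i * ((i : ℝ) ^ (ρ * (τ + 1))) ^ i) * (N.choose i * i.factorial) *
            ((K ^ (n + 1))⁻¹ * T p (N - i)) + A * ((8 * L * M * B) ^ i * ((i : ℝ) ^ (s - 1)) ^ i) *
            (N.choose i * i.factorial) * ((K ^ (n + 1))⁻¹ * T (p + (τ + 1) * i) (N - i)) := by
          gcongr
      _ = A * ((4 * L) ^ i * ((i : ℝ) ^ (ρ * (τ + 1))) ^ i) * (K ^ (n + 1))⁻¹ *
            ((N.choose i * i.factorial) * T p (N - i)) +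
            A * ((8 * L * M * B) ^ i * ((i : ℝ) ^ (s - 1)) ^ i) * (K ^ (n + 1))⁻¹ *
            ((N.choose i * i.factorial) * T (p + (τ + 1) * i) (N - i)) := by ring
      _ ≤ A * ((4 * L) ^ i * ((i : ℝ) ^ (ρ * (τ + 1))) ^ i) * (K ^ (n + 1))⁻¹ *
            (Q / (i.factorial : ℝ) ^ (μ - 1)) +
            A * ((8 * L * M * B) ^ i * ((i : ℝ) ^ (s - 1)) ^ i) * (K ^ (n + 1))⁻¹ *
            (((n : ℝ) ^ (τ + 1)) ^ i * (Q / (i.factorial : ℝ) ^ (μ - ρ * (τ + 1) - 1))) := by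
          gcongr
      _ = _ := by
          rw [hc₂, mul_pow _ ((n : ℝ) ^ (τ + 1))]
          ring
  refine (Finset.sum_le_sum hterm).trans ?_
  rw [← Finset.mul_sum, Finset.sum_add_distrib]
  have s1 := (summable_gevreySeriesTerm (A := 4 * L) (σ := ρ * (τ + 1)) (lam := μ) (by positivity)
    (by linarith) (by linarith)).sum_le_tsum (Finset.range (N + 1))
    (fun i _ => gevreySeriesTerm_nonneg (by positivity) i)
  have s2 := (summable_gevreySeriesTerm (A := c₂) (σ := s - 1) (lam := μ - ρ * (τ + 1)) hc₂0
    (by linarith) (by linarith)).sum_le_tsum (Finset.range (N + 1))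
    (fun i _ => gevreySeriesTerm_nonneg hc₂0 i)
  refine (mul_le_mul_of_nonneg_left (add_le_add s1 s2) (by positivity)).trans_eq ?_
  rw [modeConstant, hQ]
  ring

end ModeEstimate

/-! ### The truncated Fourier series as a solution, and its estimate -/

section LinearSolution

open Filter Topology

variable {n : ℕ} {P : Type*} [NormedAddCommGroup P] {U : Set P}

theorem locallyBoundedBy_const {V F ι : Type*} [NormedAddCommGroup V] [NormedSpace ℝ V]
    [NormedAddCommGroup F] [NormedSpace ℝ F] {W : Set V} {w : ι → ℝ} {c : ι → F}
    (hc : ∀ k, ‖c k‖ ≤ w k) (m : ℕ) : LocallyBoundedBy W w m (fun k (_ : V) => c k) := by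
  have key : ∀ {c : ι → F}, (∀ k, ‖c k‖ ≤ w k) → LocallyBoundedBy W w 0 (fun k (_ : V) => c k) :=
    fun hc _ _ => ⟨1, .of_forall fun _ k => by simpa using hc k⟩
  induction m generalizing c with
  | zero => exact key hc
  | succ m ih =>
    refine ⟨key hc, fun v => ?_⟩
    have h1 := ih (c := fun _ => 0) fun k => by
      simpa using (norm_nonneg _).trans (hc k)
    simpa [lineDeriv] using h1

theorem locallyBoundedBy_clm_comp {V F G ι : Type*} [NormedAddCommGroup V] [NormedSpace ℝ V]
    [NormedAddCommGroup F] [NormedSpace ℝ F] [NormedAddCommGroup G] [NormedSpace ℝ G] {W : Set V}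
    (hW : IsOpen W) {w : ι → ℝ} {A : ι → F →L[ℝ] G} (hA : ∀ k, ‖A k‖ ≤ w k) (m : ℕ) {g : V → F}
    (hg : ContDiffOn ℝ ∞ g W) : LocallyBoundedBy W w m (fun k x => A k (g x)) := by
  have key : ∀ {g : V → F}, ContDiffOn ℝ ∞ g W →
      LocallyBoundedBy W w 0 (fun k x => A k (g x)) := by
    intro g hg x hx
    refine ⟨‖g x‖ + 1, ?_⟩
    have h1 : ∀ᶠ y in 𝓝 x, ‖g y‖ < ‖g x‖ + 1 :=
      (hg.differentiableAt_of_isOpen hW hx).continuousAt.norm.eventually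
        (gt_mem_nhds (by linarith))
    filter_upwards [h1] with y hy k
    refine ((A k).le_opNorm _).trans ?_
    rw [mul_comm]
    exact mul_le_mul hy.le (hA k) (norm_nonneg _) (by positivity)
  induction m generalizing g with
  | zero => exact key hg
  | succ m ih =>
    exact ⟨key hg, fun v => (ih (hg.lineDeriv_of_isOpen hW v)).congr hW fun k x hx =>
      iterLineDeriv_clm_comp (A k) hg hW [v] hx⟩

/-- The functional `w ↦ |k|^τ ⟨w, k⟩`. -/
def scaledFrequency (τ : ℝ) (k : Fin n → ℤ) : EuclideanSpace ℝ (Fin n) →L[ℝ] ℝ :=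
  frequencyLength k ^ τ • ∑ i, (k i : ℝ) • EuclideanSpace.proj i

theorem scaledFrequency_apply (τ : ℝ) (k : Fin n → ℤ) (w : EuclideanSpace ℝ (Fin n)) :
    scaledFrequency τ k w = frequencyLength k ^ τ * ∑ i, w i * k i := by
  simp [scaledFrequency, mul_comm]

theorem norm_scaledFrequency_le (τ : ℝ) (k : Fin n → ℤ) :
    ‖scaledFrequency τ k‖ ≤ frequencyLength k ^ τ * frequencyLength k := by
  have hK := frequencyLength_nonneg k
  refine ContinuousLinearMap.opNorm_le_bound _ (by positivity) fun w => ?_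
  rw [scaledFrequency_apply, norm_mul, Real.norm_of_nonneg (by positivity), mul_assoc]
  gcongr
  refine (norm_sum_le _ _).trans ?_
  rw [frequencyLength, Finset.sum_mul]
  refine Finset.sum_le_sum fun i _ => ?_
  rw [norm_mul, mul_comm, Real.norm_eq_abs]
  gcongr
  exact PiLp.norm_apply_le w i

/-- The summands of the solution: the component of frequency `k` of `F`, divided by a smooth
truncation `h` of the small divisor. -/
def resonantMode (τ : ℝ) (h : ℝ → ℝ) (Wq : EuclideanSpace ℝ (Fin n) × P → EuclideanSpace ℝ (Fin n))
    (F : EuclideanSpace ℝ (Fin n) × P → ℂ) (k : Fin n → ℤ) (x : EuclideanSpace ℝ (Fin n) × P) : ℂ :=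
  h (scaledFrequency τ k (Wq x)) • (frequencyLength k ^ τ • fourierMode k F x)

variable {τ : ℝ} {h : ℝ → ℝ}
  {Wq : EuclideanSpace ℝ (Fin n) × P → EuclideanSpace ℝ (Fin n)}
  {F : EuclideanSpace ℝ (Fin n) × P → ℂ}

theorem frequencyLength_rpow_le (τ : ℝ) (k : Fin n → ℤ) :
    frequencyLength k ^ τ ≤ (1 + frequencyLength k) ^ (⌈τ⌉₊ + 1) := by
  have hK := frequencyLength_nonneg k
  rcases eq_or_ne k 0 with rfl | hk
  · have h0 : frequencyLength (0 : Fin n → ℤ) = 0 := by simp [frequencyLength]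
    rw [h0]
    exact (Real.zero_rpow_le_one τ).trans (by simp)
  · have h1 := one_le_frequencyLength hk
    calc frequencyLength k ^ τ ≤ frequencyLength k ^ ((⌈τ⌉₊ + 1 : ℕ) : ℝ) := by
          refine Real.rpow_le_rpow_of_exponent_le h1 ((Nat.le_ceil τ).trans ?_)
          push_cast
          linarith
      _ ≤ _ := by
          rw [Real.rpow_natCast]
          gcongr
          linarith

theorem resonantMode_zero_eqOn (hF0 : EqOn (fourierMode 0 F) 0
      ((univ : Set (EuclideanSpace ℝ (Fin n))) ×ˢ U)) :
    EqOn (resonantMode τ h Wq F 0) (fun _ => 0)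
      ((univ : Set (EuclideanSpace ℝ (Fin n))) ×ˢ U) := by
  intro x hx
  simp [resonantMode, hF0 hx]

variable [NormedSpace ℝ P]

/-- The truncated divisor depends on action and time only, so angle derivatives pass through it. The
composition estimate therefore needs action directions alone. -/
theorem iterLineDeriv_angle_smul (hU : IsOpen U) {g : EuclideanSpace ℝ (Fin n) × P → ℝ}
    {Φ : EuclideanSpace ℝ (Fin n) × P → ℂ} (hg : ∀ x z, g (x + (z, 0)) = g x)
    (hgs : ContDiffOn ℝ ∞ g ((univ : Set (EuclideanSpace ℝ (Fin n))) ×ˢ U))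
    (hΦ : ContDiffOn ℝ ∞ Φ ((univ : Set (EuclideanSpace ℝ (Fin n))) ×ˢ U))
    (l : List (EuclideanSpace ℝ (Fin n))) :
    EqOn (iterLineDeriv (l.map fun z => (z, (0 : P))) (fun x => g x • Φ x))
      (fun x => g x • iterLineDeriv (l.map fun z => (z, (0 : P))) Φ x)
      ((univ : Set (EuclideanSpace ℝ (Fin n))) ×ˢ U) := by
  have hW : IsOpen ((univ : Set (EuclideanSpace ℝ (Fin n))) ×ˢ U) := isOpen_univ.prod hU
  induction l with
  | nil => exact fun _ _ => rfl
  | cons v l ih =>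
    intro x hx
    simp only [List.map_cons, iterLineDeriv_cons]
    rw [lineDeriv_eqOn hW ih _ hx,
      lineDeriv_smul_of_isOpen hgs (hΦ.iterLineDeriv_of_isOpen hW _) hW _ hx]
    have h0 : lineDeriv ℝ g x (v, 0) = 0 := by
      simp only [lineDeriv, Prod.smul_mk, smul_zero, hg, deriv_const]
    rw [h0, zero_smul, zero_add]

variable [FiniteDimensional ℝ P]

theorem summableFamily_resonantMode (hU : IsOpen U) (hh : ContDiff ℝ ∞ h)
    (hhb : ∀ j, ∃ C : ℝ, ∀ y, |iteratedDeriv j h y| ≤ C) (hF : AnglePeriodicOn U F)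
    (hFs : ContDiffOn ℝ ∞ F ((univ : Set (EuclideanSpace ℝ (Fin n))) ×ˢ U))
    (hWs : ContDiffOn ℝ ∞ Wq ((univ : Set (EuclideanSpace ℝ (Fin n))) ×ˢ U)) :
    SummableFamily ((univ : Set (EuclideanSpace ℝ (Fin n))) ×ˢ U)
      (fun k => ((1 + frequencyLength k) ^ (n + 1))⁻¹) (resonantMode τ h Wq F) := by
  have hW : IsOpen ((univ : Set (EuclideanSpace ℝ (Fin n))) ×ˢ U) := isOpen_univ.prod hU
  set Q := ⌈τ⌉₊ + 1 with hQ
  have hφs : ∀ k, ContDiffOn ℝ ∞ (fun x => scaledFrequency τ k (Wq x))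
      ((univ : Set (EuclideanSpace ℝ (Fin n))) ×ˢ U) := fun k =>
    (scaledFrequency τ k).contDiff.comp_contDiffOn hWs
  have hFk := fun k => contDiffOn_fourierMode hU k hFs
  refine ⟨fun k => (hh.comp_contDiffOn (hφs k)).smul ((hFk k).const_smul _), fun m => ?_⟩
  have h1 := fun m => locallyBoundedBy_clm_comp hW (w := fun k => (1 + frequencyLength k) ^ (Q + 1))
    (A := scaledFrequency (n := n) τ) (fun k => by
      refine (norm_scaledFrequency_le τ k).trans ?_
      have hK := frequencyLength_nonneg k
      rw [pow_succ]
      gcongr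
      · exact frequencyLength_rpow_le τ k
      · linarith) m hWs
  have h2 := LocallyBoundedBy.comp h1 hW (fun k => one_le_pow₀ (by
      have := frequencyLength_nonneg k
      linarith)) hφs (h := fun j => iteratedDeriv j h)
    (fun j => by
      rw [iteratedDeriv_eq_iterate]
      exact hh.iterate_deriv j)
    (fun j y => by rw [iteratedDeriv_succ]) hhb m 0
  have h3 := LocallyBoundedBy.smul (locallyBoundedBy_const
      (c := fun k : Fin n → ℤ => frequencyLength k ^ τ)
      (w := fun k : Fin n → ℤ => (1 + frequencyLength k) ^ Q) (fun k => by
        rw [Real.norm_of_nonneg (Real.rpow_nonneg (frequencyLength_nonneg k) _)]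
        exact frequencyLength_rpow_le τ k) m)
    -- The order of decay is chosen to cover the growth `(Q+1)m` from differentiating `h ∘ φ` and
    -- `Q` from the prefactor `|k|^τ`, leaving the summable weight of order `n+1`.
    (locallyBoundedBy_fourierMode hU ((Q + 1) * m + Q + (n + 1)) m hF hFs) hW
    (fun k => contDiffOn_const) hFk
  have h4 := h2.smul h3 hW (fun k => by
    simpa [Function.comp_def] using hh.comp_contDiffOn (hφs k)) (fun k => (hFk k).const_smul _)
  simp only [iteratedDeriv_zero] at h4
  refine h4.mono_weight (fun k => ?_) (c := 1) (fun k => ?_)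
  · have := frequencyLength_nonneg k
    positivity
  · have h5 : 0 < 1 + frequencyLength k := by
      have := frequencyLength_nonneg k
      linarith
    rw [← pow_mul, one_mul, pow_add _ ((Q + 1) * m + Q), pow_add _ ((Q + 1) * m) Q, mul_inv,
      ← mul_assoc, ← mul_assoc, mul_inv_cancel₀ (by positivity), one_mul]

/-- The truncated series solves the homological equation at every nonresonant point. -/
theorem sum_lineDeriv_tsum_resonantMode (hU : IsOpen U) (hh : ContDiff ℝ ∞ h)
    (hhb : ∀ j, ∃ C : ℝ, ∀ y, |iteratedDeriv j h y| ≤ C) (hF : AnglePeriodicOn U F)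
    (hFs : ContDiffOn ℝ ∞ F ((univ : Set (EuclideanSpace ℝ (Fin n))) ×ˢ U))
    (hWs : ContDiffOn ℝ ∞ Wq ((univ : Set (EuclideanSpace ℝ (Fin n))) ×ˢ U))
    (hWq : ∀ x z, Wq (x + (z, 0)) = Wq x)
    (hF0 : EqOn (fourierMode 0 F) 0 ((univ : Set (EuclideanSpace ℝ (Fin n))) ×ˢ U))
    {κ : ℝ} (hκ : 0 < κ) (hinv : ∀ y, κ ≤ |y| → h y = y⁻¹)
    {x : EuclideanSpace ℝ (Fin n) × P} (hx : x ∈ (univ : Set (EuclideanSpace ℝ (Fin n))) ×ˢ U)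
    (hres : ∀ k : Fin n → ℤ, k ≠ 0 → κ / frequencyLength k ^ τ ≤ |∑ i, Wq x i * (k i : ℝ)|) :
    ∑ i, (Wq x i : ℂ) * lineDeriv ℝ (fun y => ∑' k, resonantMode τ h Wq F k y) x
      (EuclideanSpace.single i 1, 0) = Complex.I * F x := by
  have hW : IsOpen ((univ : Set (EuclideanSpace ℝ (Fin n))) ×ˢ U) := isOpen_univ.prod hU
  have hfam := summableFamily_resonantMode (τ := τ) hU hh hhb hF hFs hWs
  have hw := summable_inv_frequencyLength_pow n
  have hw0 : ∀ k : Fin n → ℤ, 0 ≤ ((1 + frequencyLength k) ^ (n + 1))⁻¹ := fun k => by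
    have := frequencyLength_nonneg k
    positivity
  have hder : ∀ k i, lineDeriv ℝ (resonantMode τ h Wq F k) x (EuclideanSpace.single i 1, 0)
      = h (scaledFrequency τ k (Wq x)) • (frequencyLength k ^ τ •
        (Complex.I * k i * fourierMode k F x)) := by
    intro k i
    have hs := contDiffOn_fourierMode hU k hFs
    have h1 := iterLineDeriv_angle_smul hU (g := fun x => h (scaledFrequency τ k (Wq x)))
      (Φ := fun x => frequencyLength k ^ τ • fourierMode k F x) (fun x z => by rw [hWq])
      (hh.comp_contDiffOn ((scaledFrequency τ k).contDiff.comp_contDiffOn hWs))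
      (hs.const_smul _) [EuclideanSpace.single i 1] hx
    simp only [List.map_cons, List.map_nil, iterLineDeriv_cons, iterLineDeriv_nil] at h1
    refine h1.trans ?_
    congr 1
    have h2 := iterLineDeriv_clm_comp (frequencyLength k ^ τ • ContinuousLinearMap.id ℝ ℂ) hs hW
      [(EuclideanSpace.single i 1, 0)] hx
    simp only [iterLineDeriv_cons, iterLineDeriv_nil, smul_apply, ContinuousLinearMap.id_apply]
      at h2
    rw [h2, hF.lineDeriv_fourierMode k hx i]
  have hterm : ∀ k, ∑ i, (Wq x i : ℂ) * lineDeriv ℝ (resonantMode τ h Wq F k) x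
      (EuclideanSpace.single i 1, 0) = Complex.I * fourierMode k F x := by
    intro k
    simp only [hder]
    -- For `k = 0` both sides vanish with the zero mode; for `k ≠ 0` the sum over `i` rebuilds
    -- `|k|^τ⟨ω,k⟩`, which cancels against `h`.
    rcases eq_or_ne k 0 with rfl | hk
    · have := hF0 hx
      simp only [Pi.zero_apply] at this
      simp [this]
    · have hK : 0 < frequencyLength k ^ τ :=
        Real.rpow_pos_of_pos (by linarith [one_le_frequencyLength hk]) _
      have h1 : κ ≤ |scaledFrequency τ k (Wq x)| := by
        have := hres k hk
        rw [div_le_iff₀ hK] at this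
        rw [scaledFrequency_apply, abs_mul, abs_of_pos hK]
        linarith
      rw [hinv _ h1]
      have h2 : scaledFrequency τ k (Wq x) ≠ 0 := by
        intro h0
        rw [h0, abs_zero] at h1
        linarith
      have h3 : ((scaledFrequency τ k (Wq x) : ℝ) : ℂ) ≠ 0 := by exact_mod_cast h2
      have h4 : ∀ i, (Wq x i : ℂ) * ((scaledFrequency τ k (Wq x))⁻¹ • (frequencyLength k ^ τ •
          (Complex.I * k i * fourierMode k F x))) = ((scaledFrequency τ k (Wq x) : ℝ) : ℂ)⁻¹ *
          (((frequencyLength k ^ τ : ℝ) : ℂ) * (Wq x i * k i)) *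
          (Complex.I * fourierMode k F x) := by
        intro i
        simp only [Complex.real_smul, Complex.ofReal_inv]
        ring
      simp only [h4]
      rw [← Finset.sum_mul, ← Finset.mul_sum, ← Finset.mul_sum]
      have h5 : ((frequencyLength k ^ τ : ℝ) : ℂ) * ∑ i, ((Wq x i : ℂ) * (k i : ℂ))
          = ((scaledFrequency τ k (Wq x) : ℝ) : ℂ) := by
        rw [scaledFrequency_apply]
        push_cast
        rfl
      rw [h5, inv_mul_cancel₀ h3, one_mul]
  have hsum : ∀ i, HasSum (fun k => (Wq x i : ℂ) * lineDeriv ℝ (resonantMode τ h Wq F k) x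
      (EuclideanSpace.single i 1, 0)) ((Wq x i : ℂ) * lineDeriv ℝ
      (fun y => ∑' k, resonantMode τ h Wq F k y) x (EuclideanSpace.single i 1, 0)) := by
    intro i
    rw [hfam.lineDeriv_tsum hW hw hw0 _ hx]
    exact ((hfam.lineDeriv hW _).summable hw hx).hasSum.mul_left _
  have h1 := hasSum_sum (s := Finset.univ) fun i _ => hsum i
  simp only [hterm] at h1
  exact h1.unique ((hF.hasSum_fourierMode hU hFs hx).mul_left _)

theorem modeConstant_nonneg {n : ℕ} {ρ τ μ L A B s M : ℝ} (hρ : 0 ≤ ρ) (hA : 0 ≤ A) (hB : 0 ≤ B)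
    (hL : 0 ≤ L) (hM : 0 ≤ M) : 0 ≤ modeConstant n ρ τ μ L A B s M := by
  have h1 : 0 ≤ ∑' b, gevreySeriesTerm (4 * L) (ρ * (τ + 1)) μ b :=
    tsum_nonneg fun b => gevreySeriesTerm_nonneg (by positivity) b
  have h2 : 0 ≤ ∑' b, gevreySeriesTerm (8 * L * M * B * (n : ℝ) ^ (τ + 1)) (s - 1)
      (μ - ρ * (τ + 1)) b :=
    tsum_nonneg fun b => gevreySeriesTerm_nonneg (by positivity) b
  unfold modeConstant
  positivity

theorem iterLineDeriv_zero {V F : Type*} [NormedAddCommGroup V] [NormedSpace ℝ V]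
    [NormedAddCommGroup F] [NormedSpace ℝ F] (l : List V) :
    iterLineDeriv l (fun _ => (0 : F)) = fun _ => 0 := by
  induction l with
  | nil => rfl
  | cons v l ih =>
    rw [iterLineDeriv_cons, ih]
    funext x
    simp [lineDeriv]

/-- The estimate of all the mixed derivatives of one summand. -/
theorem norm_iterLineDeriv_resonantMode_le (hU : IsOpen U) (hh : ContDiff ℝ ∞ h)
    (hF : AnglePeriodicOn U F)
    (hFs : ContDiffOn ℝ ∞ F ((univ : Set (EuclideanSpace ℝ (Fin n))) ×ˢ U))
    (hWs : ContDiffOn ℝ ∞ Wq ((univ : Set (EuclideanSpace ℝ (Fin n))) ×ˢ U))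
    (hWq : ∀ x z, Wq (x + (z, 0)) = Wq x)
    {ρ μ s A B L M d C q : ℝ} (hρ : 1 ≤ ρ) (hτ : (n : ℝ) - 1 < τ) (hs : 1 < s)
    (hμ : ρ * (τ + 1) + s < μ) (hA : 0 ≤ A) (hB : 0 ≤ B) (hL : 0 ≤ L) (hM : 0 ≤ M) (hd : 0 ≤ d)
    (hC : 1 ≤ C) (hq : 0 < q) (hhB : ∀ y, GevreyBoundAt s A B h y) (act : Fin n → P)
    {x : EuclideanSpace ℝ (Fin n) × P} (hx : x ∈ (univ : Set (EuclideanSpace ℝ (Fin n))) ×ˢ U)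
    (hFb : ∀ (z : EuclideanSpace ℝ (Fin n)) (la lb : List (Fin n)),
      ‖iterLineDeriv (((la.map fun i => EuclideanSpace.single i (1 : ℝ)).map fun z => (z, (0 : P))) ++
        lb.map fun i => (0, act i)) F (x + (z, 0))‖ ≤
        d * C ^ ((la.length : ℝ) + μ * lb.length) *
          Real.Gamma (ρ * la.length + μ * lb.length + q))
    (hWb : ∀ lb : List (Fin n), ‖iterLineDeriv (lb.map fun i => (0, act i)) Wq x‖ ≤
      M * L ^ lb.length * (lb.length.factorial : ℝ) ^ (ρ * (τ + 1) + 1))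
    (la lb : List (Fin n)) {k : Fin n → ℤ} (hk : k ≠ 0) :
    ‖iterLineDeriv (((la.map fun i => EuclideanSpace.single i (1 : ℝ)).map fun z => (z, (0 : P))) ++
        lb.map fun i => (0, act i)) (resonantMode τ h Wq F k) x‖ ≤
      (frequencyLength k ^ (n + 1))⁻¹ * (modeConstant n ρ τ μ L A B s M * d *
        C ^ ((n : ℝ) + τ + la.length + μ * lb.length + 1) *
        Real.Gamma (ρ * la.length + μ * lb.length + ρ * ((n : ℝ) + τ + 1) + q)) := by
  have hW : IsOpen ((univ : Set (EuclideanSpace ℝ (Fin n))) ×ˢ U) := isOpen_univ.prod hU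
  -- A nonzero frequency excludes `n = 0`; then `τ > n - 1` yields the `τ > 0` needed by the mode
  -- estimate.
  have hn : 1 ≤ n := by
    rcases Nat.eq_zero_or_pos n with rfl | hn
    · exact absurd (Subsingleton.elim k 0) hk
    · exact hn
  have hn1 : (1 : ℝ) ≤ n := by exact_mod_cast hn
  have hK1 := one_le_frequencyLength hk
  have hK0 : 0 < frequencyLength k := by linarith
  set las := (la.map fun i => EuclideanSpace.single i (1 : ℝ)).map fun z => (z, (0 : P)) with hlas
  have hφs : ContDiffOn ℝ ∞ (fun x => scaledFrequency τ k (Wq x))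
      ((univ : Set (EuclideanSpace ℝ (Fin n))) ×ˢ U) :=
    (scaledFrequency τ k).contDiff.comp_contDiffOn hWs
  have hfs := contDiffOn_fourierMode hU k hFs
  have hΦs : ContDiffOn ℝ ∞ (fun x => frequencyLength k ^ τ • fourierMode k F x)
      ((univ : Set (EuclideanSpace ℝ (Fin n))) ×ˢ U) := hfs.const_smul _
  have hgs : ContDiffOn ℝ ∞ (fun x => h (scaledFrequency τ k (Wq x)))
      ((univ : Set (EuclideanSpace ℝ (Fin n))) ×ˢ U) := hh.comp_contDiffOn hφs
  have hR : ContDiffOn ℝ ∞ (resonantMode τ h Wq F k)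
      ((univ : Set (EuclideanSpace ℝ (Fin n))) ×ˢ U) := hgs.smul hΦs
  -- Angle derivatives are moved innermost and onto the Fourier mode; only then is the Leibniz
  -- estimate applied to the action derivatives.
  rw [iterLineDeriv_perm hR hW List.perm_append_comm hx, iterLineDeriv_append,
    iterLineDeriv_eqOn hW (g := _root_.iterLineDeriv las (resonantMode τ h Wq F k))
      (iterLineDeriv_angle_smul hU (fun x z => by rw [hWq]) hgs hΦs _) _ hx]
  have hlist : ∀ l : List (EuclideanSpace ℝ (Fin n) × P),
      (∀ v ∈ l, v ∈ range fun i => ((0 : EuclideanSpace ℝ (Fin n)), act i)) →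
      ∃ lb : List (Fin n), lb.map (fun i => ((0 : EuclideanSpace ℝ (Fin n)), act i)) = l := by
    intro l hl
    have h1 : l ∈ range (List.map fun i => ((0 : EuclideanSpace ℝ (Fin n)), act i)) := by
      rw [Set.range_list_map]
      exact hl
    exact h1
  have hmain := norm_iterLineDeriv_mode_le (K := frequencyLength k) (a := la.length) hW hx
    (range fun i => ((0 : EuclideanSpace ℝ (Fin n)), act i)) hh hφs
    (hΦs.iterLineDeriv_of_isOpen hW las) hn hρ (by linarith) hs hμ hA hB hL hM hK1 hd hC hq
    (Nat.cast_nonneg _) (hhB _) ?_ ?_ (lb.map fun i => (0, act i)) ?_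
  · simpa only [List.length_map] using hmain
  · intro l hl
    obtain ⟨lb', rfl⟩ := hlist l hl
    have h1 := iterLineDeriv_clm_comp (scaledFrequency τ k) hWs hW
      (lb'.map fun i => (0, act i)) hx
    rw [h1, ← Real.norm_eq_abs]
    refine ((scaledFrequency τ k).le_opNorm _).trans ?_
    have h2 := mul_le_mul (norm_scaledFrequency_le τ k) (hWb lb') (norm_nonneg _) (by positivity)
    refine h2.trans_eq ?_
    rw [Real.rpow_add_one hK0.ne', List.length_map]
    ring
  · intro l hl m
    obtain ⟨lb', rfl⟩ := hlist l hl
    rw [← iterLineDeriv_append]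
    have h1 := iterLineDeriv_clm_comp (frequencyLength k ^ τ • ContinuousLinearMap.id ℝ ℂ) hfs hW
      (lb'.map (fun i => (0, act i)) ++ las) hx
    simp only [smul_apply, ContinuousLinearMap.id_apply] at h1
    rw [h1, iterLineDeriv_fourierMode hU k hFs _ hx, norm_smul,
      Real.norm_of_nonneg (by positivity)]
    have h2 := (hF.iterLineDeriv hU (lb'.map (fun i => (0, act i)) ++ las)
      ).frequencyLength_pow_mul_norm_fourierMode_le hU (hFs.iterLineDeriv_of_isOpen hW _) hk m hx
      (C := d * C ^ ((la.length : ℝ) + μ * lb'.length + m) *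
        Real.Gamma (ρ * m + (ρ * la.length + μ * lb'.length + q))) (fun i y => by
        rw [← iterLineDeriv_append]
        have hperm : (List.replicate m ((EuclideanSpace.single i (1 : ℝ)), (0 : P)) ++
            (lb'.map (fun i => (0, act i)) ++ las)).Perm
            ((((List.replicate m i ++ la).map fun i => EuclideanSpace.single i (1 : ℝ)).map
              fun z => (z, (0 : P))) ++ lb'.map fun i => (0, act i)) := by
          simp only [List.map_append, List.map_replicate, List.append_assoc]
          exact List.Perm.append_left _ List.perm_append_comm
        rw [iterLineDeriv_perm hFs hW hperm (add_prod_zero_mem hx _)]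
        refine (hFb (torusRep y) (List.replicate m i ++ la) lb').trans_eq ?_
        simp only [List.length_append, List.length_replicate, Nat.cast_add]
        ring_nf)
    rw [List.length_map]
    calc _ = frequencyLength k ^ τ * (frequencyLength k ^ m * ‖fourierMode k
          (iterLineDeriv (lb'.map (fun i => (0, act i)) ++ las) F) x‖) := by ring
      _ ≤ frequencyLength k ^ τ * _ := mul_le_mul_of_nonneg_left h2 (by positivity)
      _ = _ := by ring
  · intro v hv
    obtain ⟨i, _, rfl⟩ := List.mem_map.1 hv
    exact ⟨i, rfl⟩

/-- The estimate of all the mixed derivatives of the truncated series. -/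
theorem norm_iterLineDeriv_tsum_resonantMode_le (hU : IsOpen U) (hh : ContDiff ℝ ∞ h)
    (hF : AnglePeriodicOn U F)
    (hFs : ContDiffOn ℝ ∞ F ((univ : Set (EuclideanSpace ℝ (Fin n))) ×ˢ U))
    (hWs : ContDiffOn ℝ ∞ Wq ((univ : Set (EuclideanSpace ℝ (Fin n))) ×ˢ U))
    (hWq : ∀ x z, Wq (x + (z, 0)) = Wq x)
    (hF0 : EqOn (fourierMode 0 F) 0 ((univ : Set (EuclideanSpace ℝ (Fin n))) ×ˢ U))
    {ρ μ s A B L M d C q : ℝ} (hρ : 1 ≤ ρ) (hτ : (n : ℝ) - 1 < τ) (hs : 1 < s)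
    (hμ : ρ * (τ + 1) + s < μ) (hA : 0 ≤ A) (hB : 0 ≤ B) (hL : 0 ≤ L) (hM : 0 ≤ M) (hd : 0 ≤ d)
    (hC : 1 ≤ C) (hq : 0 < q) (hhB : ∀ y, GevreyBoundAt s A B h y) (act : Fin n → P)
    {x : EuclideanSpace ℝ (Fin n) × P} (hx : x ∈ (univ : Set (EuclideanSpace ℝ (Fin n))) ×ˢ U)
    (hFb : ∀ (z : EuclideanSpace ℝ (Fin n)) (la lb : List (Fin n)),
      ‖iterLineDeriv (((la.map fun i => EuclideanSpace.single i (1 : ℝ)).map fun z => (z, (0 : P))) ++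
        lb.map fun i => (0, act i)) F (x + (z, 0))‖ ≤
        d * C ^ ((la.length : ℝ) + μ * lb.length) *
          Real.Gamma (ρ * la.length + μ * lb.length + q))
    (hWb : ∀ lb : List (Fin n), ‖iterLineDeriv (lb.map fun i => (0, act i)) Wq x‖ ≤
      M * L ^ lb.length * (lb.length.factorial : ℝ) ^ (ρ * (τ + 1) + 1))
    (la lb : List (Fin n)) :
    ‖iterLineDeriv (((la.map fun i => EuclideanSpace.single i (1 : ℝ)).map fun z => (z, (0 : P))) ++
        lb.map fun i => (0, act i)) (fun y => ∑' k, resonantMode τ h Wq F k y) x‖ ≤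
      2 ^ (n + 1) * (∑' k : Fin n → ℤ, ((1 + frequencyLength k) ^ (n + 1))⁻¹) *
      (modeConstant n ρ τ μ L A B s M * d *
        C ^ ((n : ℝ) + τ + la.length + μ * lb.length + 1) *
        Real.Gamma (ρ * la.length + μ * lb.length + ρ * ((n : ℝ) + τ + 1) + q)) := by
  have hW : IsOpen ((univ : Set (EuclideanSpace ℝ (Fin n))) ×ˢ U) := isOpen_univ.prod hU
  have hhb : ∀ j, ∃ C : ℝ, ∀ y, |iteratedDeriv j h y| ≤ C := fun j => ⟨_, fun y => hhB y j⟩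
  have hfam := summableFamily_resonantMode (τ := τ) hU hh hhb hF hFs hWs
  have hw := summable_inv_frequencyLength_pow n
  have hw0 : ∀ k : Fin n → ℤ, 0 ≤ ((1 + frequencyLength k) ^ (n + 1))⁻¹ := fun k => by
    have := frequencyLength_nonneg k
    positivity
  set las := (la.map fun i => EuclideanSpace.single i (1 : ℝ)).map fun z => (z, (0 : P)) with hlas
  set lbs : List (EuclideanSpace ℝ (Fin n) × P) := lb.map fun i => (0, act i) with hlbs
  set Bd := modeConstant n ρ τ μ L A B s M * d *
        C ^ ((n : ℝ) + τ + la.length + μ * lb.length + 1) *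
        Real.Gamma (ρ * la.length + μ * lb.length + ρ * ((n : ℝ) + τ + 1) + q) with hBd
  have hBd0 : 0 ≤ Bd := by
    have hn0 : (0 : ℝ) ≤ n := Nat.cast_nonneg n
    have h1 : 0 ≤ ρ * ((n : ℝ) + τ + 1) := mul_nonneg (by linarith) (by linarith)
    have h2 : 0 ≤ ρ * (τ + 1) := mul_nonneg (by linarith) (by linarith)
    have h3 : 0 ≤ μ := by linarith
    have h4 := modeConstant_nonneg (n := n) (ρ := ρ) (τ := τ) (μ := μ) (s := s)
      (by linarith) hA hB hL hM
    have h5 : 0 ≤ Real.Gamma (ρ * la.length + μ * lb.length + ρ * ((n : ℝ) + τ + 1) + q) :=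
      Real.Gamma_nonneg_of_nonneg (by positivity)
    rw [hBd]
    positivity
  have hmode : ∀ k : Fin n → ℤ, ‖iterLineDeriv (las ++ lbs) (resonantMode τ h Wq F k) x‖ ≤
      2 ^ (n + 1) * ((1 + frequencyLength k) ^ (n + 1))⁻¹ * Bd := by
    intro k
    rcases eq_or_ne k 0 with rfl | hk
    · rw [iterLineDeriv_eqOn hW (resonantMode_zero_eqOn hF0) _ hx]
      rw [iterLineDeriv_zero, norm_zero]
      have h1 := hw0 0
      positivity
    · refine (norm_iterLineDeriv_resonantMode_le hU hh hF hFs hWs hWq hρ hτ hs hμ hA hB hL hM hd hC hq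
        hhB act hx hFb hWb la lb hk).trans (mul_le_mul_of_nonneg_right ?_ hBd0)
      -- Since `K ≥ 1` one has `1 + K ≤ 2K`; this is the origin of the factor `2^(n+1)`.
      have hK1 := one_le_frequencyLength hk
      have hK0 : 0 < frequencyLength k := by linarith
      rw [← div_eq_mul_inv, ← div_pow, ← inv_pow]
      refine pow_le_pow_left₀ (by positivity) ?_ _
      rw [inv_eq_one_div, div_le_div_iff₀ hK0 (by linarith)]
      linarith
  rw [hfam.iterLineDeriv_tsum hW hw hw0 _ hx]
  have hs' := (hw.mul_left (2 ^ (n + 1))).mul_right Bd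
  refine (tsum_of_norm_bounded hs'.hasSum hmode).trans_eq ?_
  rw [tsum_mul_right, tsum_mul_left]

end LinearSolution

/-! ### Multi-indices, and Gamma bounds turned into Gevrey bounds -/

section MultiIndex

variable {n : ℕ}

/-- The list in which each `i` occurs `α i` times, in increasing order. -/
def multiIndexList (α : Fin n → ℕ) : List (Fin n) :=
  (List.finRange n).flatMap fun i => List.replicate (α i) i

theorem length_multiIndexList (α : Fin n → ℕ) : (multiIndexList α).length = ∑ i, α i := by
  simp [multiIndexList, List.length_flatMap, Fin.sum_univ_def]

theorem multiIndexList_count_perm (l : List (Fin n)) :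
    l.Perm (multiIndexList fun i => l.count i) := by
  refine List.perm_iff_count.2 fun i => ?_
  rw [multiIndexList, List.count_flatMap, ← Fin.sum_univ_def]
  simp [List.count_replicate]

theorem sum_count (l : List (Fin n)) : ∑ i, l.count i = l.length := by
  rw [← length_multiIndexList, (multiIndexList_count_perm l).length_eq.symm]

theorem multiDeriv_eq_iterLineDeriv {F : Type*} [NormedAddCommGroup F] [NormedSpace ℝ F]
    (α : Fin n → ℕ) (g : EuclideanSpace ℝ (Fin n) → F) :
    multiDeriv α g = iterLineDeriv
      ((multiIndexList α).map fun i => EuclideanSpace.single i (1 : ℝ)) g := by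
  have h1 : ∀ (i : Fin n) (m : ℕ) (g : EuclideanSpace ℝ (Fin n) → F), (partialDeriv i)^[m] g =
      iterLineDeriv ((List.replicate m i).map fun i => EuclideanSpace.single i (1 : ℝ)) g := by
    intro i m g
    induction m with
    | zero => rfl
    | succ m ih =>
      rw [Function.iterate_succ_apply', ih, List.replicate_succ, List.map_cons, iterLineDeriv_cons]
      rfl
  rw [multiDeriv, multiIndexList]
  induction List.finRange n with
  | nil => rfl
  | cons i l ih =>
    rw [List.foldr_cons, ih, h1, List.flatMap_cons, List.map_append, iterLineDeriv_append]

theorem multinomial_le_two_pow (s : Finset (Fin n)) (α : Fin n → ℕ) :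
    Nat.multinomial s α ≤ 2 ^ (s.card * ∑ i ∈ s, α i) := by
  induction s using Finset.induction_on with
  | empty => simp
  | insert i s hi ih =>
    rw [Nat.multinomial_insert hi, Finset.card_insert_of_notMem hi, Finset.sum_insert hi]
    calc _ ≤ 2 ^ (α i + ∑ i ∈ s, α i) * 2 ^ (s.card * ∑ i ∈ s, α i) :=
          Nat.mul_le_mul (Nat.choose_le_two_pow _ _) ih
      _ = 2 ^ (α i + ∑ i ∈ s, α i + s.card * ∑ i ∈ s, α i) := (pow_add _ _ _).symm
      _ ≤ _ := Nat.pow_le_pow_right (by norm_num) (by nlinarith)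

theorem factorial_sum_le_two_pow_mul_multiFactorial (α : Fin n → ℕ) :
    ((∑ i, α i).factorial : ℝ) ≤ (2 ^ n) ^ (∑ i, α i) * multiFactorial α := by
  have h1 := multinomial_le_two_pow Finset.univ α
  rw [Finset.card_univ, Fintype.card_fin] at h1
  rw [← Nat.multinomial_spec, mul_comm, ← pow_mul, multiFactorial]
  exact_mod_cast Nat.mul_le_mul_right _ h1

theorem multiFactorial_le_factorial_sum (α : Fin n → ℕ) :
    multiFactorial α ≤ ((∑ i, α i).factorial : ℝ) := by
  unfold multiFactorial
  exact_mod_cast Nat.le_of_dvd (Nat.factorial_pos _) (Nat.prod_factorial_dvd_factorial_sum _ _)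

theorem multiFactorial_pos (α : Fin n → ℕ) : 0 < multiFactorial α := by
  unfold multiFactorial
  exact_mod_cast Finset.prod_pos fun i _ => Nat.factorial_pos _

/-- `Gamma_add_le` is iterated, `a` times with step `ρ` and then `N` times with step `μ`. In each
step the base is at most `Q+ρ+μ` times the next integer factor, and these factors build up `a!` and
`(a+1)⋯(a+N)`. -/
theorem Gamma_add_mul_le {Q ρ μ : ℝ} (hQ : 0 < Q) (hρ : 0 ≤ ρ) (hμ : 0 ≤ μ) (a N : ℕ) :
    Real.Gamma (Q + ρ * a + μ * N) ≤ Real.Gamma Q * ((Q + ρ + μ) ^ (ρ * a + μ * N) *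
      (a.factorial : ℝ) ^ ρ * ((a + 1).ascFactorial N : ℝ) ^ μ) := by
  have hR : 0 < Q + ρ + μ := by positivity
  have hG := Real.Gamma_pos_of_pos hQ
  induction N with
  | zero =>
    simp only [Nat.cast_zero, mul_zero, add_zero, Nat.ascFactorial_zero, Nat.cast_one,
      Real.one_rpow, mul_one]
    induction a with
    | zero => simp
    | succ a ih =>
      have h1 : Q + ρ * (a + 1 : ℕ) = Q + ρ * a + ρ := by
        push_cast
        ring
      have h2 : Q + ρ * a + ρ ≤ (Q + ρ + μ) * (a + 1 : ℕ) := by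
        push_cast
        have : 0 ≤ Q * a := by positivity
        have : 0 ≤ μ * (a + 1) := by positivity
        nlinarith
      have h0 : 0 ≤ Q + ρ * a + ρ := by positivity
      rw [h1, Nat.factorial_succ]
      calc _ ≤ (Q + ρ * a + ρ) ^ ρ * Real.Gamma (Q + ρ * a) := Gamma_add_le (by positivity) hρ
        _ ≤ ((Q + ρ + μ) * (a + 1 : ℕ)) ^ ρ * (Real.Gamma Q * ((Q + ρ + μ) ^ (ρ * a) *
            (a.factorial : ℝ) ^ ρ)) := by gcongr
        _ = _ := by
          rw [Real.mul_rpow hR.le (by positivity), Nat.cast_mul,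
            Real.mul_rpow (by positivity) (by positivity)]
          have : ρ * ((a + 1 : ℕ) : ℝ) = ρ * a + ρ := by
            push_cast
            ring
          rw [this, Real.rpow_add hR]
          ring
  | succ N ih =>
    have h1 : Q + ρ * a + μ * (N + 1 : ℕ) = Q + ρ * a + μ * N + μ := by
      push_cast
      ring
    have h2 : Q + ρ * a + μ * N + μ ≤ (Q + ρ + μ) * (a + 1 + N : ℕ) := by
      push_cast
      have h3 : 0 ≤ Q * (a + N) := by positivity
      have h4 : 0 ≤ ρ * (1 + N) := by positivity
      have h5 : 0 ≤ μ * a := by positivity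
      nlinarith
    have h0 : 0 ≤ Q + ρ * a + μ * N + μ := by positivity
    rw [h1, Nat.ascFactorial_succ]
    calc _ ≤ (Q + ρ * a + μ * N + μ) ^ μ * Real.Gamma (Q + ρ * a + μ * N) :=
          Gamma_add_le (by positivity) hμ
      _ ≤ ((Q + ρ + μ) * (a + 1 + N : ℕ)) ^ μ * (Real.Gamma Q * ((Q + ρ + μ) ^ (ρ * a + μ * N) *
          (a.factorial : ℝ) ^ ρ * ((a + 1).ascFactorial N : ℝ) ^ μ)) := by gcongr
      _ = _ := by
        rw [Real.mul_rpow hR.le (by positivity), Nat.cast_mul,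
          Real.mul_rpow (by positivity) (by positivity)]
        have : ρ * a + μ * ((N + 1 : ℕ) : ℝ) = ρ * a + μ * N + μ := by
          push_cast
          ring
        rw [this, Real.rpow_add hR (ρ * a + μ * N) μ]
        ring

/-- A bound by values of the Gamma function is a bound of anisotropic Gevrey type. -/
theorem exists_gevrey_bound_of_Gamma {n : ℕ} {K C p Q ρ μ : ℝ} (hK : 0 ≤ K) (hC : 0 < C)
    (hQ : 0 < Q) (hρ : 0 ≤ ρ) (hμ : 0 ≤ μ) :
    ∃ L₁ > 0, ∃ L₂ > 0, ∃ M : ℝ, ∀ α β : Fin n → ℕ,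
      K * C ^ (p + multiLength α + μ * multiLength β) *
        Real.Gamma (Q + ρ * multiLength α + μ * multiLength β) ≤
      M * L₁ ^ multiLength α * L₂ ^ multiLength β * multiFactorial α ^ ρ *
        multiFactorial β ^ μ := by
  have hR : 0 < Q + ρ + μ := by positivity
  have hG := Real.Gamma_pos_of_pos hQ
  refine ⟨C * (Q + ρ + μ) ^ ρ * (2 ^ n) ^ ρ * 2 ^ μ, by positivity,
    C ^ μ * (Q + ρ + μ) ^ μ * (2 ^ n) ^ μ * 2 ^ μ, by positivity,
    K * C ^ p * Real.Gamma Q, fun α β => ?_⟩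
  unfold multiLength
  set a := ∑ i, α i with ha
  set N := ∑ i, β i with hN
  have hα := multiFactorial_pos α
  have hβ := multiFactorial_pos β
  -- The rising factorial is `(a+N choose N) N!`, and the binomial coefficient is at most `2^(a+N)`.
  -- This separates the two multi-indices at the price of geometric factors, which go into `L₁` and
  -- `L₂`.
  have h1 : ((a + 1).ascFactorial N : ℝ) ≤ 2 ^ a * 2 ^ N * ((2 ^ n) ^ N * multiFactorial β) := by
    rw [Nat.ascFactorial_eq_factorial_mul_choose, Nat.cast_mul, mul_comm, ← pow_add]
    have h2 : (((a + N).choose N : ℕ) : ℝ) ≤ 2 ^ (a + N) := by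
      exact_mod_cast Nat.choose_le_two_pow _ _
    gcongr
    exact factorial_sum_le_two_pow_mul_multiFactorial β
  have h2 := factorial_sum_le_two_pow_mul_multiFactorial α
  rw [← ha] at h2
  calc _ ≤ K * C ^ (p + a + μ * N) * (Real.Gamma Q * ((Q + ρ + μ) ^ (ρ * a + μ * N) *
        ((2 ^ n) ^ a * multiFactorial α) ^ ρ *
        (2 ^ a * 2 ^ N * ((2 ^ n) ^ N * multiFactorial β)) ^ μ)) := by
        refine mul_le_mul_of_nonneg_left ((Gamma_add_mul_le hQ hρ hμ a N).trans ?_) (by positivity)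
        gcongr
    _ = _ := by
      have hpow : ∀ (b : ℝ) (e : ℝ) (m : ℕ), 0 ≤ b → (b ^ m) ^ e = (b ^ e) ^ m := by
        intro b e m hb
        rw [← Real.rpow_natCast, ← Real.rpow_mul hb, mul_comm, Real.rpow_mul hb,
          Real.rpow_natCast]
      have hpow2 : ∀ (b : ℝ) (e : ℝ) (m : ℕ), 0 ≤ b → b ^ (e * m) = (b ^ e) ^ m := by
        intro b e m hb
        rw [Real.rpow_mul hb, Real.rpow_natCast]
      rw [Real.rpow_add hC, Real.rpow_add hC, Real.rpow_add hR, hpow2 _ _ _ hC.le,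
        hpow2 _ _ _ hR.le, hpow2 _ _ _ hR.le, Real.mul_rpow (by positivity) hα.le,
        Real.mul_rpow (by positivity) (by positivity), Real.mul_rpow (by positivity) (by positivity),
        Real.mul_rpow (by positivity) hβ.le, hpow _ ρ a (by positivity), hpow _ μ a (by positivity),
        hpow _ μ N (by positivity), hpow _ μ N (by positivity)]
      simp only [Real.rpow_natCast, mul_pow]
      ring

end MultiIndex

/-! ### Derivatives along affine sections and mixed derivatives -/

section Sections

variable {V V' F : Type*} [NormedAddCommGroup V] [NormedSpace ℝ V] [NormedAddCommGroup V']
  [NormedSpace ℝ V'] [NormedAddCommGroup F] [NormedSpace ℝ F]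

theorem iterLineDeriv_comp_affine {σ A : V → V'} (h : ∀ x (s : ℝ) v, σ (x + s • v) = σ x + s • A v)
    (g : V' → F) (l : List V) :
    iterLineDeriv l (fun x => g (σ x)) = fun x => iterLineDeriv (l.map A) g (σ x) := by
  induction l with
  | nil => rfl
  | cons v l ih =>
    rw [iterLineDeriv_cons, ih, List.map_cons, iterLineDeriv_cons]
    funext x
    simp only [lineDeriv, h]

end Sections

section MixedDerivatives

variable {n : ℕ} {P F : Type*} [NormedAddCommGroup P]

/-- The directions of a mixed derivative: angle directions, followed by directions of `P`. -/
def mixedDirections (act : Fin n → P) (la lb : List (Fin n)) :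
    List (EuclideanSpace ℝ (Fin n) × P) :=
  ((la.map fun i => EuclideanSpace.single i (1 : ℝ)).map fun z => (z, (0 : P))) ++
    lb.map fun i => (0, act i)

theorem mixedDirections_perm (act : Fin n → P) {la la' lb lb' : List (Fin n)} (ha : la.Perm la')
    (hb : lb.Perm lb') : (mixedDirections act la lb).Perm (mixedDirections act la' lb') :=
  ((ha.map _).map _).append (hb.map _)

variable [NormedSpace ℝ P] [NormedAddCommGroup F] [NormedSpace ℝ F]

/-- The restriction to angle zero either has the same derivative evaluated at angle zero, when no
angle derivative occurs, or derivative zero otherwise. Normalizing the solution at `θ = 0` thus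
costs only a factor `2`. -/
theorem norm_iterLineDeriv_sub_origin_le {U : Set P} (hU : IsOpen U)
    {g : EuclideanSpace ℝ (Fin n) × P → F}
    (hg : ContDiffOn ℝ ∞ g ((univ : Set (EuclideanSpace ℝ (Fin n))) ×ˢ U)) (act : Fin n → P)
    (la lb : List (Fin n)) {x : EuclideanSpace ℝ (Fin n) × P}
    (hx : x ∈ (univ : Set (EuclideanSpace ℝ (Fin n))) ×ˢ U) {B : ℝ}
    (h1 : ‖iterLineDeriv (mixedDirections act la lb) g x‖ ≤ B)
    (h2 : ‖iterLineDeriv (mixedDirections act la lb) g (0, x.2)‖ ≤ B) :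
    ‖iterLineDeriv (mixedDirections act la lb) (fun y => g y - g (0, y.2)) x‖ ≤ 2 * B := by
  have hW : IsOpen ((univ : Set (EuclideanSpace ℝ (Fin n))) ×ˢ U) := isOpen_univ.prod hU
  have hg0 : ContDiffOn ℝ ∞ (fun y : EuclideanSpace ℝ (Fin n) × P => g (0, y.2))
      ((univ : Set (EuclideanSpace ℝ (Fin n))) ×ˢ U) :=
    hg.comp (contDiff_const.prodMk contDiff_snd).contDiffOn fun y hy => ⟨mem_univ _, hy.2⟩
  have hB : 0 ≤ B := (norm_nonneg _).trans h1
  have h3 : ‖iterLineDeriv (mixedDirections act la lb)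
      (fun y : EuclideanSpace ℝ (Fin n) × P => g (0, y.2)) x‖ ≤ B := by
    rw [iterLineDeriv_comp_affine (σ := fun y : EuclideanSpace ℝ (Fin n) × P => (0, y.2))
      (A := fun y => (0, y.2)) (fun y s v => by simp)]
    cases la with
    | nil =>
      have : (mixedDirections act [] lb).map
          (fun y : EuclideanSpace ℝ (Fin n) × P => ((0 : EuclideanSpace ℝ (Fin n)), y.2)) =
          mixedDirections act [] lb := by
        simp [mixedDirections]
      rwa [this]
    | cons i la =>
      simp only [mixedDirections, List.map_cons, List.cons_append, iterLineDeriv_cons]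
      rw [← Prod.zero_eq_mk, lineDeriv_zero, norm_zero]
      exact hB
  rw [iterLineDeriv_sub hg hg0 hW _ hx]
  exact (norm_sub_le _ _).trans (by linarith)

/-- The action directions, in a space of actions and times. -/
def actionDirection (i : Fin n) : EuclideanSpace ℝ (Fin n) × ℝ := (EuclideanSpace.single i 1, 0)

theorem mixedDeriv_eq_iterLineDeriv
    (g : EuclideanSpace ℝ (Fin n) × EuclideanSpace ℝ (Fin n) × ℝ → F) (α β : Fin n → ℕ)
    (θ I : EuclideanSpace ℝ (Fin n)) (t : ℝ) :
    mixedDeriv α β (fun θ I => g (θ, I, t)) θ I =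
      iterLineDeriv (mixedDirections actionDirection (multiIndexList α) (multiIndexList β)) g
        (θ, I, t) := by
  rw [mixedDirections, iterLineDeriv_append, mixedDeriv, multiDeriv_eq_iterLineDeriv]
  have h1 : ∀ θ', multiDeriv β (fun I' => g (θ', I', t)) I = iterLineDeriv
      ((multiIndexList β).map fun i => (0, actionDirection i)) g (θ', I, t) := by
    intro θ'
    rw [multiDeriv_eq_iterLineDeriv, iterLineDeriv_comp_affine
      (σ := fun I' : EuclideanSpace ℝ (Fin n) => (θ', I', t)) (A := fun v => (0, v, 0))
      (fun y s v => by simp), List.map_map]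
    rfl
  simp only [h1]
  rw [iterLineDeriv_comp_affine
    (σ := fun θ' : EuclideanSpace ℝ (Fin n) => (θ', I, t)) (A := fun v => (v, 0))
    (fun y s v => by simp)]

theorem multiDeriv_eq_iterLineDeriv_actionDirection
    (g : EuclideanSpace ℝ (Fin n) × ℝ → F) (β : Fin n → ℕ)
    (θ I : EuclideanSpace ℝ (Fin n)) (t : ℝ) :
    multiDeriv β (fun I => g (I, t)) I = iterLineDeriv
      ((multiIndexList β).map fun i => ((0 : EuclideanSpace ℝ (Fin n)), actionDirection i))
      (fun x => g x.2) (θ, I, t) := by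
  rw [multiDeriv_eq_iterLineDeriv, iterLineDeriv_comp_affine
    (σ := fun I' : EuclideanSpace ℝ (Fin n) => (I', t)) (A := fun v => (v, 0))
    (fun y s v => by simp), iterLineDeriv_comp_affine
    (σ := fun x : EuclideanSpace ℝ (Fin n) × EuclideanSpace ℝ (Fin n) × ℝ => x.2)
    (A := fun v => v.2) (fun y s v => by simp)]
  simp only [List.map_map]
  rfl

end MixedDerivatives

/-! ### From the hypotheses on `f` and `ω` to bounds along lists of directions -/

section HomologicalEquation

variable {n : ℕ}

/-- Bounds on the mixed derivatives of a family pass to arbitrary orders of differentiation. -/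
theorem norm_iterLineDeriv_mixedDirections_le {D : Set (EuclideanSpace ℝ (Fin n))}
    {J : Set ℝ} (hD : IsOpen D) (hJ : IsOpen J)
    {g : EuclideanSpace ℝ (Fin n) × EuclideanSpace ℝ (Fin n) × ℝ → ℂ}
    (hg : ContDiffOn ℝ ∞ g (univ ×ˢ D ×ˢ J)) {c : ℝ → ℝ → ℝ} {t : ℝ} (ht : t ∈ J)
    (hc : ∀ α β : Fin n → ℕ, ∀ θ, ∀ I ∈ D, ‖mixedDeriv α β (fun θ I => g (θ, I, t)) θ I‖ ≤
      c (multiLength α) (multiLength β)) (la lb : List (Fin n))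
    (θ : EuclideanSpace ℝ (Fin n)) {I : EuclideanSpace ℝ (Fin n)} (hI : I ∈ D) :
    ‖iterLineDeriv (mixedDirections actionDirection la lb) g (θ, I, t)‖ ≤
      c la.length lb.length := by
  have hW : IsOpen ((univ : Set (EuclideanSpace ℝ (Fin n))) ×ˢ D ×ˢ J) :=
    isOpen_univ.prod (hD.prod hJ)
  rw [iterLineDeriv_perm hg hW (mixedDirections_perm _ (multiIndexList_count_perm la)
    (multiIndexList_count_perm lb)) ⟨mem_univ _, hI, ht⟩, ← mixedDeriv_eq_iterLineDeriv]
  refine (hc _ _ θ I hI).trans_eq ?_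
  simp only [multiLength, sum_count]

/-- A bound of the Gevrey norm of a family passes to arbitrary orders of differentiation. -/
theorem GevreyNormLE.norm_iterLineDeriv_le {D : Set (EuclideanSpace ℝ (Fin n))} {J : Set ℝ}
    (hD : IsOpen D) (hJ : IsOpen J)
    {g : EuclideanSpace ℝ (Fin n) × ℝ → EuclideanSpace ℝ (Fin n)}
    (hg : ContDiffOn ℝ ∞ g (D ×ˢ J)) {s L M t : ℝ} (hs : 0 ≤ s) (hL : 0 ≤ L) (hM : 0 ≤ M)
    (ht : t ∈ J) (h : GevreyNormLE s L D (fun I => g (I, t)) M)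
    (θ : EuclideanSpace ℝ (Fin n)) {I : EuclideanSpace ℝ (Fin n)} (hI : I ∈ D)
    (lb : List (Fin n)) :
    ‖iterLineDeriv (lb.map fun i => ((0 : EuclideanSpace ℝ (Fin n)), actionDirection i))
      (fun x : EuclideanSpace ℝ (Fin n) × EuclideanSpace ℝ (Fin n) × ℝ => g x.2) (θ, I, t)‖ ≤
      M * L ^ lb.length * (lb.length.factorial : ℝ) ^ s := by
  have hW : IsOpen ((univ : Set (EuclideanSpace ℝ (Fin n))) ×ˢ D ×ˢ J) :=
    isOpen_univ.prod (hD.prod hJ)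
  have hg' : ContDiffOn ℝ ∞
      (fun x : EuclideanSpace ℝ (Fin n) × EuclideanSpace ℝ (Fin n) × ℝ => g x.2)
      (univ ×ˢ D ×ˢ J) := hg.comp contDiff_snd.contDiffOn fun x hx => hx.2
  rw [iterLineDeriv_perm hg' hW ((multiIndexList_count_perm lb).map _) ⟨mem_univ _, hI, ht⟩,
    ← multiDeriv_eq_iterLineDeriv_actionDirection]
  refine (h _ I hI).trans ?_
  have h1 := multiFactorial_le_factorial_sum fun i => lb.count i
  have h2 := multiFactorial_pos fun i => lb.count i
  simp only [multiLength, Real.rpow_natCast]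
  rw [sum_count] at h1 ⊢
  gcongr

theorem GevreyNormLE.nonneg {D : Set (EuclideanSpace ℝ (Fin n))}
    {g : EuclideanSpace ℝ (Fin n) → EuclideanSpace ℝ (Fin n)} {s L M : ℝ}
    (h : GevreyNormLE s L D g M) (hD : D.Nonempty) : 0 ≤ M := by
  obtain ⟨I, hI⟩ := hD
  have h1 := (norm_nonneg _).trans (h 0 I hI)
  simpa [multiLength, multiFactorial] using h1

theorem AnglePeriodicOn.fourierMode {P : Type*} [NormedAddCommGroup P] {U : Set P}
    {F : EuclideanSpace ℝ (Fin n) × P → ℂ} (hF : AnglePeriodicOn U F) (k : Fin n → ℤ) :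
    AnglePeriodicOn U (fourierMode k F) := by
  intro x hx i
  rw [_root_.fourierMode, _root_.fourierMode]
  congr 1
  funext y
  rw [add_angle_add_angle, add_comm (EuclideanSpace.single i (2 * Real.pi)), ← add_angle_add_angle,
    hF _ (add_prod_zero_mem hx _) i]

theorem AnglePeriodicOn.tsum_resonantMode {P : Type*} [NormedAddCommGroup P] {U : Set P}
    {F : EuclideanSpace ℝ (Fin n) × P → ℂ} (hF : AnglePeriodicOn U F) (τ : ℝ) (h : ℝ → ℝ)
    {Wq : EuclideanSpace ℝ (Fin n) × P → EuclideanSpace ℝ (Fin n)}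
    (hWq : ∀ x z, Wq (x + (z, 0)) = Wq x) :
    AnglePeriodicOn U (fun x => ∑' k, resonantMode τ h Wq F k x) := by
  intro x hx i
  refine tsum_congr fun k => ?_
  rw [resonantMode, resonantMode, hWq, hF.fourierMode k x hx i]

end HomologicalEquation

end

/-! ### The homological equation -/

theorem mainTheorem8 (n : ℕ) (ρ τ μ κ L₀ : ℝ) (hρ : 1 ≤ ρ) (hτ : (n : ℝ) - 1 < τ)
    (hμ : ρ * (τ + 1) + 1 < μ) (hκ : 0 < κ) (hL₀ : 0 < L₀) :
    -- the constant `A M` depends on `n, ρ, τ, μ`, on the fixed data `κ, L₀`,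
    -- and on a bound `M` of the Gevrey norm of the frequency map
    ∃ A : ℝ → ℝ, (∀ M, 0 < A M) ∧
      ∀ D Ω : Set (EuclideanSpace ℝ (Fin n)), IsOpen D → IsOpen Ω →
      ∀ f : EuclideanSpace ℝ (Fin n) → EuclideanSpace ℝ (Fin n) → ℝ → ℂ,
      -- `f(·,·;t)` is a smooth family in `G^{ρ,μ}(𝕋ⁿ × D)`
      (∀ t ∈ Set.Ioo (-1 : ℝ) 1, MemTorusGevrey ρ μ D (fun θ I => f θ I t)) →
      ContDiffOn ℝ ∞
        (fun p : EuclideanSpace ℝ (Fin n) × EuclideanSpace ℝ (Fin n) × ℝ => f p.1 p.2.1 p.2.2)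
        (Set.univ ×ˢ D ×ˢ Set.Ioo (-1 : ℝ) 1) →
      ∀ d₀ C q : ℝ, 1 ≤ C → 0 < q →
      (∀ t ∈ Set.Ioo (-1 : ℝ) 1, ∀ α β : Fin n → ℕ, ∀ θ, ∀ I ∈ D,
        ‖mixedDeriv α β (fun θ I => f θ I t) θ I‖ ≤
          d₀ * C ^ (multiLength α + μ * multiLength β) *
            Real.Gamma (ρ * multiLength α + μ * multiLength β + q)) →
      (∀ t ∈ Set.Ioo (-1 : ℝ) 1, ∀ I ∈ D, integralOverTorus (fun θ => f θ I t) = 0) →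
      ∀ freq : EuclideanSpace ℝ (Fin n) → ℝ → EuclideanSpace ℝ (Fin n),
      -- `freq(·;t)` is a smooth family in `G^{ρ'}_{L₀}(D, Ω)`, `ρ' = ρ(τ+1)+1`
      (∀ t ∈ Set.Ioo (-1 : ℝ) 1, MemGevrey (ρ * (τ + 1) + 1) L₀ D Ω (fun I => freq I t)) →
      ContDiffOn ℝ ∞ (fun p : EuclideanSpace ℝ (Fin n) × ℝ => freq p.1 p.2)
        (D ×ˢ Set.Ioo (-1 : ℝ) 1) →
      ∃ u : EuclideanSpace ℝ (Fin n) → EuclideanSpace ℝ (Fin n) → ℝ → ℂ,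
        (∀ t ∈ Set.Ioo (-1 : ℝ) 1, MemTorusGevrey ρ μ D (fun θ I => u θ I t)) ∧
        ContDiffOn ℝ ∞
          (fun p : EuclideanSpace ℝ (Fin n) × EuclideanSpace ℝ (Fin n) × ℝ => u p.1 p.2.1 p.2.2)
          (Set.univ ×ˢ D ×ˢ Set.Ioo (-1 : ℝ) 1) ∧
        (∀ t ∈ Set.Ioo (-1 : ℝ) 1, ∀ θ, ∀ I ∈ nonresonantActions τ κ D Ω (fun I => freq I t),
          directionalOp (freq I t) (fun θ => u θ I t) θ = f θ I t) ∧
        (∀ t ∈ Set.Ioo (-1 : ℝ) 1, ∀ I ∈ D, u 0 I t = 0) ∧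
        ∀ t ∈ Set.Ioo (-1 : ℝ) 1, ∀ M : ℝ,
          GevreyNormLE (ρ * (τ + 1) + 1) L₀ D (fun I => freq I t) M →
          ∀ α β : Fin n → ℕ, ∀ θ, ∀ I ∈ D,
            ‖mixedDeriv α β (fun θ I => u θ I t) θ I‖ ≤
              A M * d₀ * C ^ ((n : ℝ) + τ + multiLength α + μ * multiLength β + 1) *
                Real.Gamma (ρ * multiLength α + μ * multiLength β +
                  ρ * ((n : ℝ) + τ + 1) + q) := by
  -- The midpoint of the interval `(1, μ - ρ(τ+1))`, which is nonempty because `μ > ρ'`.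
  set s := 1 + (μ - (ρ * (τ + 1) + 1)) / 2 with hs_def
  have hs : 1 < s := by linarith
  have hsμ : ρ * (τ + 1) + s < μ := by linarith
  have hn0 : (0 : ℝ) ≤ n := Nat.cast_nonneg n
  have hτ1 : 0 ≤ ρ * (τ + 1) := mul_nonneg (by linarith) (by linarith)
  obtain ⟨h, hh, hinv, Ah, Bh, hA, hB, hhB⟩ := exists_gevrey_inverse hs hκ
  have hB0 : 0 ≤ Bh := by linarith
  have hhb : ∀ j, ∃ C : ℝ, ∀ y, |iteratedDeriv j h y| ≤ C := fun j => ⟨_, fun y => hhB y j⟩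
  have hw := summable_inv_frequencyLength_pow n
  have hw0 : ∀ k : Fin n → ℤ, 0 ≤ ((1 + frequencyLength k) ^ (n + 1))⁻¹ := fun k => by
    have := frequencyLength_nonneg k
    positivity
  set Z := ∑' k : Fin n → ℤ, ((1 + frequencyLength k) ^ (n + 1))⁻¹ with hZ
  have hZ0 : 0 ≤ Z := tsum_nonneg hw0
  have hmc : ∀ M, 0 ≤ modeConstant n ρ τ μ L₀ Ah Bh s (max M 0) := fun M =>
    modeConstant_nonneg (by linarith) hA hB0 hL₀.le (le_max_right _ _)
  have hApos : ∀ M, 0 < 2 * (2 ^ (n + 1) * Z * modeConstant n ρ τ μ L₀ Ah Bh s (max M 0)) + 1 :=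
    fun M => by
      have := hmc M
      positivity
  -- The factor `2` pays for the normalization at `θ = 0`, and `2^(n+1) Z` for the sum over
  -- frequencies. The maximum gives meaning to negative `M`, which can occur only for empty `D`, and
  -- `+ 1` makes the constant strictly positive.
  refine ⟨fun M => 2 * (2 ^ (n + 1) * Z * modeConstant n ρ τ μ L₀ Ah Bh s (max M 0)) + 1, hApos, ?_⟩
  intro D Ω hD hΩ f hf hfs d₀ C q hC hq hfb hf0 freq hfreq hfreqs
  have hJ : IsOpen (Ioo (-1 : ℝ) 1) := isOpen_Ioo
  have hU := hD.prod hJ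
  have hW : IsOpen ((univ : Set (EuclideanSpace ℝ (Fin n))) ×ˢ D ×ˢ Ioo (-1 : ℝ) 1) :=
    isOpen_univ.prod hU
  -- The series divides by `⟨ω,k⟩` rather than `i⟨ω,k⟩`, so it solves the equation with right side
  -- `iF`; the factor `-i` corrects this.
  set F : EuclideanSpace ℝ (Fin n) × EuclideanSpace ℝ (Fin n) × ℝ → ℂ :=
    fun x => -Complex.I * f x.1 x.2.1 x.2.2 with hF_def
  set Wq : EuclideanSpace ℝ (Fin n) × EuclideanSpace ℝ (Fin n) × ℝ → EuclideanSpace ℝ (Fin n) :=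
    fun x => freq x.2.1 x.2.2 with hWq_def
  have hWq : ∀ x z, Wq (x + (z, 0)) = Wq x := fun x z => by simp [hWq_def]
  have hWs : ContDiffOn ℝ ∞ Wq (univ ×ˢ D ×ˢ Ioo (-1 : ℝ) 1) :=
    hfreqs.comp contDiff_snd.contDiffOn fun x hx => hx.2
  have hFs : ContDiffOn ℝ ∞ F (univ ×ˢ D ×ˢ Ioo (-1 : ℝ) 1) := contDiffOn_const.mul hfs
  have hF : AnglePeriodicOn (D ×ˢ Ioo (-1 : ℝ) 1) F := by
    rintro ⟨θ, I, t⟩ ⟨-, hI, ht⟩ i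
    simp only [hF_def, Prod.mk_add_mk, add_zero]
    exact congrArg _ ((hf t ht).1 θ I hI i)
  have hF0 : EqOn (fourierMode 0 F) 0 (univ ×ˢ D ×ˢ Ioo (-1 : ℝ) 1) := by
    intro x hx
    rw [hF.fourierMode_zero hx]
    have h1 := hf0 x.2.2 hx.2.2 x.2.1 hx.2.1
    rw [integralOverTorus] at h1 ⊢
    simp only [hF_def]
    rw [integral_const_mul, h1]
    simp
  have hfam := summableFamily_resonantMode (τ := τ) hU hh hhb hF hFs hWs
  set S : EuclideanSpace ℝ (Fin n) × EuclideanSpace ℝ (Fin n) × ℝ → ℂ :=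
    fun x => ∑' k, resonantMode τ h Wq F k x with hS_def
  have hSs : ContDiffOn ℝ ∞ S (univ ×ˢ D ×ˢ Ioo (-1 : ℝ) 1) := hfam.contDiffOn_tsum hW hw hw0
  have hSp : AnglePeriodicOn (D ×ˢ Ioo (-1 : ℝ) 1) S := hF.tsum_resonantMode τ h hWq
  have hus : ContDiffOn ℝ ∞ (fun x => S x - S (0, x.2)) (univ ×ˢ D ×ˢ Ioo (-1 : ℝ) 1) :=
    hSs.sub (hSs.comp (contDiff_const.prodMk contDiff_snd).contDiffOn
      fun x hx => ⟨mem_univ _, hx.2⟩)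
  have hd : ∀ t ∈ Ioo (-1 : ℝ) 1, ∀ I ∈ D, 0 ≤ d₀ := by
    intro t ht I hI
    have h1 := (norm_nonneg _).trans (hfb t ht 0 0 0 I hI)
    have h2 : 0 < Real.Gamma q := Real.Gamma_pos_of_pos hq
    simp only [multiLength, Pi.zero_apply, Finset.sum_const_zero, Nat.cast_zero, mul_zero, add_zero,
      Real.rpow_zero, mul_one, zero_add] at h1
    exact nonneg_of_mul_nonneg_left h1 h2
  have hFb : ∀ t ∈ Ioo (-1 : ℝ) 1, ∀ (la lb : List (Fin n)) (θ : EuclideanSpace ℝ (Fin n)),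
      ∀ I ∈ D, ‖iterLineDeriv (mixedDirections actionDirection la lb) F (θ, I, t)‖ ≤
        d₀ * C ^ ((la.length : ℝ) + μ * lb.length) *
          Real.Gamma (ρ * la.length + μ * lb.length + q) := by
    intro t ht la lb θ I hI
    have h1 := iterLineDeriv_clm_comp (-Complex.I • ContinuousLinearMap.id ℝ ℂ) hfs hW
      (mixedDirections actionDirection la lb) (x := (θ, I, t)) ⟨mem_univ _, hI, ht⟩
    simp only [smul_apply, ContinuousLinearMap.id_apply, smul_eq_mul] at h1
    rw [hF_def, h1, norm_mul, norm_neg, Complex.norm_I, one_mul]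
    exact norm_iterLineDeriv_mixedDirections_le (c := fun a b => d₀ * C ^ (a + μ * b) *
      Real.Gamma (ρ * a + μ * b + q)) hD hJ hfs ht (hfb t ht) la lb θ hI
  have hest : ∀ t ∈ Ioo (-1 : ℝ) 1, ∀ M : ℝ,
      GevreyNormLE (ρ * (τ + 1) + 1) L₀ D (fun I => freq I t) M →
      ∀ α β : Fin n → ℕ, ∀ θ, ∀ I ∈ D,
        ‖mixedDeriv α β (fun θ I => S (θ, I, t) - S (0, I, t)) θ I‖ ≤
          (2 * (2 ^ (n + 1) * Z * modeConstant n ρ τ μ L₀ Ah Bh s (max M 0)) + 1) * d₀ *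
            C ^ ((n : ℝ) + τ + multiLength α + μ * multiLength β + 1) *
            Real.Gamma (ρ * multiLength α + μ * multiLength β + ρ * ((n : ℝ) + τ + 1) + q) := by
    intro t ht M hM α β θ I hI
    have hM0 : 0 ≤ M := hM.nonneg ⟨I, hI⟩
    have hd0 := hd t ht I hI
    have hbd := fun θ' : EuclideanSpace ℝ (Fin n) =>
      norm_iterLineDeriv_tsum_resonantMode_le hU hh hF hFs hWs hWq hF0 hρ hτ
        hs hsμ hA hB0 hL₀.le hM0 hd0 hC hq hhB actionDirection (x := (θ', I, t))
        ⟨mem_univ _, hI, ht⟩ (fun z la lb => by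
          simp only [Prod.mk_add_mk, add_zero]
          exact hFb t ht la lb (θ' + z) I hI)
        (fun lb => hM.norm_iterLineDeriv_le hD hJ (g := fun p => freq p.1 p.2) hfreqs
          (by linarith) hL₀.le hM0 ht θ' hI lb) (multiIndexList α) (multiIndexList β)
    have h1 := norm_iterLineDeriv_sub_origin_le hU hSs actionDirection (multiIndexList α)
      (multiIndexList β) (x := (θ, I, t)) ⟨mem_univ _, hI, ht⟩ (hbd θ) (hbd 0)
    rw [← mixedDeriv_eq_iterLineDeriv (fun x => S x - S (0, x.2))] at h1
    refine h1.trans ?_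
    rw [length_multiIndexList, length_multiIndexList, max_eq_left hM0]
    have hl1 : 0 ≤ multiLength α := Nat.cast_nonneg _
    have hl2 : 0 ≤ multiLength β := Nat.cast_nonneg _
    have hG : 0 ≤ Real.Gamma (ρ * multiLength α + μ * multiLength β +
        ρ * ((n : ℝ) + τ + 1) + q) := by
      have h2 : 0 ≤ ρ * ((n : ℝ) + τ + 1) := mul_nonneg (by linarith) (by linarith)
      have h3 : 0 ≤ μ := by linarith
      exact Real.Gamma_nonneg_of_nonneg (by positivity)
    have h4 : 0 ≤ d₀ * C ^ ((n : ℝ) + τ + multiLength α + μ * multiLength β + 1) *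
        Real.Gamma (ρ * multiLength α + μ * multiLength β + ρ * ((n : ℝ) + τ + 1) + q) := by
      positivity
    unfold multiLength at h4 ⊢
    linarith
  refine ⟨fun θ I t => S (θ, I, t) - S (0, I, t), fun t ht => ⟨?_, ?_, ?_⟩, hus, ?_,
    fun t ht I hI => sub_self _, hest⟩
  · intro θ I hI i
    have h1 := hSp (θ, I, t) ⟨mem_univ _, hI, ht⟩ i
    simp only [Prod.mk_add_mk, add_zero] at h1
    simp only [h1]
  · exact hus.comp (contDiff_fst.prodMk (contDiff_snd.prodMk contDiff_const)).contDiffOn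
      fun p hp => ⟨mem_univ _, hp.2, ht⟩
  · obtain ⟨M, hM⟩ := (hfreq t ht).2.2
    have hQ : 0 < ρ * ((n : ℝ) + τ + 1) + q := by
      have h2 : 0 ≤ ρ * ((n : ℝ) + τ + 1) := mul_nonneg (by linarith) (by linarith)
      linarith
    -- The sign of `d₀` is known only at a point of `D`, whereas `L₁`, `L₂` and the bound must be
    -- chosen beforehand; hence the absolute value.
    have hK := mul_nonneg (hApos M).le (abs_nonneg d₀)
    obtain ⟨L₁, hL₁, L₂, hL₂, M', hM'⟩ := exists_gevrey_bound_of_Gamma (n := n) (C := C)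
      (p := (n : ℝ) + τ + 1) (ρ := ρ) (μ := μ) hK (by linarith) hQ (by linarith) (by linarith)
    refine ⟨L₁, hL₁, L₂, hL₂, M', fun α β θ I hI => (hest t ht M hM α β θ I hI).trans ?_⟩
    refine le_trans (le_of_eq ?_) (hM' α β)
    rw [abs_of_nonneg (hd t ht I hI)]
    ring_nf
  · rintro t ht θ I ⟨hI, hΩI, hres, -⟩
    have h1 := sum_lineDeriv_tsum_resonantMode hU hh hhb hF hFs hWs hWq hF0 hκ hinv
      (x := (θ, I, t)) ⟨mem_univ _, hI, ht⟩ hres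
    rw [directionalOp]
    have h2 : ∀ i : Fin n, partialDeriv i (fun θ => S (θ, I, t) - S (0, I, t)) θ =
        lineDeriv ℝ S (θ, I, t) (EuclideanSpace.single i 1, 0) := by
      intro i
      simp [partialDeriv, lineDeriv, deriv_sub_const]
    simp only [h2]
    refine h1.trans ?_
    simp only [hF_def]
    rw [neg_mul, mul_neg, ← mul_assoc, Complex.I_mul_I]
    simp
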